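/- For a set $V$, a \emph{$3$-colouring template} on $V$ is a triple $\mathbf G=(G_1,G_2,G_3)$ of graphs on $V$ (edges may lie in several $G_i$). A \emph{rainbow triangle} in $\mathbf G$ consists of distinct vertices $u,v,w$ and an ordering $(i,j,k)$ of $\{1,2,3\}$ with $uv\in E(G_i)$, $vw\in E(G_j)$, $uw\in E(G_k)$. A triple $(\alpha_1,\alpha_2,\alpha_3)\in[0,1]^3$ is a \emph{forcing triple} if for all sufficiently large $n$ every $n$-vertex $3$-colouring template with $|E(G_i)|>\min\left(\frac{\alpha_i}{2}n^2,\binom n2-1\right)$ for $i=1,2,3$ contains a rainbow triangle. For a partition $V=A\sqcup B\sqcup C$ with $|A|=a$, $|B|=b$, $|C|=c$, write $S^{(2)}$ for the set of unordered pairs of distinct elements of $S$ and $(S,T)^{(2)}$ for the set of pairs with one element in $S$ and one in $T$. Let $\mathbf F(a,b,c)=(F_1,F_2,F_3)$ and $\mathbf H(a,b,c)=(H_1,H_2,H_3)$ be (any instance of) the templates $$F_1=A^{(2)}\cup B^{(2)},\quad F_2=A^{(2)}\cup C^{(2)},\quad F_3=V^{(2)}\setminus A^{(2)},$$ $$H_1=A^{(2)}\cup(B\cup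 C)^{(2)}\cup(A,C)^{(2)},\quad H_2=A^{(2)},\quad H_3=(B\cup C)^{(2)}\cup(A,B)^{(2)}.$$ Let $\tau=\frac{4-\sqrt7}{9}$. Let $\mathcal R_1$ be the set of $(\alpha_1,\alpha_2)\in[0,1]^2$ with $$\max\left(1-\alpha_2,\tfrac{1+\tau^2}{2},\alpha_2\right)\le\alpha_1\le 1-2\sqrt{\alpha_2}+2\alpha_2.$$ A \emph{canonical representation} of $(\alpha_1,\alpha_2)$ is a pair $(x,y)$ of non-negative reals with $x\ge\frac12$, $x+y\le1$, $\alpha_1=x^2+y^2$ and $\alpha_2=x^2+(1-x-y)^2$; it is unique if it exists. Let $\mathcal R_1'$ be the set of $(\alpha_1,\alpha_2)\in\mathcal R_1$ that have a canonical representation $(x,y)$ with $2x^2+(1-x-y)^2\ge1$. Let $\mathcal R_2$ be the set of $(\alpha_1,\alpha_2)\in[0,1]^2$ with $\alpha_1\ge\max\left(2-2\sqrt{\alpha_2},\,1-2\sqrt{\alpha_2}+2\alpha_2\right)$. \textbf{Theorem.} There exists a constant $K>0$ such that for all $(\alpha_1,\alpha_2)\in[0,1]^2$ with $\alpha_1\ge\alpha_2$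 the following hold. (a) If $(\alpha_1,\alpha_2)\in\mathcal R_1'$, with canonical representation $(x,y)$, and $\alpha_3:=1-x^2$, then: (i) $\alpha_2\ge\alpha_3$; (ii) for every integer $n\ge1$, every $n$-vertex $3$-colouring template with $|E(G_i)|\ge\alpha_i\binom n2+Kn$ for $i=1,2,3$ contains a rainbow triangle; (iii) for every integer $n\ge1$, setting $a=\lfloor xn\rfloor$, $b=\lfloor yn\rfloor$ one has $a+b\le n$, and with $c=n-a-b$ the $n$-vertex template $\mathbf F(a,b,c)$ satisfies $|E(F_i)|\ge\alpha_i\binom n2-Kn$ for $i=1,2,3$ and contains no rainbow triangle. In particular, a triple $(\alpha_1',\alpha_2',\alpha_3')\in[0,1]^3$ is not forcing if for each $i$ either $\alpha_i'<\alpha_i$ or $\alpha_i'=0$, and is forcing if for each $i$ either $\alpha_i'>\alpha_i$ or $\alpha_i'=1$. Moreover $\alpha_3$ is the least $t$ such that $(\alpha_1,\alpha_2,t)$ is a forcing triple. (b) If $(\alpha_1,\alpha_2)\in\mathcal R_2$ and $\alpha_3:=2-\alpha_1-2\sqrt{\alpha_2}+\alpha_2$, then (i), (ii), the "in particular" statement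 and the minimality statement of (a) hold for this $\alpha_3$, and: (iii) for every integer $n\ge1$, setting $a=\lfloor\sqrt{\alpha_2}\,n\rfloor$, $b=\left\lfloor\frac{1-\alpha_1}{2\sqrt{\alpha_2}}n\right\rfloor$ one has $a+b\le n$, and with $c=n-a-b$ the $n$-vertex template $\mathbf H(a,b,c)$ satisfies $|E(H_i)|\ge\alpha_i\binom n2-Kn$ for $i=1,2,3$ and contains no rainbow triangle. (c) If $(\alpha_1,\alpha_2)\notin\mathcal R_1'\cup\mathcal R_2$, then $(\alpha_1,\alpha_2,\alpha_2)$ is not a forcing triple. -/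

import Mathlib

namespace RainbowTriangle

/-- An `r`-colouring template on the vertex set `V`: an `r`-tuple of graphs on `V`
(which may share edges). -/
abbrev ColouringTemplate (r : ℕ) (V : Type*) := Fin r → SimpleGraph V

/-- The number of edges of a graph on a finite vertex set. -/
noncomputable def edgeCount {V : Type*} (G : SimpleGraph V) : ℕ := G.edgeSet.ncard

/-- The template contains a triangle whose three edges lie in colour classes of three different
colours. (The vertices `u`, `v`, `w` are distinct, since adjacency is irreflexive.) -/
def HasRainbowTriangle {r : ℕ} {V : Type*} (G : ColouringTemplate r V) : Prop :=
  ∃ u v w : V, ∃ i j k : Fin r, i ≠ j ∧ j ≠ k ∧ i ≠ k ∧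
    (G i).Adj u v ∧ (G j).Adj v w ∧ (G k).Adj u w

/-- A triple of densities in `[0,1]³` is forcing if, for all large `n`, every `n`-vertex
`3`-colouring template with `e(Gᵢ) > min (αᵢ n² / 2, n.choose 2 - 1)` for each `i` contains a
rainbow triangle. -/
def IsForcingTriple (α : Fin 3 → ℝ) : Prop :=
  (∀ i, α i ∈ Set.Icc (0 : ℝ) 1) ∧
    ∀ᶠ n : ℕ in Filter.atTop, ∀ G : ColouringTemplate 3 (Fin n),
      (∀ i, min (α i / 2 * (n : ℝ) ^ 2) ((n.choose 2 : ℝ) - 1) < (edgeCount (G i) : ℝ)) →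
        HasRainbowTriangle G

/-- `S⁽²⁾`: all pairs of distinct vertices of `S`, as the edge set of a graph on `V`. -/
def pairsIn {V : Type*} (S : Set V) : SimpleGraph V where
  Adj u v := u ≠ v ∧ u ∈ S ∧ v ∈ S
  symm := ⟨fun _ _ h => ⟨h.1.symm, h.2.2, h.2.1⟩⟩
  loopless := ⟨fun _ h => h.1 rfl⟩

/-- `(S, T)⁽²⁾`: all pairs with one vertex in `S` and one vertex in `T`, as the edge set of a graph
on `V`. -/
def pairsBetween {V : Type*} (S T : Set V) : SimpleGraph V where
  Adj u v := u ≠ v ∧ (u ∈ S ∧ v ∈ T ∨ u ∈ T ∧ v ∈ S)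
  symm := ⟨fun _ _ h => ⟨h.1.symm, h.2.symm.imp And.symm And.symm⟩⟩
  loopless := ⟨fun _ h => h.1 rfl⟩

/-- `V` is the disjoint union of `A`, `B`, `C`, of sizes `a`, `b`, `c`. -/
def IsTripartition {V : Type*} (A B C : Set V) (a b c : ℕ) : Prop :=
  A ∪ B ∪ C = Set.univ ∧ Disjoint A B ∧ Disjoint A C ∧ Disjoint B C ∧
    A.ncard = a ∧ B.ncard = b ∧ C.ncard = c

/-- The template `F` on the parts `A`, `B`, `C`. -/
def templateF {V : Type*} (A B C : Set V) : ColouringTemplate 3 V :=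
  ![pairsIn A ⊔ pairsIn B, pairsIn A ⊔ pairsIn C, (pairsIn A)ᶜ]

/-- The template `H` on the parts `A`, `B`, `C`. -/
def templateH {V : Type*} (A B C : Set V) : ColouringTemplate 3 V :=
  ![pairsIn A ⊔ pairsIn (B ∪ C) ⊔ pairsBetween A C,
    pairsIn A,
    pairsIn (B ∪ C) ⊔ pairsBetween A B]

/-- `τ = (4 - √7) / 9`. -/
noncomputable def tau : ℝ := (4 - √7) / 9

/-- The region `R₁`. -/
def regionR1 : Set (ℝ × ℝ) :=
  {p | p.1 ∈ Set.Icc (0 : ℝ) 1 ∧ p.2 ∈ Set.Icc (0 : ℝ) 1 ∧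
    max (max (1 - p.2) ((1 + tau ^ 2) / 2)) p.2 ≤ p.1 ∧
    p.1 ≤ 1 - 2 * √p.2 + 2 * p.2}

/-- `(x, y)` is a canonical representation of `(α₁, α₂)`. -/
def IsCanonicalRep (α₁ α₂ x y : ℝ) : Prop :=
  0 ≤ x ∧ 0 ≤ y ∧ 1 / 2 ≤ x ∧ x + y ≤ 1 ∧
    α₁ = x ^ 2 + y ^ 2 ∧ α₂ = x ^ 2 + (1 - x - y) ^ 2

/-- The region `R₁'`: the points of `R₁` whose canonical representation `(x, y)` satisfies
`2x² + (1 - x - y)² ≥ 1`. -/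
def regionR1' : Set (ℝ × ℝ) :=
  {p | p ∈ regionR1 ∧
    ∃ x y : ℝ, IsCanonicalRep p.1 p.2 x y ∧ 1 ≤ 2 * x ^ 2 + (1 - x - y) ^ 2}

/-- The region `R₂`. -/
def regionR2 : Set (ℝ × ℝ) :=
  {p | p.1 ∈ Set.Icc (0 : ℝ) 1 ∧ p.2 ∈ Set.Icc (0 : ℝ) 1 ∧
    max (2 - 2 * √p.2) (1 - 2 * √p.2 + 2 * p.2) ≤ p.1}

/-- Every template on `n ≥ 1` vertices with `e(Gᵢ) ≥ αᵢ (n.choose 2) + K n` for each `i` contains a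
rainbow triangle. -/
def ForcesUpToLinear (K : ℝ) (α : Fin 3 → ℝ) : Prop :=
  ∀ n : ℕ, 1 ≤ n → ∀ G : ColouringTemplate 3 (Fin n),
    (∀ i, α i * (n.choose 2 : ℝ) + K * n ≤ (edgeCount (G i) : ℝ)) → HasRainbowTriangle G

/-- `G` is rainbow-triangle-free and `e(Gᵢ) ≥ αᵢ (n.choose 2) - K n` for each `i`. -/
def IsMatchingExample {n : ℕ} (K : ℝ) (α : Fin 3 → ℝ) (G : ColouringTemplate 3 (Fin n)) : Prop :=
  (∀ i, α i * (n.choose 2 : ℝ) - K * n ≤ (edgeCount (G i) : ℝ)) ∧ ¬ HasRainbowTriangle G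

/-- Triples of densities below `α` (coordinatewise strictly, or zero) are not forcing, triples above
`α` (coordinatewise strictly, or one) are forcing. -/
def IsForcingThreshold (α : Fin 3 → ℝ) : Prop :=
  ∀ β : Fin 3 → ℝ, (∀ i, β i ∈ Set.Icc (0 : ℝ) 1) →
    ((∀ i, β i < α i ∨ β i = 0) → ¬ IsForcingTriple β) ∧
    ((∀ i, α i < β i ∨ β i = 1) → IsForcingTriple β)

end RainbowTriangle

/-! Upper bound. Give every ordered pair of vertices its excess, the number of its colours minus one
(so `-1` on the diagonal), and its excess off `k`, where colour `k` is ignored. The sums of these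
are twice edge counts minus `n ^ 2`. The densities `α` are encoded by numbers `x ≥ y ≥ z` with sum
one (`IsWitness`): the total excess exceeds `(x ^ 2 + y ^ 2 + z ^ 2) * n ^ 2`, and the excess off
`k` exceeds `t k ^ 2 * n ^ 2` with `t = (z, y, y)`, or else `t k = 0`.

Suppose there is no rainbow triangle. A pair with all three colours can be deleted with its ends
without spoiling these inequalities, so assume that every list has at most two colours, and say that
a pair with two colours has the type of its missing colour. Suppose for the moment that such pairs
match all the vertices, type `k` covering `a k` of them. Two pairs of one type are joined with
excess at most four. Two pairs of different types are joined with excess at most one, and those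
joined with excess exactly one are paid for by losses inside the types (`cross_excess_le_three`,
`cross_excess_le_two`, `two_mul_sum_le_sum_common`). Hence the total excess is at most `∑ a k ^ 2`,
and the excess off `k` is at most `a k ^ 2`. So `a k ≥ t k * n`, and three masses with sum `n` and
these lower bounds have sum of squares at most `(x ^ 2 + y ^ 2 + z ^ 2) * n ^ 2`, a contradiction.

In general a maximum fractional matching leaves a mass `δ` of single vertices. They carry no
positive excess among themselves, and such a vertex has excess at most one to a matched pair,
positive only in the configuration `IsExc`. Exceptional vertices force negative excess between the
pairs concerned. After averaging over the single vertices, `gain_nonneg` shows that `δ` can be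
distributed among the three types so that the argument above still applies (`false_of_noTriple`).

Lower bound. The templates `templateF` and `templateH` have no rainbow triangle, and their densities
are computed directly. Non-forcing for coordinates that equal a density is obtained by moving a
little mass between the parts. Densities equal to one need separate care, because there the edge
hypothesis says that the graph is complete. -/

namespace RainbowTriangle

/-! ### Colour lists, excess, and the constraints imposed by a double pair -/

section Lists
variable {V : Type*}

open Classical in
/-- The indicator of the edges of colour `i`. -/
noncomputable def ind (G : ColouringTemplate 3 V) (i : Fin 3) (u v : V) : ℤ :=
  if (G i).Adj u v then 1 else 0

/-- The number of colours of `uv`, minus one. -/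
noncomputable def excess (G : ColouringTemplate 3 V) (u v : V) : ℤ :=
  ind G 0 u v + ind G 1 u v + ind G 2 u v - 1

/-- The number of colours of `uv` other than `k`, minus one. -/
noncomputable def excessOff (G : ColouringTemplate 3 V) (k : Fin 3) (u v : V) : ℤ :=
  excess G u v - ind G k u v

/-- The sum of `f` over the four pairs joining the pairs `p` and `q`. -/
def cross (f : V → V → ℤ) (p q : V × V) : ℤ :=
  f p.1 q.1 + f p.1 q.2 + f p.2 q.1 + f p.2 q.2

/-- The three colours are all different. -/
def Distinct (i j k : Fin 3) : Prop := i ≠ j ∧ j ≠ k ∧ i ≠ k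

/-- The colours of `uv` are all the colours but `k`. -/
def IsDouble (G : ColouringTemplate 3 V) (k : Fin 3) (u v : V) : Prop :=
  ∀ i, ind G i u v = if i = k then 0 else 1

/-- No pair has all three colours. -/
def NoTriple (G : ColouringTemplate 3 V) : Prop := ∀ u v, excess G u v ≤ 1

theorem exists_third {i j : Fin 3} (h : i ≠ j) : ∃ k, Distinct i j k := by
  revert i j; unfold Distinct; decide

theorem exists_distinct (i : Fin 3) : ∃ j k, Distinct i j k := by
  revert i; unfold Distinct; decide

theorem Distinct.rotate {i j k : Fin 3} (h : Distinct i j k) : Distinct j k i :=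
  ⟨h.2.1, h.2.2.symm, h.1.symm⟩

theorem Distinct.swap {i j k : Fin 3} (h : Distinct i j k) : Distinct i k j :=
  ⟨h.2.2, h.2.1.symm, h.1⟩

variable {G : ColouringTemplate 3 V}

theorem ind_comm (i : Fin 3) (u v : V) : ind G i u v = ind G i v u := by
  unfold ind; rw [SimpleGraph.adj_comm]

theorem ind_nonneg (i : Fin 3) (u v : V) : 0 ≤ ind G i u v := by
  unfold ind; split_ifs <;> simp

theorem ind_le_one (i : Fin 3) (u v : V) : ind G i u v ≤ 1 := by
  unfold ind; split_ifs <;> simp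

theorem ind_self (i : Fin 3) (u : V) : ind G i u u = 0 := by
  simp [ind]

theorem Distinct.sum_eq {i j k : Fin 3} (h : Distinct i j k) {M : Type*} [AddCommMonoid M]
    (f : Fin 3 → M) : ∑ l, f l = f i + f j + f k := by
  have key : ∀ i j k : Fin 3, i ≠ j ∧ j ≠ k ∧ i ≠ k → Finset.univ = ({i, j, k} : Finset (Fin 3)) := by
    decide
  rw [key i j k h, Finset.sum_insert, Finset.sum_pair h.2.1, add_assoc]
  simp [h.1, h.2.2]

theorem Distinct.eq_or_eq_or_eq {i j k : Fin 3} (h : Distinct i j k) (l : Fin 3) :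
    l = i ∨ l = j ∨ l = k := by
  have key : ∀ i j k : Fin 3, i ≠ j ∧ j ≠ k ∧ i ≠ k → ∀ l, l = i ∨ l = j ∨ l = k := by
    decide
  exact key i j k h l

theorem excess_eq {i j k : Fin 3} (h : Distinct i j k) (u v : V) :
    excess G u v = ind G i u v + ind G j u v + ind G k u v - 1 := by
  rw [excess, ← Fin.sum_univ_three fun l => ind G l u v, h.sum_eq]

theorem excessOff_eq {i j k : Fin 3} (h : Distinct i j k) (u v : V) :
    excessOff G i u v = ind G j u v + ind G k u v - 1 := by
  rw [excessOff, excess_eq h]; ring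

theorem excess_comm (u v : V) : excess G u v = excess G v u := by
  simp only [excess, ind_comm _ u v]

theorem excessOff_comm (k : Fin 3) (u v : V) : excessOff G k u v = excessOff G k v u := by
  simp only [excessOff, excess_comm u v, ind_comm _ u v]

theorem excess_self (u : V) : excess G u u = -1 := by
  simp [excess, ind_self]

theorem excessOff_self (k : Fin 3) (u : V) : excessOff G k u u = -1 := by
  simp [excessOff, excess_self, ind_self]

theorem excessOff_le_excess (k : Fin 3) (u v : V) : excessOff G k u v ≤ excess G u v := by
  have := ind_nonneg (G := G) k u v
  unfold excessOff; omega

theorem excessOff_le_one (k : Fin 3) (u v : V) : excessOff G k u v ≤ 1 := by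
  obtain ⟨i, j, h⟩ := exists_distinct k
  have := ind_le_one (G := G) i u v
  have := ind_le_one (G := G) j u v
  rw [excessOff_eq h]; omega

/-- Absence of rainbow triangles as linear inequalities in 0/1 variables, so that every later case
analysis of colour lists is integer linear arithmetic. -/
theorem ind_triangle (hG : ¬ HasRainbowTriangle G) {i j k : Fin 3} (h : Distinct i j k)
    (u v w : V) : ind G i u v + ind G j v w + ind G k u w ≤ 2 := by
  by_contra hc
  refine hG ⟨u, v, w, i, j, k, h.1, h.2.1, h.2.2, ?_⟩
  unfold ind at hc
  split_ifs at hc <;> simp_all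

theorem IsDouble.eqs {i j k : Fin 3} (h : Distinct i j k) {u v : V} (hd : IsDouble G i u v) :
    ind G i u v = 0 ∧ ind G j u v = 1 ∧ ind G k u v = 1 := by
  refine ⟨by simpa using hd i, ?_, ?_⟩
  · simpa [h.1.symm] using hd j
  · simpa [h.2.2.symm] using hd k

theorem IsDouble.of_eqs {i j k : Fin 3} (h : Distinct i j k) {u v : V}
    (h1 : ind G i u v = 0) (h2 : ind G j u v = 1) (h3 : ind G k u v = 1) : IsDouble G i u v := by
  intro l
  rcases h.eq_or_eq_or_eq l with rfl | rfl | rfl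
  · simpa using h1
  · simpa [h.1.symm] using h2
  · simpa [h.2.2.symm] using h3

theorem IsDouble.symm {k : Fin 3} {u v : V} (hd : IsDouble G k u v) : IsDouble G k v u :=
  fun i => by rw [ind_comm, hd i]

theorem IsDouble.unique {k l : Fin 3} {u v : V} (hk : IsDouble G k u v) (hl : IsDouble G l u v) :
    k = l := by
  by_contra hne
  have := hk k
  rw [hl k] at this
  simp [hne] at this

theorem exists_isDouble {u v : V} (h : excess G u v = 1) : ∃ k, IsDouble G k u v := by
  have h01 : Distinct 0 1 2 := by unfold Distinct; decide
  have b0 := ind_le_one (G := G) 0 u v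
  have b1 := ind_le_one (G := G) 1 u v
  have b2 := ind_le_one (G := G) 2 u v
  have c0 := ind_nonneg (G := G) 0 u v
  have c1 := ind_nonneg (G := G) 1 u v
  have c2 := ind_nonneg (G := G) 2 u v
  unfold excess at h
  rcases c0.eq_or_lt with h0 | h0
  · exact ⟨0, .of_eqs h01 (by omega) (by omega) (by omega)⟩
  rcases c1.eq_or_lt with h1 | h1
  · exact ⟨1, .of_eqs h01.rotate (by omega) (by omega) (by omega)⟩
  · exact ⟨2, .of_eqs h01.rotate.rotate (by omega) (by omega) (by omega)⟩

theorem list_bounds (hF : NoTriple G) {i j k : Fin 3} (h : Distinct i j k) (u v : V) :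
    0 ≤ ind G i u v ∧ 0 ≤ ind G j u v ∧ 0 ≤ ind G k u v ∧
    ind G i u v ≤ 1 ∧ ind G j u v ≤ 1 ∧ ind G k u v ≤ 1 ∧
    ind G i u v + ind G j u v + ind G k u v ≤ 2 := by
  have := hF u v
  rw [excess_eq h] at this
  exact ⟨ind_nonneg .., ind_nonneg .., ind_nonneg .., ind_le_one .., ind_le_one ..,
    ind_le_one .., by omega⟩

/-- Since `uv` carries `j` and `k`, colour `i` on one of `uw`, `vw` together with `j` or `k` on the
other would close a rainbow triangle. -/
theorem IsDouble.bounds (hG : ¬ HasRainbowTriangle G) {i j k : Fin 3} (h : Distinct i j k)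
    {u v : V} (hd : IsDouble G i u v) (w : V) :
    ind G i u w + ind G j v w ≤ 1 ∧ ind G i u w + ind G k v w ≤ 1 ∧
    ind G i v w + ind G j u w ≤ 1 ∧ ind G i v w + ind G k u w ≤ 1 := by
  obtain ⟨-, h2, h3⟩ := hd.eqs h
  have t1 := ind_triangle hG h.swap.rotate u v w
  have t2 := ind_triangle hG h.rotate u v w
  have t3 := ind_triangle hG h.rotate.swap u v w
  have t4 := ind_triangle hG h.rotate.rotate.swap u v w
  have t5 := ind_triangle hG h.swap.rotate v u w
  have t6 := ind_triangle hG h.rotate v u w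
  have t7 := ind_triangle hG h.rotate.swap v u w
  have t8 := ind_triangle hG h.rotate.rotate.swap v u w
  rw [ind_comm _ v u] at t5 t6 t7 t8
  omega

theorem IsDouble.bounds' (hG : ¬ HasRainbowTriangle G) {i j k : Fin 3} (h : Distinct i j k)
    {u v : V} (hd : IsDouble G i u v) (w : V) :
    ind G i w u + ind G j w v ≤ 1 ∧ ind G i w u + ind G k w v ≤ 1 ∧
    ind G i w v + ind G j w u ≤ 1 ∧ ind G i w v + ind G k w u ≤ 1 := by
  simpa only [ind_comm _ w] using hd.bounds hG h w

theorem cross_comm {f : V → V → ℤ} (hf : ∀ u v, f u v = f v u) (p q : V × V) :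
    cross f p q = cross f q p := by
  simp only [cross, hf q.1, hf q.2]; ring

/-- Let `j` be the third colour. The two crossing bounds for `i` and `j` add up to at most two
occurrences of `i` and `j` on `uw` and `vw` together. -/
theorem IsDouble.excessOff_add_nonpos (hG : ¬ HasRainbowTriangle G) {i k : Fin 3} (hik : i ≠ k) {u v : V}
    (hd : IsDouble G i u v) (w : V) : excessOff G k u w + excessOff G k v w ≤ 0 := by
  obtain ⟨j, h⟩ := exists_third hik
  have h' : Distinct i j k := h.swap
  obtain ⟨h1, h2, h3, h4⟩ := hd.bounds hG h' w
  have := ind_nonneg (G := G) i u w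
  have := ind_nonneg (G := G) i v w
  rw [excessOff_eq h'.rotate.rotate, excessOff_eq h'.rotate.rotate]
  omega

theorem cross_excess_le_four (hF : NoTriple G) (p q : V × V) :
    cross (excess G) p q ≤ 4 := by
  have := hF p.1 q.1
  have := hF p.1 q.2
  have := hF p.2 q.1
  have := hF p.2 q.2
  unfold cross; omega

theorem cross_excess_le_one (hG : ¬ HasRainbowTriangle G) (hF : NoTriple G)
    {i j : Fin 3} (hij : i ≠ j) {p q : V × V}
    (hp : IsDouble G i p.1 p.2) (hq : IsDouble G j q.1 q.2) : cross (excess G) p q ≤ 1 := by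
  obtain ⟨k, h⟩ := exists_third hij
  obtain ⟨u, v⟩ := p
  obtain ⟨w, z⟩ := q
  have b1 := list_bounds hF h u w
  have b2 := list_bounds hF h u z
  have b3 := list_bounds hF h v w
  have b4 := list_bounds hF h v z
  have d1 := hp.bounds hG h w
  have d2 := hp.bounds hG h z
  have d3 := hq.bounds' hG h.rotate u
  have d4 := hq.bounds' hG h.rotate v
  simp only [cross, excess_eq h] at *
  omega

end Lists
-- Links between double pairs of different types, and exceptional vertices
section Lists
variable {V : Type*} {G : ColouringTemplate 3 V}

/-- The lists between a double pair `oc` and a double pair `dp` of another type, in the case where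
they carry excess one. -/
def IsLink (G : ColouringTemplate 3 V) (i j k : Fin 3) (o c d p : V) : Prop :=
  (ind G i o d = 0 ∧ ind G j o d = 1 ∧ ind G k o d = 1) ∧
  (ind G i c p = 1 ∧ ind G j c p = 0 ∧ ind G k c p = 1) ∧
  (ind G i c d = 0 ∧ ind G j c d = 0 ∧ ind G k c d = 1) ∧
  (ind G i o p = 0 ∧ ind G j o p = 0 ∧ ind G k o p = 0)

/-- The pair `p` consists of `a` and `b`. -/
def IsEnds (p : V × V) (a b : V) : Prop := (a = p.1 ∧ b = p.2) ∨ (a = p.2 ∧ b = p.1)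

theorem isLink_of_ind_eq_zero (hG : ¬ HasRainbowTriangle G) (hF : NoTriple G)
    {i j k : Fin 3} (h : Distinct i j k) {u v w z : V}
    (hp : IsDouble G i u v) (hq : IsDouble G j w z) (hpq : cross (excess G) (u, v) (w, z) = 1)
    (h0 : ind G k u z = 0) : IsLink G i j k u v w z := by
  obtain ⟨_, _, _, _, _, _, _⟩ := list_bounds hF h u w
  obtain ⟨_, _, _, _, _, _, _⟩ := list_bounds hF h u z
  obtain ⟨_, _, _, _, _, _, _⟩ := list_bounds hF h v w
  obtain ⟨_, _, _, _, _, _, _⟩ := list_bounds hF h v z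
  obtain ⟨_, _, _, _⟩ := hp.bounds hG h w
  obtain ⟨_, _, _, _⟩ := hp.bounds hG h z
  obtain ⟨_, _, _, _⟩ := hq.bounds' hG h.rotate u
  obtain ⟨_, _, _, _⟩ := hq.bounds' hG h.rotate v
  simp only [cross, excess_eq h] at hpq
  clear hp hq
  have e1 : ind G i u z = 0 := by lia
  have e2 : ind G j u z = 0 := by lia
  have e3 : ind G j u w = 1 := by lia
  have e4 : ind G i v z = 1 := by lia
  refine ⟨⟨?_, e3, ?_⟩, ⟨e4, ?_, ?_⟩, ⟨?_, ?_, ?_⟩, e1, e2, h0⟩ <;> lia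

theorem exists_isLink (hG : ¬ HasRainbowTriangle G) (hF : NoTriple G)
    {i j k : Fin 3} (h : Distinct i j k) {p q : V × V}
    (hp : IsDouble G i p.1 p.2) (hq : IsDouble G j q.1 q.2) (hpq : cross (excess G) p q = 1) :
    ∃ o c d e, IsEnds p o c ∧ IsEnds q d e ∧ IsLink G i j k o c d e := by
  obtain ⟨u, v⟩ := p
  obtain ⟨w, z⟩ := q
  -- Some joining pair misses `k`. If all four carried `k`, the two double pairs would exclude `i`
  -- and `j` from all of them, leaving four colours in total and excess zero.
  have h0 : ind G k u w = 0 ∨ ind G k u z = 0 ∨ ind G k v w = 0 ∨ ind G k v z = 0 := by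
    obtain ⟨_, _, _, _, _, _, _⟩ := list_bounds hF h u w
    obtain ⟨_, _, _, _, _, _, _⟩ := list_bounds hF h u z
    obtain ⟨_, _, _, _, _, _, _⟩ := list_bounds hF h v w
    obtain ⟨_, _, _, _, _, _, _⟩ := list_bounds hF h v z
    obtain ⟨_, _, _, _⟩ := hp.bounds hG h w
    obtain ⟨_, _, _, _⟩ := hp.bounds hG h z
    obtain ⟨_, _, _, _⟩ := hq.bounds' hG h.rotate u
    obtain ⟨_, _, _, _⟩ := hq.bounds' hG h.rotate v
    simp only [cross, excess_eq h] at hpq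
    by_contra! hc
    obtain ⟨_, _, _, _⟩ := hc
    clear hp hq
    have e1 : ind G k u w = 1 := by lia
    have e2 : ind G k u z = 1 := by lia
    have e3 : ind G k v w = 1 := by lia
    have e4 : ind G k v z = 1 := by lia
    lia
  rcases h0 with h0 | h0 | h0 | h0
  · exact ⟨u, v, z, w, by simp [IsEnds], by simp [IsEnds],
      isLink_of_ind_eq_zero hG hF h hp hq.symm (by simp only [cross] at hpq ⊢; omega) h0⟩
  · exact ⟨u, v, w, z, by simp [IsEnds], by simp [IsEnds],
      isLink_of_ind_eq_zero hG hF h hp hq hpq h0⟩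
  · exact ⟨v, u, z, w, by simp [IsEnds], by simp [IsEnds],
      isLink_of_ind_eq_zero hG hF h hp.symm hq.symm (by simp only [cross] at hpq ⊢; omega) h0⟩
  · exact ⟨v, u, w, z, by simp [IsEnds], by simp [IsEnds],
      isLink_of_ind_eq_zero hG hF h hp.symm hq (by simp only [cross] at hpq ⊢; omega) h0⟩

/-- What two pairs of one type linked to the same pair of another type impose on each other. -/
theorem exists_ends_of_common_link (hG : ¬ HasRainbowTriangle G) (hF : NoTriple G)
    {i j k : Fin 3} (h : Distinct i j k) {p q g : V × V}
    (hp : IsDouble G i p.1 p.2) (hq : IsDouble G i q.1 q.2) (hg : IsDouble G j g.1 g.2)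
    (hpg : cross (excess G) p g = 1) (hqg : cross (excess G) q g = 1) :
    ∃ a b c d, IsEnds p a b ∧ IsEnds q c d ∧
      (ind G j b d = 0 ∨ (excess G a d = -1 ∧ excess G b c = -1)) := by
  obtain ⟨o, c, d, e, hpe, hge, h1⟩ := exists_isLink hG hF h hp hg hpg
  obtain ⟨o', c', d', e', hqe, hge', h2⟩ := exists_isLink hG hF h hq hg hqg
  refine ⟨o, c, o', c', hpe, hqe, ?_⟩
  have key : (d = d' ∧ e = e') ∨ (d = e' ∧ e = d') := by
    unfold IsEnds at hge hge'
    rcases hge with ⟨rfl, rfl⟩ | ⟨rfl, rfl⟩ <;> rcases hge' with ⟨rfl, rfl⟩ | ⟨rfl, rfl⟩ <;> simp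
  obtain ⟨⟨_, _, _⟩, ⟨_, _, _⟩, ⟨_, _, _⟩, _, _, _⟩ := h1
  obtain ⟨⟨_, _, _⟩, ⟨_, _, _⟩, ⟨_, _, _⟩, _, _, _⟩ := h2
  rcases key with ⟨rfl, rfl⟩ | ⟨rfl, rfl⟩
  -- Equal orientation: `c` and `c'` both send colours `i` and `k` to `e`, so colour `j` on `cc'`
  -- would be rainbow.
  · left
    have := ind_nonneg (G := G) j c c'
    have := ind_triangle hG h c e c'
    have := ind_triangle hG h.rotate c' c e
    rw [ind_comm i c' e, ind_comm j c' c] at *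
    lia
  -- Opposite orientation: `d` sends `j, k` to `o` and `i, k` to `c'`, which excludes every colour
  -- from `oc'`. The same holds for `o'c` through `e`.
  · right
    have := ind_triangle hG h.rotate o d c'
    have := ind_triangle hG h.rotate.swap o d c'
    have := ind_triangle hG h.rotate.rotate o d c'
    have := ind_triangle hG h.rotate o' e c
    have := ind_triangle hG h.rotate.swap o' e c
    have := ind_triangle hG h.rotate.rotate o' e c
    obtain ⟨_, _, _, _, _, _, _⟩ := list_bounds hF h o c'
    obtain ⟨_, _, _, _, _, _, _⟩ := list_bounds hF h o' c
    rw [excess_comm c o', excess_eq h, excess_eq h]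
    simp only [ind_comm _ d c', ind_comm _ e c] at *
    lia

/-- Excess four needs the list `{j, k}` on all four joining pairs: colour `i` on one of them would
exclude `j` and `k` from another. A common link removes `j` from one of these lists or empties two
of them. -/
theorem cross_excess_le_three (hG : ¬ HasRainbowTriangle G) (hF : NoTriple G)
    {i j k : Fin 3} (h : Distinct i j k) {p q g : V × V}
    (hp : IsDouble G i p.1 p.2) (hq : IsDouble G i q.1 q.2) (hg : IsDouble G j g.1 g.2)
    (hpg : cross (excess G) p g = 1) (hqg : cross (excess G) q g = 1) :
    cross (excess G) p q ≤ 3 := by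
  obtain ⟨a, b, c, d, hab, hcd, hor⟩ := exists_ends_of_common_link hG hF h hp hq hg hpg hqg
  obtain ⟨u, v⟩ := p
  obtain ⟨w, z⟩ := q
  obtain ⟨_, _, _, _, _, _, _⟩ := list_bounds hF h u w
  obtain ⟨_, _, _, _, _, _, _⟩ := list_bounds hF h u z
  obtain ⟨_, _, _, _, _, _, _⟩ := list_bounds hF h v w
  obtain ⟨_, _, _, _, _, _, _⟩ := list_bounds hF h v z
  obtain ⟨_, _, _, _⟩ := hp.bounds hG h w
  obtain ⟨_, _, _, _⟩ := hp.bounds hG h z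
  clear hp hq
  simp only [cross, excess_eq h, IsEnds] at *
  rcases hab with ⟨rfl, rfl⟩ | ⟨rfl, rfl⟩ <;> rcases hcd with ⟨rfl, rfl⟩ | ⟨rfl, rfl⟩ <;> lia

/-- The common link of type `j` costs a colour `j` and that of type `k` a colour `k`, unless one of
them already empties two lists. The losses add up even when they hit the same joining pair. -/
theorem cross_excess_le_two (hG : ¬ HasRainbowTriangle G) (hF : NoTriple G)
    {i j k : Fin 3} (h : Distinct i j k) {p q g r : V × V}
    (hp : IsDouble G i p.1 p.2) (hq : IsDouble G i q.1 q.2) (hg : IsDouble G j g.1 g.2)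
    (hr : IsDouble G k r.1 r.2)
    (hpg : cross (excess G) p g = 1) (hqg : cross (excess G) q g = 1)
    (hpr : cross (excess G) p r = 1) (hqr : cross (excess G) q r = 1) :
    cross (excess G) p q ≤ 2 := by
  obtain ⟨a, b, c, d, hab, hcd, hor⟩ := exists_ends_of_common_link hG hF h hp hq hg hpg hqg
  obtain ⟨a', b', c', d', hab', hcd', hor'⟩ :=
    exists_ends_of_common_link hG hF h.swap hp hq hr hpr hqr
  obtain ⟨u, v⟩ := p
  obtain ⟨w, z⟩ := q
  obtain ⟨_, _, _, _, _, _, _⟩ := list_bounds hF h u w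
  obtain ⟨_, _, _, _, _, _, _⟩ := list_bounds hF h u z
  obtain ⟨_, _, _, _, _, _, _⟩ := list_bounds hF h v w
  obtain ⟨_, _, _, _, _, _, _⟩ := list_bounds hF h v z
  obtain ⟨_, _, _, _⟩ := hp.bounds hG h w
  obtain ⟨_, _, _, _⟩ := hp.bounds hG h z
  obtain ⟨_, _, _, _⟩ := hq.bounds' hG h u
  obtain ⟨_, _, _, _⟩ := hq.bounds' hG h v
  clear hp hq hg hr hpg hqg hpr hqr
  simp only [cross, excess_eq h, IsEnds] at *
  rcases hab with ⟨rfl, rfl⟩ | ⟨rfl, rfl⟩ <;> rcases hcd with ⟨rfl, rfl⟩ | ⟨rfl, rfl⟩ <;>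
    rcases hab' with ⟨rfl, rfl⟩ | ⟨rfl, rfl⟩ <;> rcases hcd' with ⟨rfl, rfl⟩ | ⟨rfl, rfl⟩ <;> lia

/-- The vertex `d` sends to `p`, a pair of type `k`, a pair of type `k` and a pair whose only
colour is `i`. -/
def IsExc (G : ColouringTemplate 3 V) (d : V) (k i : Fin 3) (p : V × V) : Prop :=
  i ≠ k ∧ ∃ t s, IsEnds p t s ∧ IsDouble G k d t ∧ ∀ l, ind G l d s = if l = i then 1 else 0

theorem IsExc.exists_eqs {i j k : Fin 3} (h : Distinct i j k) {d : V} {p : V × V}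
    (he : IsExc G d k i p) : ∃ t s, IsEnds p t s ∧
      (ind G k d t = 0 ∧ ind G i d t = 1 ∧ ind G j d t = 1) ∧
      (ind G k d s = 0 ∧ ind G i d s = 1 ∧ ind G j d s = 0) := by
  obtain ⟨-, t, s, hp, ht, hs⟩ := he
  refine ⟨t, s, hp, ht.eqs h.rotate.rotate, ?_, ?_, ?_⟩
  · simpa [h.2.2.symm] using hs k
  · simpa using hs i
  · simpa [h.1.symm] using hs j

/-- If no vertex pair from `d` to both ends of `p` is double, then the excess from `d` to `p` is
nonpositive unless `d` is exceptional for `p`. -/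
theorem excess_add_nonpos (hG : ¬ HasRainbowTriangle G) (hF : NoTriple G) {d : V} {k : Fin 3}
    {p : V × V} (hp : IsDouble G k p.1 p.2)
    (hd : ¬ (excess G d p.1 = 1 ∧ excess G d p.2 = 1)) (hx : ∀ i, ¬ IsExc G d k i p) :
    excess G d p.1 + excess G d p.2 ≤ 0 := by
  by_contra! hc
  obtain ⟨i, j, h⟩ := exists_distinct k
  obtain ⟨u, v⟩ := p
  -- The two colours of `du` include one other than `k`, so `k` is not on `dv`. The only colour of
  -- `dv` is then not `k`, so `k` is not on `du` either, and this is the exceptional configuration.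
  have key : ∀ u v, IsDouble G k u v → (∀ i, ¬ IsExc G d k i (u, v)) → excess G d u = 1 →
      excess G d v = 0 → False := by
    intro u v hp hx h1 h2
    obtain ⟨_, _, _, _⟩ := hp.bounds' hG h d
    obtain ⟨_, _, _, _, _, _, _⟩ := list_bounds hF h d u
    obtain ⟨_, _, _, _, _, _, _⟩ := list_bounds hF h d v
    rw [excess_eq h] at h1 h2
    have hu : IsDouble G k d u := .of_eqs h (by lia) (by lia) (by lia)
    have h0 : ind G k d v = 0 := by lia
    rcases (by lia : ind G i d v = 1 ∧ ind G j d v = 0 ∨ ind G i d v = 0 ∧ ind G j d v = 1) with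
      ⟨h3, h4⟩ | ⟨h3, h4⟩
    · refine hx i ⟨h.1.symm, u, v, .inl ⟨rfl, rfl⟩, hu, fun l => ?_⟩
      rcases h.eq_or_eq_or_eq l with rfl | rfl | rfl <;> simp [*, h.1, h.2.1.symm]
    · refine hx j ⟨h.2.2.symm, u, v, .inl ⟨rfl, rfl⟩, hu, fun l => ?_⟩
      rcases h.eq_or_eq_or_eq l with rfl | rfl | rfl <;> simp [*, h.2.1, h.2.2]
  have h1 := hF d u
  have h2 := hF d v
  simp only at hc hd hp
  rcases (by lia : excess G d u = 1 ∧ excess G d v = 0 ∨ excess G d v = 1 ∧ excess G d u = 0) with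
    ⟨h3, h4⟩ | ⟨h3, h4⟩
  · exact key u v hp hx h3 h4
  · refine key v u hp.symm (fun i hi => hx i ⟨hi.1, ?_⟩) h3 h4
    obtain ⟨-, t, s, ht, hs⟩ := hi
    exact ⟨t, s, ht.symm, hs⟩

theorem IsExc.unique {d : V} {k i j : Fin 3} {p : V × V} (hi : IsExc G d k i p)
    (hj : IsExc G d k j p) : i = j := by
  obtain ⟨hik, t, s, hp, ht, hs⟩ := hi
  obtain ⟨hjk, t', s', hp', ht', hs'⟩ := hj
  have key : (t = t' ∧ s = s') ∨ (t = s' ∧ s = t') := by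
    unfold IsEnds at hp hp'
    rcases hp with ⟨rfl, rfl⟩ | ⟨rfl, rfl⟩ <;> rcases hp' with ⟨rfl, rfl⟩ | ⟨rfl, rfl⟩ <;> simp
  rcases key with ⟨rfl, rfl⟩ | ⟨rfl, rfl⟩
  · have := hs i
    rw [hs' i] at this
    by_contra hne
    simp [hne] at this
  · obtain ⟨l, hl⟩ := exists_third hjk
    have := ht l
    rw [hs' l] at this
    simp [hl.2.2.symm, hl.2.1.symm] at this

theorem cherry_bounds (hG : ¬ HasRainbowTriangle G) {i j k : Fin 3} (h : Distinct i j k)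
    (d u v : V) :
    (ind G j d u + ind G k d v + ind G i u v ≤ 2 ∧ ind G k d u + ind G j d v + ind G i u v ≤ 2) ∧
    (ind G i d u + ind G k d v + ind G j u v ≤ 2 ∧ ind G k d u + ind G i d v + ind G j u v ≤ 2) ∧
    (ind G i d u + ind G j d v + ind G k u v ≤ 2 ∧ ind G j d u + ind G i d v + ind G k u v ≤ 2) := by
  have tri := fun i j k (h : Distinct i j k) => ind_comm (G := G) i d u ▸ ind_triangle hG h u d v
  exact ⟨⟨tri _ _ _ h.rotate, tri _ _ _ h.rotate.rotate.swap⟩,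
    ⟨tri _ _ _ h.swap, tri _ _ _ h.rotate.rotate⟩, tri _ _ _ h, tri _ _ _ h.rotate.swap⟩

theorem IsEnds.isDouble {k : Fin 3} {p : V × V} {t s : V} (h : IsEnds p t s)
    (hp : IsDouble G k p.1 p.2) : IsDouble G k t s := by
  rcases h with ⟨rfl, rfl⟩ | ⟨rfl, rfl⟩
  exacts [hp, hp.symm]

theorem IsEnds.cross_eq (f : V → V → ℤ) {p q : V × V} {t s t' s' : V} (h : IsEnds p t s)
    (h' : IsEnds q t' s') : cross f p q = f t t' + f t s' + f s t' + f s s' := by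
  rcases h with ⟨rfl, rfl⟩ | ⟨rfl, rfl⟩ <;> rcases h' with ⟨rfl, rfl⟩ | ⟨rfl, rfl⟩ <;>
    simp only [cross] <;> ring

/-- Write `t, s` and `t', s'` for the ends, the double pairs at `d` being `dt` and `dt'`. Through
`d` every colour is excluded from `tt'`, while `ts'` can only have `k`, `st'` only `l`, and `ss'`
lacks `j`. If `ss'` has both `k` and `l`, the double pairs `ts` and `t's'` empty `ts'` and `st'`. -/
theorem cross_excess_le_neg_one (hG : ¬ HasRainbowTriangle G) (hF : NoTriple G)
    {k l : Fin 3} {d : V} {p q : V × V} (hp : IsDouble G k p.1 p.2) (hq : IsDouble G l q.1 q.2)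
    (hpe : IsExc G d k l p) (hqe : IsExc G d l k q) : cross (excess G) p q ≤ -1 := by
  obtain ⟨j, h⟩ := exists_third hpe.1
  obtain ⟨t, s, hts, ⟨_, _, _⟩, _, _, _⟩ := hpe.exists_eqs h.swap
  obtain ⟨t', s', hts', ⟨_, _, _⟩, _, _, _⟩ := hqe.exists_eqs h.rotate
  obtain ⟨⟨_, _⟩, ⟨_, _⟩, _, _⟩ := cherry_bounds hG h d t t'
  obtain ⟨⟨_, _⟩, ⟨_, _⟩, _, _⟩ := cherry_bounds hG h d t s'
  obtain ⟨⟨_, _⟩, ⟨_, _⟩, _, _⟩ := cherry_bounds hG h d s t'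
  obtain ⟨⟨_, _⟩, ⟨_, _⟩, _, _⟩ := cherry_bounds hG h d s s'
  obtain ⟨_, _, _, _⟩ := (hts.isDouble hp).bounds hG h.rotate s'
  obtain ⟨_, _, _, _⟩ := (hts'.isDouble hq).bounds' hG h s
  obtain ⟨_, _, _, _, _, _, _⟩ := list_bounds hF h t s'
  obtain ⟨_, _, _, _, _, _, _⟩ := list_bounds hF h s t'
  obtain ⟨_, _, _, _, _, _, _⟩ := list_bounds hF h s s'
  rw [hts.cross_eq _ hts']
  simp only [excess_eq h]
  clear hp hq hpe hqe hts hts'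
  lia

/-- Colour `k` lies on `dt` and `ds`. With both `l` and `j` on `dt'` it excludes `l` and `j` from
`tt'` and `st'`. With the one colour of `ds'` it excludes one of `l`, `j` from `ts'` and `ss'`. -/
theorem cross_excessOff_le_neg_two (hG : ¬ HasRainbowTriangle G) (hF : NoTriple G)
    {k l i : Fin 3} {d : V} {p q : V × V} (hp : IsDouble G l p.1 p.2) (hq : IsDouble G k q.1 q.2)
    (hpe : IsExc G d l k p) (hqe : IsExc G d k i q) : cross (excessOff G k) p q ≤ -2 := by
  obtain ⟨j, h⟩ := exists_third hpe.1
  obtain ⟨t, s, hts, ⟨_, _, _⟩, _, _, _⟩ := hpe.exists_eqs h.swap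
  have hi : i = l ∨ i = j := (h.eq_or_eq_or_eq i).resolve_left hqe.1
  obtain ⟨t', s', hts', ⟨_, _, _⟩, h0, hlj⟩ : ∃ t' s', IsEnds q t' s' ∧
      (ind G k d t' = 0 ∧ ind G l d t' = 1 ∧ ind G j d t' = 1) ∧
      ind G k d s' = 0 ∧ (ind G l d s' = 1 ∧ ind G j d s' = 0 ∨
        ind G l d s' = 0 ∧ ind G j d s' = 1) := by
    rcases hi with rfl | rfl
    · obtain ⟨t', s', h1, h2, h3⟩ := hqe.exists_eqs h.rotate
      exact ⟨t', s', h1, h2, h3.1, .inl h3.2⟩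
    · obtain ⟨t', s', h1, h2, h3⟩ := hqe.exists_eqs h.rotate.swap.rotate.rotate
      exact ⟨t', s', h1, ⟨h2.1, h2.2.2, h2.2.1⟩, h3.1, .inr h3.2.symm⟩
  obtain ⟨⟨_, _⟩, ⟨_, _⟩, _, _⟩ := cherry_bounds hG h d t t'
  obtain ⟨⟨_, _⟩, ⟨_, _⟩, _, _⟩ := cherry_bounds hG h d t s'
  obtain ⟨⟨_, _⟩, ⟨_, _⟩, _, _⟩ := cherry_bounds hG h d s t'
  obtain ⟨⟨_, _⟩, ⟨_, _⟩, _, _⟩ := cherry_bounds hG h d s s'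
  have hp' := hts.isDouble hp
  have hq' := hts'.isDouble hq
  obtain ⟨_, _, _, _⟩ := hp'.bounds hG h.rotate t'
  obtain ⟨_, _, _, _⟩ := hp'.bounds hG h.rotate s'
  obtain ⟨_, _, _, _⟩ := hq'.bounds' hG h t
  obtain ⟨_, _, _, _⟩ := hq'.bounds' hG h s
  obtain ⟨_, _, _, _, _, _, _⟩ := list_bounds hF h t t'
  obtain ⟨_, _, _, _, _, _, _⟩ := list_bounds hF h t s'
  obtain ⟨_, _, _, _, _, _, _⟩ := list_bounds hF h s t'
  obtain ⟨_, _, _, _, _, _, _⟩ := list_bounds hF h s s'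
  rw [hts.cross_eq _ hts']
  simp only [excessOff_eq h]
  clear hp hq hpe hqe hts hts' hp' hq'
  lia

end Lists

/-! ### Maximum fractional matchings and their local optimality -/

section FractionalMatching
variable {V : Type*}

open Classical in
/-- The weight function of a single edge. -/
noncomputable def edgeWeight (a b u v : V) : ℝ :=
  (if u = a ∧ v = b then 1 else 0) + (if u = b ∧ v = a then 1 else 0)

open Classical in
theorem edgeWeight_comm (a b u v : V) : edgeWeight a b u v = edgeWeight a b v u := by
  unfold edgeWeight
  rw [add_comm]
  exact congrArg₂ _ (if_congr and_comm rfl rfl) (if_congr and_comm rfl rfl)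

theorem edgeWeight_nonneg (a b u v : V) : 0 ≤ edgeWeight a b u v := by
  unfold edgeWeight
  split_ifs <;> norm_num

theorem edgeWeight_eq_zero {X : SimpleGraph V} {a b u v : V} (hab : X.Adj a b)
    (h : ¬ X.Adj u v) : edgeWeight a b u v = 0 := by
  unfold edgeWeight
  split_ifs <;> simp_all [X.adj_comm]

theorem edgeWeight_of_ne {a b u v : V} (h : ¬ (u = a ∧ v = b)) (h' : ¬ (u = b ∧ v = a)) :
    edgeWeight a b u v = 0 := by
  unfold edgeWeight
  split_ifs
  all_goals simp_all

variable [Fintype V]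

/-- A fractional matching of the graph `X`. -/
structure IsFracMatching (X : SimpleGraph V) (m : V → V → ℝ) : Prop where
  nonneg : ∀ u v, 0 ≤ m u v
  comm : ∀ u v, m u v = m v u
  eq_zero : ∀ u v, ¬ X.Adj u v → m u v = 0
  sum_le : ∀ u, ∑ v, m u v ≤ 1

theorem IsFracMatching.le_one {X : SimpleGraph V} {m : V → V → ℝ} (hm : IsFracMatching X m)
    (u v : V) : m u v ≤ 1 :=
  (Finset.single_le_sum (fun w _ => hm.nonneg u w) (Finset.mem_univ v)).trans (hm.sum_le u)

theorem exists_isFracMatching_max (X : SimpleGraph V) :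
    ∃ m, IsFracMatching X m ∧
      ∀ m', IsFracMatching X m' → ∑ u, ∑ v, m' u v ≤ ∑ u, ∑ v, m u v := by
  have hK : IsCompact {m : V → V → ℝ | IsFracMatching X m} := by
    have hb : IsCompact (Set.pi Set.univ fun _ : V => Set.pi Set.univ fun _ : V =>
        Set.Icc (0 : ℝ) 1) :=
      isCompact_univ_pi fun _ => isCompact_univ_pi fun _ => isCompact_Icc
    refine hb.of_isClosed_subset ?_ fun m hm u _ v _ => ⟨hm.nonneg u v, hm.le_one u v⟩
    have : {m : V → V → ℝ | IsFracMatching X m} =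
        (⋂ u, ⋂ v, {m | 0 ≤ m u v}) ∩ (⋂ u, ⋂ v, {m | m u v = m v u}) ∩
        (⋂ u, ⋂ v, ⋂ _ : ¬ X.Adj u v, {m | m u v = 0}) ∩ ⋂ u, {m | ∑ v, m u v ≤ 1} := by
      ext m
      simp only [Set.mem_ofPred_eq, Set.mem_inter_iff, Set.mem_iInter]
      exact ⟨fun h => ⟨⟨⟨h.1, h.2⟩, h.3⟩, h.4⟩, fun h => ⟨h.1.1.1, h.1.1.2, h.1.2, h.2⟩⟩
    rw [this]
    refine ((IsClosed.inter ?_ ?_).inter ?_).inter ?_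
    · exact isClosed_iInter fun u => isClosed_iInter fun v =>
        isClosed_le continuous_const (by fun_prop)
    · exact isClosed_iInter fun u => isClosed_iInter fun v =>
        isClosed_eq (by fun_prop) (by fun_prop)
    · exact isClosed_iInter fun u => isClosed_iInter fun v => isClosed_iInter fun _ =>
        isClosed_eq (by fun_prop) continuous_const
    · exact isClosed_iInter fun u => isClosed_le (by fun_prop) continuous_const
  obtain ⟨m, hm, hmax⟩ := hK.exists_isMaxOn ⟨fun _ _ => 0, by constructor <;> simp⟩
    (f := fun m => ∑ u, ∑ v, m u v) (by fun_prop)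
  exact ⟨m, hm, fun m' hm' => hmax hm'⟩

open Classical in
theorem sum_edgeWeight (a b u : V) :
    ∑ v, edgeWeight a b u v = (if u = a then 1 else 0) + (if u = b then 1 else 0) := by
  simp only [edgeWeight, Finset.sum_add_distrib, ite_and]
  congr 1
  · by_cases h : u = a <;> simp [h]
  · by_cases h : u = b <;> simp [h]

theorem sum_sum_edgeWeight (a b : V) : ∑ u, ∑ v, edgeWeight a b u v = 2 := by
  classical
  simp [sum_edgeWeight, Finset.sum_add_distrib, one_add_one_eq_two]

theorem exists_stable_isFracMatching (X : SimpleGraph V) :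
    ∃ m, IsFracMatching X m ∧
      (∀ d d', ∑ v, m d v < 1 → ∑ v, m d' v < 1 → ¬ X.Adj d d') ∧
      ∀ d t s, ∑ v, m d v < 1 → 0 < m t s → ¬ (X.Adj d t ∧ X.Adj d s) := by
  classical
  obtain ⟨m, hm, hmax⟩ := exists_isFracMatching_max X
  refine ⟨m, hm, fun d d' hd hd' hX => ?_, fun d t s hd hts ⟨hdt, hds⟩ => ?_⟩
  -- Two adjacent unsaturated vertices would allow the weight of the edge between them to be raised.
  · obtain ⟨ε, hε, h1, h2⟩ : ∃ ε : ℝ, 0 < ε ∧ ε ≤ 1 - ∑ v, m d v ∧ ε ≤ 1 - ∑ v, m d' v :=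
      ⟨min (1 - ∑ v, m d v) (1 - ∑ v, m d' v), by simp [hd, hd'], min_le_left .., min_le_right ..⟩
    have hne := hX.ne
    have := hmax (fun u v => m u v + ε * edgeWeight d d' u v) ⟨fun u v => ?_, fun u v => ?_,
      fun u v h => ?_, fun u => ?_⟩
    · simp only [Finset.sum_add_distrib, ← Finset.mul_sum, sum_sum_edgeWeight] at this
      linarith
    · exact add_nonneg (hm.nonneg u v) (mul_nonneg hε.le (edgeWeight_nonneg ..))
    · simp only [hm.comm u v, edgeWeight_comm _ _ u v]
    · simp only [hm.eq_zero u v h, edgeWeight_eq_zero hX h]; simp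
    · simp only [Finset.sum_add_distrib, ← Finset.mul_sum, sum_edgeWeight]
      have := hm.sum_le u
      by_cases h3 : u = d
      · subst h3; simp only [if_true, hne, if_false]; linarith
      · by_cases h4 : u = d'
        · subst h4; simp only [h3, if_true, if_false]; linarith
        · simp only [h3, h4, if_false]; linarith
  -- Otherwise move `ε` from `ts` to each of `dt` and `ds`. The loads at `t` and `s` do not change,
  -- the load at `d` grows by `2 * ε`, and the total weight increases.
  · have hX : X.Adj t s := by
      by_contra h
      exact hts.ne' (hm.eq_zero t s h)
    obtain ⟨ε, hε, h1, h2⟩ : ∃ ε : ℝ, 0 < ε ∧ 2 * ε ≤ 1 - ∑ v, m d v ∧ ε ≤ m t s := by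
      refine ⟨min ((1 - ∑ v, m d v) / 2) (m t s), by simp [hd, hts], ?_, min_le_right ..⟩
      have := min_le_left ((1 - ∑ v, m d v) / 2) (m t s)
      linarith
    have n1 := hdt.ne
    have n2 := hds.ne
    have n3 := hX.ne
    have := hmax (fun u v => m u v + ε * (edgeWeight d t u v + edgeWeight d s u v -
        edgeWeight t s u v)) ⟨fun u v => ?_, fun u v => ?_, fun u v h => ?_, fun u => ?_⟩
    · simp only [Finset.sum_add_distrib, ← Finset.mul_sum, Finset.sum_sub_distrib,
        sum_sum_edgeWeight] at this
      linarith
    · have e1 := edgeWeight_nonneg d t u v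
      have e2 := edgeWeight_nonneg d s u v
      have e3 := hm.nonneg u v
      have e4 : ε * edgeWeight t s u v ≤ m u v := by
        by_cases h3 : u = t ∧ v = s
        · obtain ⟨rfl, rfl⟩ := h3
          simpa [edgeWeight, n3] using h2
        · by_cases h4 : u = s ∧ v = t
          · obtain ⟨rfl, rfl⟩ := h4
            rw [hm.comm]
            simpa [edgeWeight, n3, n3.symm] using h2
          · rw [edgeWeight_of_ne h3 h4]; simpa
      nlinarith [mul_nonneg hε.le e1, mul_nonneg hε.le e2]
    · simp only [hm.comm u v, edgeWeight_comm _ _ u v]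
    · simp only [hm.eq_zero u v h, edgeWeight_eq_zero hX h, edgeWeight_eq_zero hdt h,
        edgeWeight_eq_zero hds h]
      simp
    · simp only [Finset.sum_add_distrib, ← Finset.mul_sum, Finset.sum_sub_distrib, sum_edgeWeight]
      have := hm.sum_le u
      by_cases h3 : u = d
      · subst h3; simp only [if_true, n1, n2, if_false]; linarith
      · by_cases h4 : u = t
        · subst h4; simp only [h3, n3, if_true, if_false]; linarith
        · by_cases h5 : u = s
          · subst h5; simp only [h3, h4, if_true, if_false]; linarith
          · simp only [h3, h4, h5, if_false]; linarith

end FractionalMatching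

/-! ### Splitting the vertex masses into single vertices and double pairs -/

section Decomposition
variable {V : Type*} [Fintype V]

/-- A splitting of the unit masses of the vertices into the masses `c` of single vertices and the
masses `μ k p` of the double pairs `p` of type `k`. -/
structure IsSplitting (G : ColouringTemplate 3 V) (c : V → ℝ) (μ : Fin 3 → V × V → ℝ) : Prop where
  nonneg : ∀ d, 0 ≤ c d
  pair_nonneg : ∀ k p, 0 ≤ μ k p
  isDouble : ∀ k p, 0 < μ k p → IsDouble G k p.1 p.2
  sum_eq : ∀ g : V → ℝ, ∑ u, g u = ∑ d, c d * g d + ∑ k, ∑ p, μ k p * (g p.1 + g p.2)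
  excess_nonpos : ∀ d d', 0 < c d → 0 < c d' → excess G d d' ≤ 0
  not_double : ∀ d k p, 0 < c d → 0 < μ k p → ¬ (excess G d p.1 = 1 ∧ excess G d p.2 = 1)

/-- The graph of the pairs with exactly two colours. -/
def doubleGraph (G : ColouringTemplate 3 V) : SimpleGraph V where
  Adj u v := excess G u v = 1
  symm := ⟨fun u v h => by rw [excess_comm, h]⟩
  loopless := ⟨fun u h => by rw [excess_self] at h; norm_num at h⟩

theorem exists_isSplitting {G : ColouringTemplate 3 V} (hF : NoTriple G) :
    ∃ c μ, IsSplitting G c μ := by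
  classical
  obtain ⟨m, hm, h1, h2⟩ := exists_stable_isFracMatching (doubleGraph G)
  -- A single vertex receives the unused part of its unit mass. A matched edge occurs as two ordered
  -- pairs, hence the division by two.
  refine ⟨fun u => 1 - ∑ v, m u v, fun k p => if IsDouble G k p.1 p.2 then m p.1 p.2 / 2 else 0,
    fun d => sub_nonneg.2 (hm.sum_le d), fun k p => ?_, fun k p h => ?_, fun g => ?_,
    fun d d' hd hd' => ?_, fun d k p hd hp => ?_⟩
  · split_ifs
    · exact div_nonneg (hm.nonneg ..) zero_le_two
    · exact le_rfl
  · by_contra h'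
    simp [h'] at h
  · have hsum : ∀ p : V × V, ∑ k, (if IsDouble G k p.1 p.2 then m p.1 p.2 / 2 else 0) =
        m p.1 p.2 / 2 := by
      intro p
      by_cases hp : (doubleGraph G).Adj p.1 p.2
      · obtain ⟨k, hk⟩ := exists_isDouble hp
        have : ∀ l, IsDouble G l p.1 p.2 ↔ l = k :=
          fun l => ⟨fun hl => hl.unique hk, fun h => h ▸ hk⟩
        simp [this]
      · simp [hm.eq_zero _ _ hp]
    rw [Finset.sum_comm]
    simp only [← Finset.sum_mul, hsum]
    rw [Fintype.sum_prod_type]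
    have e1 : ∑ u, ∑ v, m u v / 2 * (g u + g v) = ∑ u, (∑ v, m u v) * g u := by
      have e2 : ∑ u, ∑ v, m u v * g v = ∑ u, ∑ v, m u v * g u := by
        rw [Finset.sum_comm]
        simp only [hm.comm]
      calc ∑ u, ∑ v, m u v / 2 * (g u + g v)
          = (∑ u, ∑ v, m u v * g u + ∑ u, ∑ v, m u v * g v) / 2 := by
            rw [← Finset.sum_add_distrib, Finset.sum_div]
            refine Finset.sum_congr rfl fun u _ => ?_
            rw [← Finset.sum_add_distrib, Finset.sum_div]
            exact Finset.sum_congr rfl fun v _ => by ring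
        _ = ∑ u, (∑ v, m u v) * g u := by
            rw [e2, add_self_div_two]
            simp only [Finset.sum_mul]
    rw [e1, ← Finset.sum_add_distrib]
    exact Finset.sum_congr rfl fun u _ => by ring
  · have h := h1 d d' (by linarith) (by linarith)
    have := hF d d'
    change ¬ excess G d d' = 1 at h
    omega
  · refine h2 d p.1 p.2 (by linarith) ?_
    by_contra h'
    split_ifs at hp <;> linarith

variable {G : ColouringTemplate 3 V} {c : V → ℝ} {μ : Fin 3 → V × V → ℝ}

theorem IsSplitting.card_eq (hS : IsSplitting G c μ) :
    (Fintype.card V : ℝ) = ∑ d, c d + 2 * ∑ k, ∑ p, μ k p := by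
  have := hS.sum_eq fun _ => 1
  simp only [Finset.sum_const, Finset.card_univ, nsmul_eq_mul, mul_one, ← Finset.sum_mul] at this
  rw [this]; ring

/-- The total of `f` over the pairs joining pairs of type `k` to pairs of type `l`. -/
noncomputable def crossSum (μ : Fin 3 → V × V → ℝ) (f : V → V → ℤ) (k l : Fin 3) : ℝ :=
  ∑ p, ∑ q, μ k p * μ l q * (cross f p q : ℝ)

/-- The splitting identity is applied once in each variable. -/
theorem IsSplitting.sum_sum_eq (hS : IsSplitting G c μ) {f : V → V → ℤ}
    (hf : ∀ u v, f u v = f v u) :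
    ∑ u, ∑ v, (f u v : ℝ) = ∑ d, ∑ d', c d * c d' * (f d d' : ℝ) +
      2 * ∑ d, c d * ∑ k, ∑ p, μ k p * ((f d p.1 : ℝ) + f d p.2) + ∑ k, ∑ l, crossSum μ f k l := by
  set I : V → ℝ := fun u => ∑ d, c d * (f u d : ℝ) with hI
  set J : V → ℝ := fun u => ∑ k, ∑ p, μ k p * ((f u p.1 : ℝ) + f u p.2) with hJ
  have e : ∀ u, ∑ v, (f u v : ℝ) = I u + J u := fun u => hS.sum_eq fun v => (f u v : ℝ)
  have e1 : ∑ d, ∑ d', c d * c d' * (f d d' : ℝ) = ∑ d, c d * I d :=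
    Finset.sum_congr rfl fun d _ => by
      rw [Finset.mul_sum]
      exact Finset.sum_congr rfl fun d' _ => by ring
  have e2 : ∑ k, ∑ p, μ k p * (I p.1 + I p.2) = ∑ d, c d * J d := by
    have : ∀ k p, μ k p * (I p.1 + I p.2) =
        ∑ d, c d * (μ k p * ((f d p.1 : ℝ) + f d p.2)) := by
      intro k p
      rw [hI, ← Finset.sum_add_distrib, Finset.mul_sum]
      exact Finset.sum_congr rfl fun d _ => by rw [hf p.1 d, hf p.2 d]; ring
    simp only [this, hJ, Finset.mul_sum]
    rw [Finset.sum_comm]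
    conv_rhs => rw [Finset.sum_comm]
    rw [Finset.sum_comm]
    refine Finset.sum_congr rfl fun k _ => Finset.sum_comm
  have e3 : ∑ l, ∑ q, μ l q * (J q.1 + J q.2) = ∑ k, ∑ l, crossSum μ f k l := by
    refine Finset.sum_congr rfl fun l _ => ?_
    have : ∀ q : V × V, μ l q * (J q.1 + J q.2) =
        ∑ k, ∑ p, μ l q * μ k p * (cross f q p : ℝ) := by
      intro q
      simp only [hJ, ← Finset.sum_add_distrib, Finset.mul_sum]
      refine Finset.sum_congr rfl fun k _ => Finset.sum_congr rfl fun p _ => ?_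
      simp only [cross]
      push_cast
      ring
    simp only [this]
    rw [Finset.sum_comm]
    rfl
  simp only [e]
  rw [hS.sum_eq, e1, ← e3]
  change _ = _ + 2 * ∑ d, c d * J d + _
  simp only [mul_add, Finset.sum_add_distrib] at e2 ⊢
  linarith

theorem IsSplitting.sum_sum_le (hS : IsSplitting G c μ) {f : V → V → ℤ}
    (hf : ∀ u v, f u v = f v u) (hfe : ∀ u v, f u v ≤ excess G u v)
    {η : V → Fin 3 → V × V → ℝ}
    (hη : ∀ d k p, 0 < c d → 0 < μ k p → (f d p.1 : ℝ) + f d p.2 ≤ η d k p) :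
    ∑ u, ∑ v, (f u v : ℝ) ≤ 2 * ∑ d, c d * ∑ k, ∑ p, μ k p * η d k p +
      ∑ k, ∑ l, crossSum μ f k l := by
  rw [hS.sum_sum_eq hf]
  have e1 : ∑ d, ∑ d', c d * c d' * (f d d' : ℝ) ≤ 0 := by
    refine Finset.sum_nonpos fun d _ => Finset.sum_nonpos fun d' _ => ?_
    rcases (hS.nonneg d).eq_or_lt with h | h
    · simp [← h]
    rcases (hS.nonneg d').eq_or_lt with h' | h'
    · simp [← h']
    refine mul_nonpos_of_nonneg_of_nonpos (by positivity) ?_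
    exact_mod_cast (hfe d d').trans (hS.excess_nonpos d d' h h')
  have e2 : ∑ d, c d * ∑ k, ∑ p, μ k p * ((f d p.1 : ℝ) + f d p.2) ≤
      ∑ d, c d * ∑ k, ∑ p, μ k p * η d k p := by
    refine Finset.sum_le_sum fun d _ => ?_
    rcases (hS.nonneg d).eq_or_lt with h | h
    · simp [← h]
    refine mul_le_mul_of_nonneg_left (Finset.sum_le_sum fun k _ => Finset.sum_le_sum fun p _ => ?_)
      h.le
    rcases (hS.pair_nonneg k p).eq_or_lt with h' | h'
    · simp [← h']
    exact mul_le_mul_of_nonneg_left (hη d k p h h') h'.le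
  linarith

theorem crossSum_le {k l : Fin 3} (hS : IsSplitting G c μ) {f : V → V → ℤ} {θ : V × V → V × V → ℝ}
    (h : ∀ p q, 0 < μ k p → 0 < μ l q → (cross f p q : ℝ) ≤ θ p q) :
    crossSum μ f k l ≤ ∑ p, ∑ q, μ k p * μ l q * θ p q := by
  refine Finset.sum_le_sum fun p _ => Finset.sum_le_sum fun q _ => ?_
  rcases (hS.pair_nonneg k p).eq_or_lt with h1 | h1
  · simp [← h1]
  rcases (hS.pair_nonneg l q).eq_or_lt with h2 | h2
  · simp [← h2]
  exact mul_le_mul_of_nonneg_left (h p q h1 h2) (by positivity)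

end Decomposition

/-! ### A common-neighbour inequality for weighted bipartite graphs -/

section CommonNeighbours
variable {P : Type*} [Fintype P]

-- For fixed `e`, the ratio sum is a weighted average, over the neighbours `g` of `e`, of the degree
-- of `g`. Each such degree counts only vertices that share the neighbour `g` with `e`.
open Classical in
theorem sum_degree_ratio_le {α β : P → ℝ} (hα : ∀ e, 0 ≤ α e) (hβ : ∀ g, 0 ≤ β g)
    (R : P → P → Prop) :
    ∑ e, ∑ g, α e * β g * (if R e g then 1 else 0) *
        ((∑ f, α f * if R f g then 1 else 0) / ∑ h, β h * if R e h then 1 else 0) ≤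
      ∑ e, ∑ f, α e * α f * (if ∃ g, 0 < β g ∧ R e g ∧ R f g then 1 else 0) := by
  refine Finset.sum_le_sum fun e _ => ?_
  set N : ℝ := ∑ f, α f * (if ∃ g, 0 < β g ∧ R e g ∧ R f g then 1 else 0) with hN
  set D : ℝ := ∑ h, β h * if R e h then 1 else 0 with hD
  have hN0 : 0 ≤ N := Finset.sum_nonneg fun f _ => mul_nonneg (hα f) (by split_ifs <;> norm_num)
  have hD0 : 0 ≤ D := Finset.sum_nonneg fun f _ => mul_nonneg (hβ f) (by split_ifs <;> norm_num)
  have h1 : ∀ g, β g * (if R e g then 1 else 0) * (∑ f, α f * if R f g then 1 else 0) ≤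
      β g * (if R e g then 1 else 0) * N := by
    intro g
    rcases (hβ g).eq_or_lt with h | h
    · simp [← h]
    by_cases hr : R e g
    · refine mul_le_mul_of_nonneg_left (Finset.sum_le_sum fun f _ => ?_) (by simp [hr, h.le])
      refine mul_le_mul_of_nonneg_left ?_ (hα f)
      by_cases hf : R f g
      · rw [if_pos hf, if_pos ⟨g, h, hr, hf⟩]
      · rw [if_neg hf]
        split_ifs <;> norm_num
    · simp [hr]
  calc _ = α e * ((∑ g, β g * (if R e g then 1 else 0) *
            (∑ f, α f * if R f g then 1 else 0)) / D) := by
          rw [Finset.sum_div, Finset.mul_sum]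
          exact Finset.sum_congr rfl fun g _ => by ring
    _ ≤ α e * N := by
          refine mul_le_mul_of_nonneg_left (div_le_of_le_mul₀ hD0 hN0 ?_) (hα e)
          refine (Finset.sum_le_sum fun g _ => h1 g).trans ?_
          rw [← Finset.sum_mul, mul_comm]
    _ = _ := by
          rw [hN, Finset.mul_sum]
          exact Finset.sum_congr rfl fun g _ => by ring

open Classical in
/-- In a weighted bipartite graph, twice the edge weight is at most the weight of the pairs with a
common neighbour. -/
theorem two_mul_sum_le_sum_common {α β : P → ℝ} (hα : ∀ e, 0 ≤ α e) (hβ : ∀ g, 0 ≤ β g)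
    (R : P → P → Prop) :
    2 * ∑ e, ∑ g, α e * β g * (if R e g then 1 else 0) ≤
      ∑ e, ∑ f, α e * α f * (if ∃ g, 0 < β g ∧ R e g ∧ R f g then 1 else 0) +
      ∑ g, ∑ h, β g * β h * (if ∃ e, 0 < α e ∧ R e g ∧ R e h then 1 else 0) := by
  have h1 := sum_degree_ratio_le hα hβ R
  have h2 := sum_degree_ratio_le hβ hα fun g e => R e g
  rw [Finset.sum_comm] at h2
  refine le_trans ?_ (add_le_add h1 h2)
  rw [Finset.mul_sum, ← Finset.sum_add_distrib]
  refine Finset.sum_le_sum fun e _ => ?_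
  rw [Finset.mul_sum, ← Finset.sum_add_distrib]
  refine Finset.sum_le_sum fun g _ => ?_
  rcases (hα e).eq_or_lt with h | ha
  · simp [← h]
  rcases (hβ g).eq_or_lt with h | hb
  · simp [← h]
  by_cases hr : R e g
  swap
  · simp [hr]
  set x : ℝ := ∑ f, α f * if R f g then 1 else 0 with hx
  set y : ℝ := ∑ h, β h * if R e h then 1 else 0 with hy
  -- For an edge `eg`, `x` and `y` are the weighted degrees of its two ends. The two ratio sums
  -- contribute `x / y + y / x ≥ 2` per edge.
  have hx0 : 0 < x := by
    refine ha.trans_le ?_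
    have := Finset.single_le_sum (f := fun f => α f * if R f g then (1 : ℝ) else 0)
      (fun f _ => mul_nonneg (hα f) (by split_ifs <;> norm_num)) (Finset.mem_univ e)
    simpa [hr, hx] using this
  have hy0 : 0 < y := by
    refine hb.trans_le ?_
    have := Finset.single_le_sum (f := fun h => β h * if R e h then (1 : ℝ) else 0)
      (fun f _ => mul_nonneg (hβ f) (by split_ifs <;> norm_num)) (Finset.mem_univ g)
    simpa [hr, hy] using this
  have hxy : 2 ≤ x / y + y / x := by
    rw [div_add_div _ _ hy0.ne' hx0.ne', le_div_iff₀ (by positivity)]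
    nlinarith [sq_nonneg (x - y)]
  simp only [hr, if_true, mul_one]
  nlinarith [mul_le_mul_of_nonneg_left hxy (mul_pos ha hb).le]

end CommonNeighbours

/-! ### Excess between matched pairs: links and common links -/

section Profile
variable {V : Type*} [Fintype V] {G : ColouringTemplate 3 V} {c : V → ℝ} {μ : Fin 3 → V × V → ℝ}

open Classical in
/-- The mass of the pairs of type `k` for which `d` is exceptional with colour `i`. -/
noncomputable def excMass (G : ColouringTemplate 3 V) (μ : Fin 3 → V × V → ℝ) (d : V)
    (k i : Fin 3) : ℝ := ∑ p, μ k p * if IsExc G d k i p then 1 else 0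

open Classical in
/-- The mass of the pairs of type `k` and type `l` joined with excess one. -/
noncomputable def linkMass (G : ColouringTemplate 3 V) (μ : Fin 3 → V × V → ℝ)
    (k l : Fin 3) : ℝ := ∑ p, ∑ q, μ k p * μ l q * if cross (excess G) p q = 1 then 1 else 0

open Classical in
/-- The mass of the couples of pairs of type `k` linked to a common pair of type `l`. -/
noncomputable def commonMass (G : ColouringTemplate 3 V) (μ : Fin 3 → V × V → ℝ)
    (k l : Fin 3) : ℝ := ∑ p, ∑ q, μ k p * μ k q *
      if ∃ g, 0 < μ l g ∧ cross (excess G) p g = 1 ∧ cross (excess G) q g = 1 then 1 else 0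

open Classical in
theorem IsSplitting.two_mul_linkMass_le (hS : IsSplitting G c μ) (k l : Fin 3) :
    2 * linkMass G μ k l ≤ commonMass G μ k l + commonMass G μ l k := by
  have := two_mul_sum_le_sum_common (hS.pair_nonneg k) (hS.pair_nonneg l)
    fun p q => cross (excess G) p q = 1
  have e : commonMass G μ l k = ∑ p, ∑ q, μ l p * μ l q *
      if ∃ g, 0 < μ k g ∧ cross (excess G) g p = 1 ∧ cross (excess G) g q = 1 then 1 else 0 := by
    unfold commonMass
    simp only [fun p g => cross_comm (excess_comm (G := G)) p g]
  rw [e]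
  unfold linkMass commonMass
  convert this

theorem linkMass_comm (k l : Fin 3) : linkMass G μ k l = linkMass G μ l k := by
  unfold linkMass
  rw [Finset.sum_comm]
  refine Finset.sum_congr rfl fun q _ => Finset.sum_congr rfl fun p _ => ?_
  rw [cross_comm excess_comm p q, mul_comm (μ k p)]

theorem sum_mul_sum_mul (k l : Fin 3) (f g : V × V → ℝ) :
    ∑ p, ∑ q, μ k p * μ l q * (f p * g q) = (∑ p, μ k p * f p) * ∑ q, μ l q * g q := by
  rw [Finset.sum_mul_sum]
  exact Finset.sum_congr rfl fun p _ => Finset.sum_congr rfl fun q _ => by ring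

theorem sum_mul_sum_mul_const (k l : Fin 3) (b : ℝ) :
    ∑ p, ∑ q, μ k p * μ l q * b = b * ((∑ p, μ k p) * ∑ q, μ l q) := by
  rw [Finset.sum_mul_sum, Finset.mul_sum]
  refine Finset.sum_congr rfl fun p _ => ?_
  rw [Finset.mul_sum]
  exact Finset.sum_congr rfl fun q _ => by ring

/-- A couple of pairs of type `i` loses one from the maximum four for each other type in which it
has a common link. -/
theorem crossSum_excess_self_le (hG : ¬ HasRainbowTriangle G) (hF : NoTriple G)
    (hS : IsSplitting G c μ) {i j k : Fin 3} (h : Distinct i j k) :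
    crossSum μ (excess G) i i ≤
      4 * (∑ p, μ i p) ^ 2 - commonMass G μ i j - commonMass G μ i k := by
  classical
  have := crossSum_le (k := i) (l := i) hS (f := excess G) (θ := fun p q => 4 -
    (if ∃ g, 0 < μ j g ∧ cross (excess G) p g = 1 ∧ cross (excess G) q g = 1 then 1 else 0) -
    (if ∃ g, 0 < μ k g ∧ cross (excess G) p g = 1 ∧ cross (excess G) q g = 1 then 1 else 0))
    fun p q hp hq => by
      have hp := hS.isDouble i p hp
      have hq := hS.isDouble i q hq
      have key : ∀ {j k}, Distinct i j k →
          (∃ g, 0 < μ j g ∧ cross (excess G) p g = 1 ∧ cross (excess G) q g = 1) →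
          cross (excess G) p q ≤ 3 := fun h ⟨g, hg, h1, h2⟩ =>
        cross_excess_le_three hG hF h hp hq (hS.isDouble _ g hg) h1 h2
      split_ifs with h1 h2 h2
      · obtain ⟨g, hg, h3, h4⟩ := h1
        obtain ⟨r, hr, h5, h6⟩ := h2
        have := cross_excess_le_two hG hF h hp hq (hS.isDouble _ g hg) (hS.isDouble _ r hr)
          h3 h4 h5 h6
        norm_num
        exact_mod_cast this
      · have := key h h1
        norm_num
        exact_mod_cast this
      · have := key h.swap h2
        norm_num
        exact_mod_cast this
      · have := cross_excess_le_four hF p q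
        norm_num
        exact_mod_cast this
  refine this.trans_eq ?_
  simp only [mul_sub, Finset.sum_sub_distrib, sum_mul_sum_mul_const]
  rw [sq]
  rfl

/-- Only links contribute positively. A couple for which `d` is exceptional on both sides, with the
colours exchanged, has excess at most `-1` and is therefore no link. -/
theorem crossSum_excess_le (hG : ¬ HasRainbowTriangle G) (hF : NoTriple G)
    (hS : IsSplitting G c μ) {k l : Fin 3} (hkl : k ≠ l) (d : V) :
    crossSum μ (excess G) k l ≤ linkMass G μ k l - excMass G μ d k l * excMass G μ d l k := by
  classical
  have := crossSum_le (k := k) (l := l) hS (f := excess G) (θ := fun p q =>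
    (if cross (excess G) p q = 1 then 1 else 0) -
    (if IsExc G d k l p then 1 else 0) * (if IsExc G d l k q then 1 else 0))
    fun p q hp hq => by
      have hp := hS.isDouble k p hp
      have hq := hS.isDouble l q hq
      have h1 := cross_excess_le_one hG hF hkl hp hq
      by_cases h2 : IsExc G d k l p
      · by_cases h3 : IsExc G d l k q
        · have h4 := cross_excess_le_neg_one hG hF hp hq h2 h3
          have h5 : ¬ cross (excess G) p q = 1 := by omega
          simp only [h2, h3, h5, if_true, if_false]
          norm_num
          exact_mod_cast h4
        · simp only [h3, if_false, mul_zero, sub_zero]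
          split_ifs with h6
          · exact_mod_cast h1
          · have : cross (excess G) p q ≤ 0 := by omega
            exact_mod_cast this
      · simp only [h2, if_false, zero_mul, sub_zero]
        split_ifs with h6
        · exact_mod_cast h1
        · have : cross (excess G) p q ≤ 0 := by omega
          exact_mod_cast this
  refine this.trans_eq ?_
  simp only [mul_sub, Finset.sum_sub_distrib, sum_mul_sum_mul]
  rfl

end Profile

/-! ### Total excess bounds and the numerical profile of a template -/

section Profile
variable {V : Type*} [Fintype V] {G : ColouringTemplate 3 V} {c : V → ℝ} {μ : Fin 3 → V × V → ℝ}

theorem IsSplitting.excMass_nonneg (hS : IsSplitting G c μ) (d : V) (k i : Fin 3) :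
    0 ≤ excMass G μ d k i :=
  Finset.sum_nonneg fun p _ => mul_nonneg (hS.pair_nonneg k p) (by split_ifs <;> norm_num)

theorem excMass_self (d : V) (k : Fin 3) : excMass G μ d k k = 0 := by
  simp [excMass, IsExc]

theorem IsSplitting.excMass_add_le (hS : IsSplitting G c μ) (d : V) {k i j : Fin 3} (hij : i ≠ j) :
    excMass G μ d k i + excMass G μ d k j ≤ ∑ p, μ k p := by
  unfold excMass
  rw [← Finset.sum_add_distrib]
  refine Finset.sum_le_sum fun p _ => ?_
  have := hS.pair_nonneg k p
  split_ifs with h1 h2 <;> first | exact absurd (h1.unique h2) hij | linarith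

open Classical in
theorem excess_add_le_sum (hG : ¬ HasRainbowTriangle G) (hF : NoTriple G)
    (hS : IsSplitting G c μ) {d : V} {k : Fin 3} {p : V × V} (hd : 0 < c d) (hp : 0 < μ k p) :
    ((excess G d p.1 : ℝ) + excess G d p.2) ≤ ∑ i, if IsExc G d k i p then 1 else 0 := by
  have h := hS.not_double d k p hd hp
  by_cases hx : ∀ i, ¬ IsExc G d k i p
  · have := excess_add_nonpos hG hF (hS.isDouble k p hp) h hx
    simp only [hx, if_false, Finset.sum_const_zero]
    exact_mod_cast this
  · push Not at hx
    obtain ⟨i, hi⟩ := hx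
    have h1 := hF d p.1
    have h2 := hF d p.2
    have h3 : excess G d p.1 + excess G d p.2 ≤ 1 := by omega
    have h4 : (excess G d p.1 : ℝ) + excess G d p.2 ≤ 1 := by exact_mod_cast h3
    refine h4.trans ((le_of_eq ?_).trans
      (Finset.single_le_sum (fun j _ => by split_ifs <;> norm_num) (Finset.mem_univ i)))
    rw [if_pos hi]

theorem sum_mul_sum_exc (d : V) (k : Fin 3) [∀ i p, Decidable (IsExc G d k i p)] :
    ∑ p, μ k p * ∑ i, (if IsExc G d k i p then 1 else 0) = ∑ i, excMass G μ d k i := by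
  simp only [Finset.mul_sum]
  rw [Finset.sum_comm]
  refine Finset.sum_congr rfl fun i _ => Finset.sum_congr rfl fun p _ => ?_
  congr

/-- Summed over all types, the link masses are absorbed by the common-link masses subtracted within
the types. The vertex `d₀` in the penalty is free, so that one may later average over it. -/
theorem sum_excess_le (hG : ¬ HasRainbowTriangle G) (hF : NoTriple G) (hS : IsSplitting G c μ)
    (d₀ : V) :
    ∑ u, ∑ v, (excess G u v : ℝ) ≤ 2 * ∑ d, c d * ∑ k, ∑ i, excMass G μ d k i +
      4 * ∑ k, (∑ p, μ k p) ^ 2 -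
      2 * (excMass G μ d₀ 0 1 * excMass G μ d₀ 1 0 + excMass G μ d₀ 0 2 * excMass G μ d₀ 2 0 +
        excMass G μ d₀ 1 2 * excMass G μ d₀ 2 1) := by
  classical
  have h1 := hS.sum_sum_le excess_comm (fun _ _ => le_rfl)
    (η := fun d k p => ∑ i, if IsExc G d k i p then 1 else 0)
    fun d k p hd hp => excess_add_le_sum hG hF hS hd hp
  simp only [sum_mul_sum_exc] at h1
  refine h1.trans ?_
  have h012 : Distinct 0 1 2 := by unfold Distinct; decide
  have a0 := crossSum_excess_self_le hG hF hS h012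
  have a1 := crossSum_excess_self_le hG hF hS h012.rotate
  have a2 := crossSum_excess_self_le hG hF hS h012.rotate.rotate
  have b1 := crossSum_excess_le hG hF hS (k := 0) (l := 1) (by decide) d₀
  have b2 := crossSum_excess_le hG hF hS (k := 0) (l := 2) (by decide) d₀
  have b3 := crossSum_excess_le hG hF hS (k := 1) (l := 0) (by decide) d₀
  have b4 := crossSum_excess_le hG hF hS (k := 1) (l := 2) (by decide) d₀
  have b5 := crossSum_excess_le hG hF hS (k := 2) (l := 0) (by decide) d₀
  have b6 := crossSum_excess_le hG hF hS (k := 2) (l := 1) (by decide) d₀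
  have c1 := hS.two_mul_linkMass_le 0 1
  have c2 := hS.two_mul_linkMass_le 0 2
  have c3 := hS.two_mul_linkMass_le 1 2
  rw [linkMass_comm 1 0] at b3
  rw [linkMass_comm 2 0] at b5
  rw [linkMass_comm 2 1] at b6
  have e : ∑ k, ∑ l, crossSum μ (excess G) k l ≤ 4 * ∑ k, (∑ p, μ k p) ^ 2 -
      2 * (excMass G μ d₀ 0 1 * excMass G μ d₀ 1 0 + excMass G μ d₀ 0 2 * excMass G μ d₀ 2 0 +
        excMass G μ d₀ 1 2 * excMass G μ d₀ 2 1) := by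
    simp only [Fin.sum_univ_three]
    linarith
  linarith

theorem crossSum_excessOff_nonpos (hG : ¬ HasRainbowTriangle G) (hS : IsSplitting G c μ)
    {k l l' : Fin 3} (hl : l ≠ k) : crossSum μ (excessOff G k) l l' ≤ 0 := by
  refine (crossSum_le hS (θ := fun _ _ => 0) fun p q hp _ => ?_).trans_eq (by simp)
  have h1 := (hS.isDouble l p hp).excessOff_add_nonpos hG hl q.1
  have h2 := (hS.isDouble l p hp).excessOff_add_nonpos hG hl q.2
  have : cross (excessOff G k) p q ≤ 0 := by unfold cross; omega
  exact_mod_cast this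

theorem crossSum_excessOff_self_le (hS : IsSplitting G c μ) (k : Fin 3) :
    crossSum μ (excessOff G k) k k ≤ 4 * (∑ p, μ k p) ^ 2 := by
  refine (crossSum_le hS (θ := fun _ _ => 4) fun p q hp _ => ?_).trans_eq
    (by rw [sum_mul_sum_mul_const, sq])
  have := excessOff_le_one (G := G) k
  have : cross (excessOff G k) p q ≤ 4 := by
    have h1 := this p.1 q.1
    have h2 := this p.1 q.2
    have h3 := this p.2 q.1
    have h4 := this p.2 q.2
    unfold cross; omega
  exact_mod_cast this

theorem crossSum_comm {f : V → V → ℤ} (hf : ∀ u v, f u v = f v u) (k l : Fin 3) :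
    crossSum μ f k l = crossSum μ f l k := by
  unfold crossSum
  rw [Finset.sum_comm]
  refine Finset.sum_congr rfl fun q _ => Finset.sum_congr rfl fun p _ => ?_
  rw [cross_comm hf p q, mul_comm (μ k p)]

/-- Every couple contributes at most zero, and at most `-2` when `d` is exceptional for the pair of
type `l` with colour `k` and exceptional for the pair of type `k` with any colour. -/
theorem crossSum_excessOff_le (hG : ¬ HasRainbowTriangle G) (hF : NoTriple G)
    (hS : IsSplitting G c μ) {k l : Fin 3} (hl : l ≠ k) (d : V) :
    crossSum μ (excessOff G k) l k ≤ -2 * (excMass G μ d l k * ∑ i, excMass G μ d k i) := by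
  classical
  have := crossSum_le (k := l) (l := k) hS (f := excessOff G k) (θ := fun p q =>
    ((if IsExc G d l k p then 1 else 0) * ∑ i, if IsExc G d k i q then 1 else 0) * -2)
    fun p q hp hq => by
      have hp := hS.isDouble l p hp
      have hq := hS.isDouble k q hq
      have h0 : cross (excessOff G k) p q ≤ 0 := by
        have h1 := hp.excessOff_add_nonpos hG hl q.1
        have h2 := hp.excessOff_add_nonpos hG hl q.2
        unfold cross; omega
      by_cases h2 : IsExc G d l k p
      · by_cases h3 : ∃ i, IsExc G d k i q
        · obtain ⟨i, hi⟩ := h3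
          have h4 := cross_excessOff_le_neg_two hG hF hp hq h2 hi
          have : ∀ j, IsExc G d k j q ↔ j = i := fun j => ⟨fun h => h.unique hi, fun h => h ▸ hi⟩
          simp only [h2, this, if_true, Finset.sum_ite_eq', Finset.mem_univ]
          norm_num
          exact_mod_cast h4
        · push Not at h3
          simp only [h3, if_false, Finset.sum_const_zero, mul_zero, zero_mul]
          exact_mod_cast h0
      · simp only [h2, if_false, zero_mul]
        exact_mod_cast h0
  refine this.trans_eq ?_
  simp only [← mul_assoc _ _ (-2 : ℝ), ← Finset.sum_mul, sum_mul_sum_mul, sum_mul_sum_exc]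
  rw [mul_comm]
  rfl

theorem sum_excessOff_le (hG : ¬ HasRainbowTriangle G) (hF : NoTriple G) (hS : IsSplitting G c μ)
    {i j k : Fin 3} (h : Distinct i j k) (d₀ : V) :
    ∑ u, ∑ v, (excessOff G k u v : ℝ) ≤ 2 * ∑ d, c d * ∑ i, excMass G μ d k i +
      4 * (∑ p, μ k p) ^ 2 -
      4 * ((excMass G μ d₀ i k + excMass G μ d₀ j k) * ∑ i, excMass G μ d₀ k i) := by
  classical
  have h1 := hS.sum_sum_le (excessOff_comm k) (excessOff_le_excess k)
    (η := fun d l p => if l = k then ∑ i, if IsExc G d l i p then 1 else 0 else 0)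
    fun d l p hd hp => by
      split_ifs with hl
      · refine le_trans ?_ (excess_add_le_sum hG hF hS hd hp)
        have h2 := excessOff_le_excess (G := G) k d p.1
        have h3 := excessOff_le_excess (G := G) k d p.2
        exact_mod_cast add_le_add h2 h3
      · have := (hS.isDouble l p hp).excessOff_add_nonpos hG hl d
        rw [excessOff_comm k p.1, excessOff_comm k p.2] at this
        exact_mod_cast this
  have e1 : ∀ d, ∑ l, ∑ p, μ l p * (if l = k then ∑ i, if IsExc G d l i p then 1 else 0 else 0) =
      ∑ i, excMass G μ d k i := by
    intro d
    rw [Finset.sum_eq_single k]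
    · simp only [if_true, sum_mul_sum_exc]
    · intro l _ hl
      simp [hl]
    · simp
  simp only [e1] at h1
  refine h1.trans ?_
  rw [h.sum_eq, h.sum_eq, h.sum_eq, h.sum_eq]
  have a1 := crossSum_excessOff_self_le hS (G := G) k
  have a2 := crossSum_excessOff_le hG hF hS h.2.2 d₀
  have a3 := crossSum_excessOff_le hG hF hS h.2.1 d₀
  have a4 := crossSum_excessOff_nonpos hG hS h.2.2 (l' := i)
  have a5 := crossSum_excessOff_nonpos hG hS h.2.2 (l' := j)
  have a6 := crossSum_excessOff_nonpos hG hS h.2.1 (l' := i)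
  have a7 := crossSum_excessOff_nonpos hG hS h.2.1 (l' := j)
  rw [crossSum_comm (excessOff_comm k) k i, crossSum_comm (excessOff_comm k) k j]
  linarith

/-- Averaging over `d₀` with the weights `w` of the single vertices puts the linear gain and the
quadratic penalty into one sum, so that later estimates can be made vertex by vertex. -/
theorem le_add_sum_of_forall_le {T B δ : ℝ} {w g f : V → ℝ} (hw : ∀ d, 0 ≤ w d)
    (hw1 : ∑ d, w d = 1) (h : ∀ d₀, T ≤ 2 * ∑ d, δ * w d * g d + B - f d₀) :
    T ≤ B + ∑ d, w d * (2 * δ * g d - f d) := by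
  have h1 : ∑ d₀, w d₀ * T ≤ ∑ d₀, w d₀ * (2 * ∑ d, δ * w d * g d + B - f d₀) :=
    Finset.sum_le_sum fun d _ => mul_le_mul_of_nonneg_left (h d) (hw d)
  have e1 : ∑ d, w d * (2 * δ * g d - f d) = 2 * ∑ d, δ * w d * g d - ∑ d, w d * f d := by
    rw [Finset.mul_sum, ← Finset.sum_sub_distrib]
    exact Finset.sum_congr rfl fun d _ => by ring
  have e2 : ∑ d₀, w d₀ * (2 * ∑ d, δ * w d * g d + B - f d₀) =
      2 * ∑ d, δ * w d * g d + B - ∑ d, w d * f d := by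
    simp only [mul_sub, Finset.sum_sub_distrib, ← Finset.sum_mul, hw1, one_mul]
  rw [← Finset.sum_mul, hw1, one_mul, e2] at h1
  linarith

/-- The numerical data extracted from a splitting: the masses `a` of the three types, the total
mass `δ` of the single vertices with its distribution `w`, and the exceptional masses `y`. -/
structure IsProfile (G : ColouringTemplate 3 V) (a : Fin 3 → ℝ) (δ : ℝ) (w : V → ℝ)
    (y : V → Fin 3 → Fin 3 → ℝ) : Prop where
  a_nonneg : ∀ k, 0 ≤ a k
  δ_nonneg : 0 ≤ δ
  w_nonneg : ∀ d, 0 ≤ w d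
  sum_w : ∑ d, w d = 1
  sum_a : ∑ k, a k + δ = Fintype.card V
  y_nonneg : ∀ d k i, 0 ≤ y d k i
  y_add_le : ∀ d {i j k}, Distinct i j k → y d k i + y d k j ≤ a k / 2
  sum_excess_le : ∀ {i j k}, Distinct i j k → ∑ u, ∑ v, (excess G u v : ℝ) ≤ ∑ k, a k ^ 2 +
    ∑ d, w d * (2 * δ * (y d i j + y d i k + y d j i + y d j k + y d k i + y d k j) -
      2 * (y d i j * y d j i + y d i k * y d k i + y d j k * y d k j))
  sum_excessOff_le : ∀ {i j k}, Distinct i j k → ∑ u, ∑ v, (excessOff G k u v : ℝ) ≤ a k ^ 2 +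
    ∑ d, w d * (2 * δ * (y d k i + y d k j) - 4 * ((y d i k + y d j k) * (y d k i + y d k j)))

theorem exists_isProfile [Nonempty V] (hG : ¬ HasRainbowTriangle G) (hF : NoTriple G) :
    ∃ a δ w y, IsProfile G a δ w y := by
  classical
  obtain ⟨c, μ, hS⟩ := exists_isSplitting hF
  obtain ⟨w, hw, hw1, hcw⟩ : ∃ w : V → ℝ, (∀ d, 0 ≤ w d) ∧ ∑ d, w d = 1 ∧
      ∀ d, c d = (∑ d, c d) * w d := by
    -- Without single vertices any distribution will do; a point mass is taken.
    rcases (Finset.sum_nonneg fun d _ => hS.nonneg d : 0 ≤ ∑ d, c d).eq_or_lt with h | h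
    · have h0 := (Finset.sum_eq_zero_iff_of_nonneg fun d _ => hS.nonneg d).1 h.symm
      obtain ⟨d₀⟩ := ‹Nonempty V›
      refine ⟨Pi.single d₀ 1, fun d => ?_, by simp, fun d => ?_⟩
      · rw [Pi.single_apply]; split_ifs <;> norm_num
      · rw [← h, zero_mul, h0 d (Finset.mem_univ d)]
    · refine ⟨fun d => c d / ∑ d, c d, fun d => div_nonneg (hS.nonneg d) h.le, ?_, fun d => ?_⟩
      · rw [← Finset.sum_div, div_self h.ne']
      · rw [mul_div_cancel₀ _ h.ne']
  set δ := ∑ d, c d with hδ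
  have hS' : IsSplitting G (fun d => δ * w d) μ := by rwa [← funext hcw]
  have e : ∀ {i j k} (h : Distinct i j k) (d : V), ∑ l, excMass G μ d k l =
      excMass G μ d k i + excMass G μ d k j := fun h d => by
    rw [h.sum_eq, excMass_self, add_zero]
  -- The factor two counts vertices instead of pairs; the exceptional masses remain masses of pairs,
  -- hence their bound `a k / 2`.
  refine ⟨fun k => 2 * ∑ p, μ k p, δ, w, excMass G μ, fun k => ?_, ?_, hw, hw1, ?_,
    hS.excMass_nonneg, fun d i j k h => ?_, fun {i j k} h => ?_, fun {i j k} h => ?_⟩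
  · exact mul_nonneg zero_le_two (Finset.sum_nonneg fun p _ => hS.pair_nonneg k p)
  · exact Finset.sum_nonneg fun d _ => hS.nonneg d
  · rw [hS.card_eq, ← Finset.mul_sum, add_comm]
  · have := hS.excMass_add_le d (k := k) h.1
    linarith
  · have hp : ∀ d, excMass G μ d i j * excMass G μ d j i + excMass G μ d i k * excMass G μ d k i +
        excMass G μ d j k * excMass G μ d k j = excMass G μ d 0 1 * excMass G μ d 1 0 +
        excMass G μ d 0 2 * excMass G μ d 2 0 + excMass G μ d 1 2 * excMass G μ d 2 1 := by
      intro d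
      have h1 : ∑ k, ∑ l, excMass G μ d k l * excMass G μ d l k =
          2 * (excMass G μ d i j * excMass G μ d j i + excMass G μ d i k * excMass G μ d k i +
            excMass G μ d j k * excMass G μ d k j) := by
        simp only [h.sum_eq, excMass_self]; ring
      have h2 : ∑ k, ∑ l, excMass G μ d k l * excMass G μ d l k =
          2 * (excMass G μ d 0 1 * excMass G μ d 1 0 + excMass G μ d 0 2 * excMass G μ d 2 0 +
            excMass G μ d 1 2 * excMass G μ d 2 1) := by
        simp only [Fin.sum_univ_three, excMass_self]; ring
      linarith
    have hs : ∀ d, ∑ k, ∑ i, excMass G μ d k i = excMass G μ d i j + excMass G μ d i k +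
        excMass G μ d j i + excMass G μ d j k + excMass G μ d k i + excMass G μ d k j := by
      intro d
      rw [h.sum_eq, e h, e h.rotate, e h.rotate.rotate]
      ring
    have := le_add_sum_of_forall_le hw hw1 fun d₀ => sum_excess_le hG hF hS' d₀
    simp only [hs, ← hp] at this
    simpa only [mul_pow, ← Finset.mul_sum, show (2 : ℝ) ^ 2 = 4 by norm_num] using this
  · have := le_add_sum_of_forall_le hw hw1 fun d₀ => sum_excessOff_le hG hF hS' h d₀
    simp only [e h] at this
    simpa only [mul_pow, show (2 : ℝ) ^ 2 = 4 by norm_num] using this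

end Profile

/-! ### Real inequalities for the masses -/

section Numerics

theorem mixed_case_nonneg {a b c δ A₁ A₂ B₁ B₃ C₂ C₃ : ℝ} (hb : 0 ≤ b) (hc : 0 ≤ c) (hδ : 0 ≤ δ)
    (hA₁ : 0 ≤ A₁) (hA₂ : 0 ≤ A₂) (hB₁ : 0 ≤ B₁) (hB₃ : 0 ≤ B₃) (hC₂ : 0 ≤ C₂) (hC₃ : 0 ≤ C₃)
    (hA : A₁ + A₂ ≤ a / 2) (hB : B₁ + B₃ ≤ b / 2) (hC : C₂ + C₃ ≤ c / 2) (h : b + c + δ ≤ a) :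
    0 ≤ 2 * a * (δ / 2 + (A₁ + B₁)) + 2 * c * (δ / 2 - (A₁ + B₁)) -
      2 * δ * (A₁ + A₂ + B₁ + B₃ + C₂ + C₃) + 2 * (A₂ * B₃ + A₁ * C₃ + B₁ * C₂) + δ ^ 2 / 3 := by
  have k1 : 0 ≤ δ * (c / 2 - (C₂ + C₃)) := mul_nonneg hδ (by linarith)
  have k2 : 0 ≤ A₁ * C₃ := by positivity
  have k3 : 0 ≤ B₁ * C₂ := by positivity
  have k4 : 0 ≤ (a - c - δ) * (A₁ + B₁) := mul_nonneg (by linarith) (by linarith)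
  -- After the nonnegative terms `k1` to `k4` are dropped, only `A₂` and `B₃` remain. The rest is
  -- linear in `B₃`, hence worst at `0` or at `b / 2`, according to the sign of `δ - A₂`.
  suffices 0 ≤ δ * (a - 2 * A₂) - 2 * (δ - A₂) * B₃ + δ ^ 2 / 3 by nlinarith
  rcases le_total δ A₂ with h3 | h3
  · have := mul_nonneg hδ (by linarith : 0 ≤ a - 2 * A₂)
    have := mul_nonneg (by linarith : 0 ≤ A₂ - δ) hB₃
    nlinarith
  · have k5 : 0 ≤ (δ - A₂) * (b / 2 - B₃) := mul_nonneg (by linarith) (by linarith)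
    suffices 0 ≤ δ * (a - 2 * A₂) - (δ - A₂) * b + δ ^ 2 / 3 by nlinarith
    rcases le_total (2 * δ) b with h4 | h4
    · nlinarith
    · rcases le_total (2 * δ) a with h5 | h5
      · nlinarith [mul_nonneg (by linarith : 0 ≤ 2 * δ - b) (by linarith : 0 ≤ δ - A₂)]
      · nlinarith [mul_nonneg (by linarith : 0 ≤ 2 * δ - b) (by linarith : 0 ≤ a / 2 - A₂),
          sq_nonneg (δ - 2 * b)]

/-- The gain of the three masses `a ≥ b + c + δ` outweighs the excess contributed by the
exceptional masses. -/
theorem gain_nonneg {a b c δ A₁ A₂ B₁ B₃ C₂ C₃ : ℝ} (hb : 0 ≤ b) (hc : 0 ≤ c) (hδ : 0 ≤ δ)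
    (hA₁ : 0 ≤ A₁) (hA₂ : 0 ≤ A₂) (hB₁ : 0 ≤ B₁) (hB₃ : 0 ≤ B₃) (hC₂ : 0 ≤ C₂) (hC₃ : 0 ≤ C₃)
    (hA : A₁ + A₂ ≤ a / 2) (hB : B₁ + B₃ ≤ b / 2) (hC : C₂ + C₃ ≤ c / 2) (h : b + c + δ ≤ a) :
    2 * δ * (A₁ + A₂ + B₁ + B₃ + C₂ + C₃) - 2 * (A₂ * B₃ + A₁ * C₃ + B₁ * C₂) ≤
      2 * a * (δ - max (δ / 2 - (A₂ + C₂)) 0 - max (δ / 2 - (A₁ + B₁)) 0) +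
        2 * b * max (δ / 2 - (A₂ + C₂)) 0 + 2 * c * max (δ / 2 - (A₁ + B₁)) 0 + δ ^ 2 / 3 := by
  rcases le_total (δ / 2) (A₂ + C₂) with h2 | h2 <;> rcases le_total (δ / 2) (A₁ + B₁) with h1 | h1
  · rw [max_eq_right (by linarith), max_eq_right (by linarith)]
    have := mul_nonneg hδ (by linarith : 0 ≤ a - b - c)
    have := mul_nonneg hδ (by linarith :
      0 ≤ a / 2 + b / 2 + c / 2 - (A₁ + A₂ + B₁ + B₃ + C₂ + C₃))
    have : 0 ≤ A₂ * B₃ + A₁ * C₃ + B₁ * C₂ := by positivity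
    nlinarith
  · rw [max_eq_right (by linarith), max_eq_left (by linarith)]
    have := mixed_case_nonneg hb hc hδ hA₁ hA₂ hB₁ hB₃ hC₂ hC₃ hA hB hC h
    linarith
  · rw [max_eq_left (by linarith), max_eq_right (by linarith)]
    have := mixed_case_nonneg hc hb hδ hA₂ hA₁ hC₂ hC₃ hB₁ hB₃ (by linarith) hC hB
      (by linarith : c + b + δ ≤ a)
    linarith
  · rw [max_eq_left (by linarith), max_eq_left (by linarith)]
    have := mul_nonneg hδ (by linarith : 0 ≤ b / 2 - (B₁ + B₃))
    have := mul_nonneg hδ (by linarith : 0 ≤ c / 2 - (C₂ + C₃))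
    have := mul_nonneg hδ hB₁
    have := mul_nonneg hδ hC₂
    have := mul_nonneg (by linarith : 0 ≤ a - δ - b) (by linarith : 0 ≤ A₂ + C₂)
    have := mul_nonneg (by linarith : 0 ≤ a - δ - c) (by linarith : 0 ≤ A₁ + B₁)
    have : 0 ≤ A₂ * B₃ + A₁ * C₃ + B₁ * C₂ := by positivity
    nlinarith

/-- If the sum of squares exceeds twice the sum of products, the largest of three masses is
larger than the other two together. -/
theorem add_add_le_of_sq {a b c δ : ℝ} (hb : 0 ≤ b) (hc : 0 ≤ c) (hab : b ≤ a) (hac : c ≤ a)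
    (h : (a + b + c) ^ 2 + δ ^ 2 < 2 * (a ^ 2 + b ^ 2 + c ^ 2)) : b + c + δ ≤ a := by
  by_contra! hlt
  -- If `a ≥ b + c`, this gives `δ < a - b - c`. Otherwise `0 ≤ b + c - a ≤ min b c`, whose square
  -- is at most `b * c`.
  have h1 : δ ^ 2 + 4 * (b * c) < (a - b - c) ^ 2 := by nlinarith
  rcases le_total 0 (a - b - c) with h2 | h2
  · nlinarith [mul_nonneg hb hc]
  · rcases le_total b c with h3 | h3 <;> nlinarith [sq_nonneg δ, mul_nonneg hb hc]

/-- Among three masses with sum `n`, bounded below by thresholds, the sum of squares is largest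
when the thresholds are attained. -/
theorem sum_sq_le_of_le {n x y z p q r : ℝ} (hzy : z ≤ y) (hyx : y ≤ x) (hn : 0 ≤ n)
    (hxyz : x + y + z = 1) (hpqr : p + q + r = n) (hqp : q ≤ p) (hrp : r ≤ p)
    (hp : p ≤ x * n) (hq : z * n ≤ q) (hr : z * n ≤ r) :
    p ^ 2 + q ^ 2 + r ^ 2 ≤ (x ^ 2 + y ^ 2 + z ^ 2) * n ^ 2 := by
  wlog hrq : r ≤ q generalizing q r
  · have := this (by linarith) hrp hqp hr hq (le_of_not_ge hrq)
    linarith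
  have e : x * n + y * n + z * n = n := by rw [← add_mul, ← add_mul, hxyz, one_mul]
  have h1 : z * n ≤ y * n := mul_le_mul_of_nonneg_right hzy hn
  have h2 : y * n ≤ x * n := mul_le_mul_of_nonneg_right hyx hn
  have h3 := mul_nonneg (sub_nonneg.2 hp) (by linarith : 0 ≤ x * n - y * n + (p - q))
  have h4 := mul_nonneg (sub_nonneg.2 hr) (by linarith : 0 ≤ y * n - z * n + (q - r))
  have e2 : q = x * n + y * n + z * n - p - r := by linarith
  have e3 : (x ^ 2 + y ^ 2 + z ^ 2) * n ^ 2 - (p ^ 2 + q ^ 2 + r ^ 2) =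
      (x * n - p) * (x * n - y * n + (p - q)) + (r - z * n) * (y * n - z * n + (q - r)) := by
    rw [e2]; ring
  linarith

end Numerics

/-! ### The contradiction for templates without triple pairs -/

section Core
variable {V : Type*} [Fintype V] {G : ColouringTemplate 3 V}

theorem exists_distinct_max (a : Fin 3 → ℝ) :
    ∃ i j k, Distinct i j k ∧ a j ≤ a i ∧ a k ≤ a i := by
  obtain ⟨i, hi⟩ := Finite.exists_max a
  obtain ⟨j, k, h⟩ := exists_distinct i
  exact ⟨i, j, k, h, hi j, hi k⟩

variable {a : Fin 3 → ℝ} {δ : ℝ} {w : V → ℝ} {y : V → Fin 3 → Fin 3 → ℝ}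

theorem sum_mul_le_of_le {w f : V → ℝ} {b : ℝ} (hw : ∀ d, 0 ≤ w d) (hw1 : ∑ d, w d = 1)
    (h : ∀ d, f d ≤ b) : ∑ d, w d * f d ≤ b := by
  refine (Finset.sum_le_sum fun d _ => mul_le_mul_of_nonneg_left (h d) (hw d)).trans_eq ?_
  rw [← Finset.sum_mul, hw1, one_mul]

/-- The single vertices contribute at most `δ * (a i + a j + a k)`. With `n = a i + a j + a k + δ`,
excess above `n ^ 2 / 2` becomes the hypothesis of `add_add_le_of_sq`. -/
theorem IsProfile.add_add_le (hP : IsProfile G a δ w y) {i j k : Fin 3} (h : Distinct i j k)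
    (hj : a j ≤ a i) (hk : a k ≤ a i)
    (hS : (Fintype.card V : ℝ) ^ 2 / 2 < ∑ u, ∑ v, (excess G u v : ℝ)) :
    a j + a k + δ ≤ a i := by
  refine add_add_le_of_sq (hP.a_nonneg j) (hP.a_nonneg k) hj hk ?_
  have h1 := hP.sum_excess_le h
  have h2 : ∑ d, w d * (2 * δ * (y d i j + y d i k + y d j i + y d j k + y d k i + y d k j) -
      2 * (y d i j * y d j i + y d i k * y d k i + y d j k * y d k j)) ≤
      δ * (a i + a j + a k) := by
    refine sum_mul_le_of_le hP.w_nonneg hP.sum_w fun d => ?_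
    have e1 := hP.y_add_le d h.rotate
    have e2 := hP.y_add_le d h.rotate.rotate
    have e3 := hP.y_add_le d h
    have := hP.y_nonneg d
    have e4 := mul_nonneg hP.δ_nonneg (by linarith : 0 ≤ (a i + a j + a k) / 2 -
      (y d i j + y d i k + y d j i + y d j k + y d k i + y d k j))
    have e5 := mul_nonneg (this i j) (this j i)
    have e6 := mul_nonneg (this i k) (this k i)
    have e7 := mul_nonneg (this j k) (this k j)
    nlinarith
  have h3 := hP.sum_a
  rw [h.sum_eq] at h1 h3
  rw [← h3] at hS
  nlinarith

/-- The gain at a vertex is `4 * Y * (δ / 2 - X)`, where `Y ≤ a k / 2` is its exceptional mass in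
type `k` and `X` its exceptional mass with colour `k` in the other types. It thus acts like an
enlargement of type `k` by the average of `max (δ / 2 - X) 0`. -/
theorem IsProfile.sum_excessOff_le_sq (hP : IsProfile G a δ w y) {i j k : Fin 3}
    (h : Distinct i j k) : ∑ u, ∑ v, (excessOff G k u v : ℝ) ≤
      (a k + ∑ d, w d * max (δ / 2 - (y d i k + y d j k)) 0) ^ 2 := by
  set D := ∑ d, w d * max (δ / 2 - (y d i k + y d j k)) 0 with hD
  have h1 := hP.sum_excessOff_le h
  have h2 : ∑ d, w d * (2 * δ * (y d k i + y d k j) -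
      4 * ((y d i k + y d j k) * (y d k i + y d k j))) ≤ 2 * a k * D := by
    rw [hD, Finset.mul_sum]
    refine Finset.sum_le_sum fun d _ => ?_
    have e1 := hP.y_add_le d h
    have e2 := hP.y_nonneg d k i
    have e3 := hP.y_nonneg d k j
    have e4 : (y d k i + y d k j) * (δ / 2 - (y d i k + y d j k)) ≤
        a k / 2 * max (δ / 2 - (y d i k + y d j k)) 0 :=
      (mul_le_mul_of_nonneg_left (le_max_left _ 0) (by linarith)).trans
        (mul_le_mul_of_nonneg_right e1 (le_max_right ..))
    have := mul_le_mul_of_nonneg_left e4 (hP.w_nonneg d)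
    linarith
  nlinarith [sq_nonneg D]

/-- A rainbow triangle free template without triple pairs cannot exceed all thresholds. -/
theorem false_of_noTriple [Nonempty V] (hG : ¬ HasRainbowTriangle G) (hF : NoTriple G)
    {x y z : ℝ} (hzy : z ≤ y) (hyx : y ≤ x) (hxyz : x + y + z = 1)
    (hV : 1 / 2 ≤ x ^ 2 + y ^ 2 + z ^ 2) {t : Fin 3 → ℝ} (htz : ∀ k, z ≤ t k)
    (hty : ∀ j k, j ≠ k → y + z ≤ t j + t k)
    (ht : ∀ k, t k = 0 ∨ t k ^ 2 * (Fintype.card V : ℝ) ^ 2 < ∑ u, ∑ v, (excessOff G k u v : ℝ))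
    (hS : (x ^ 2 + y ^ 2 + z ^ 2) * (Fintype.card V : ℝ) ^ 2 < ∑ u, ∑ v, (excess G u v : ℝ)) :
    False := by
  obtain ⟨a, δ, w, m, hP⟩ := exists_isProfile hG hF
  obtain ⟨i, j, k, h, hj, hk⟩ := exists_distinct_max a
  set n : ℝ := (Fintype.card V : ℝ)
  have hn0 : 0 ≤ n := by positivity
  have hdom := hP.add_add_le h hj hk (by nlinarith [sq_nonneg n])
  set Dj := ∑ d, w d * max (δ / 2 - (m d i j + m d k j)) 0 with hDj
  set Dk := ∑ d, w d * max (δ / 2 - (m d i k + m d j k)) 0 with hDk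
  have hDj0 : 0 ≤ Dj :=
    Finset.sum_nonneg fun d _ => mul_nonneg (hP.w_nonneg d) (le_max_right ..)
  have hDk0 : 0 ≤ Dk :=
    Finset.sum_nonneg fun d _ => mul_nonneg (hP.w_nonneg d) (le_max_right ..)
  have hδ := hP.δ_nonneg
  have hm := hP.y_nonneg
  have hDj1 : Dj ≤ δ / 2 := sum_mul_le_of_le hP.w_nonneg hP.sum_w fun d =>
    max_le (by linarith [hm d i j, hm d k j]) (by linarith)
  have hDk1 : Dk ≤ δ / 2 := sum_mul_le_of_le hP.w_nonneg hP.sum_w fun d =>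
    max_le (by linarith [hm d i k, hm d j k]) (by linarith)
  have aj := hP.a_nonneg j
  have ak := hP.a_nonneg k
  -- The excess off `l` gives a lower bound for the enlarged mass of type `l`.
  have key : ∀ l s, 0 ≤ s → ∑ u, ∑ v, (excessOff G l u v : ℝ) ≤ s ^ 2 → t l * n ≤ s := by
    intro l s hs h
    rcases ht l with h0 | h0
    · rwa [h0, zero_mul]
    · exact (abs_le_of_sq_le_sq' (by rw [mul_pow]; linarith) hs).2
  have hqj : t j * n ≤ a j + Dj := key j _ (by linarith) (hP.sum_excessOff_le_sq h.swap)
  have hqk : t k * n ≤ a k + Dk := key k _ (by linarith) (hP.sum_excessOff_le_sq h)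
  have hsum := hP.sum_a
  rw [h.sum_eq] at hsum
  have hle := hP.sum_excess_le h
  have hgain : ∑ d, w d * (2 * δ * (m d i j + m d i k + m d j i + m d j k + m d k i + m d k j) -
      2 * (m d i j * m d j i + m d i k * m d k i + m d j k * m d k j)) ≤
      2 * a i * (δ - Dj - Dk) + 2 * a j * Dj + 2 * a k * Dk + δ ^ 2 / 3 := by
    -- As `w` has sum one, the right side is an average too, and the comparison reduces to
    -- `gain_nonneg` at each vertex.
    have e : 2 * a i * (δ - Dj - Dk) + 2 * a j * Dj + 2 * a k * Dk + δ ^ 2 / 3 =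
        ∑ d, w d * (2 * a i * (δ - max (δ / 2 - (m d i j + m d k j)) 0 -
          max (δ / 2 - (m d i k + m d j k)) 0) + 2 * a j * max (δ / 2 - (m d i j + m d k j)) 0 +
          2 * a k * max (δ / 2 - (m d i k + m d j k)) 0 + δ ^ 2 / 3) := by
      have e1 : ∀ d, w d * (2 * a i * (δ - max (δ / 2 - (m d i j + m d k j)) 0 -
          max (δ / 2 - (m d i k + m d j k)) 0) + 2 * a j * max (δ / 2 - (m d i j + m d k j)) 0 +
          2 * a k * max (δ / 2 - (m d i k + m d j k)) 0 + δ ^ 2 / 3) =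
          (2 * a i * δ + δ ^ 2 / 3) * w d +
          (2 * a j - 2 * a i) * (w d * max (δ / 2 - (m d i j + m d k j)) 0) +
          (2 * a k - 2 * a i) * (w d * max (δ / 2 - (m d i k + m d j k)) 0) := fun d => by ring
      simp only [e1, Finset.sum_add_distrib, ← Finset.mul_sum, hP.sum_w, ← hDj, ← hDk]
      ring
    rw [e]
    refine Finset.sum_le_sum fun d _ => mul_le_mul_of_nonneg_left ?_ (hP.w_nonneg d)
    have := gain_nonneg aj ak hδ (hm d i k) (hm d i j) (hm d j k) (hm d j i) (hm d k j) (hm d k i)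
      (by linarith [hP.y_add_le d h.rotate]) (by linarith [hP.y_add_le d h.rotate.rotate])
      (by linarith [hP.y_add_le d h]) hdom
    linarith
  have hyz : (y + z) * n ≤ (t j + t k) * n := mul_le_mul_of_nonneg_right (hty j k h.2.1) hn0
  have htj := mul_le_mul_of_nonneg_right (htz j) hn0
  have htk := mul_le_mul_of_nonneg_right (htz k) hn0
  have hx : x * n = n - (y + z) * n := by rw [show x = 1 - (y + z) by linarith]; ring
  -- The mass `δ` is distributed: `Dj` to type `j`, `Dk` to type `k`, the rest to the dominant type
  -- `i`. The new masses have sum `n`.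
  have := sum_sq_le_of_le (p := a i + (δ - Dj - Dk)) (q := a j + Dj) (r := a k + Dk) hzy hyx hn0
    hxyz (by linarith) (by linarith) (by linarith) (by linarith) (by linarith) (by linarith)
  rw [h.sum_eq] at hle
  -- The three shares have sum `δ`, so their squares add up to at least `δ ^ 2 / 3`, which covers
  -- the last term of the gain.
  nlinarith [sq_nonneg (δ - Dj - Dk - Dj), sq_nonneg (δ - Dj - Dk - Dk), sq_nonneg (Dj - Dk)]

end Core

/-! ### Deleting a pair that carries all three colours -/

section Deletion
variable {V : Type*} {G : ColouringTemplate 3 V}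

theorem ind_eq_one_of_triple {u v : V} (h : 2 ≤ excess G u v) (i : Fin 3) : ind G i u v = 1 := by
  obtain ⟨j, k, hd⟩ := exists_distinct i
  have := ind_le_one (G := G) i u v
  have := ind_le_one (G := G) j u v
  have := ind_le_one (G := G) k u v
  rw [excess_eq hd] at h
  omega

/-- Different colours on `uw` and `vw` would be completed by `uv`. So one of the two lists is empty,
or both are the same single colour. -/
theorem excess_add_le_one_of_triple (hG : ¬ HasRainbowTriangle G) {u v : V}
    (h : 2 ≤ excess G u v) (w : V) : excess G u w + excess G v w ≤ 1 := by
  have h012 : Distinct 0 1 2 := by unfold Distinct; decide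
  have e0 := ind_eq_one_of_triple h 0
  have e1 := ind_eq_one_of_triple h 1
  have e2 := ind_eq_one_of_triple h 2
  have t1 := ind_triangle hG h012 u v w
  have t2 := ind_triangle hG h012.swap u v w
  have t3 := ind_triangle hG h012.rotate u v w
  have t4 := ind_triangle hG h012.rotate.swap u v w
  have t5 := ind_triangle hG h012.rotate.rotate u v w
  have t6 := ind_triangle hG h012.rotate.rotate.swap u v w
  have b := fun i u v => ind_nonneg (G := G) i u v
  have c := fun i u v => ind_le_one (G := G) i u v
  have := b 0 u w; have := b 1 u w; have := b 2 u w
  have := b 0 v w; have := b 1 v w; have := b 2 v w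
  have := c 0 u w; have := c 1 u w; have := c 2 u w
  have := c 0 v w; have := c 1 v w; have := c 2 v w
  unfold excess
  clear b c hG h
  lia

theorem excessOff_add_nonpos_of_triple (hG : ¬ HasRainbowTriangle G) {u v : V}
    (h : 2 ≤ excess G u v) (k : Fin 3) (w : V) : excessOff G k u w + excessOff G k v w ≤ 0 := by
  obtain ⟨i, j, hd⟩ := exists_distinct k
  have e := ind_eq_one_of_triple h k
  have t1 := ind_triangle hG hd u v w
  have t2 := ind_triangle hG hd.swap u v w
  rw [excessOff_eq hd, excessOff_eq hd]
  omega

/-- The template induced on the vertices other than `u` and `v`. -/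
def deletePair (G : ColouringTemplate 3 V) (u v : V) : ColouringTemplate 3 {w // w ≠ u ∧ w ≠ v} :=
  fun i => (G i).comap Subtype.val

theorem not_hasRainbowTriangle_deletePair (hG : ¬ HasRainbowTriangle G) (u v : V) :
    ¬ HasRainbowTriangle (deletePair G u v) := by
  rintro ⟨a, b, c, i, j, k, h1, h2, h3, h4, h5, h6⟩
  exact hG ⟨a, b, c, i, j, k, h1, h2, h3, h4, h5, h6⟩

variable [Fintype V]

theorem sum_eq_add_add_sum {M : Type*} [AddCommMonoid M] {u v : V} (huv : u ≠ v) (f : V → M)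
    [Fintype {w // w ≠ u ∧ w ≠ v}] :
    ∑ w, f w = f u + f v + ∑ w : {w // w ≠ u ∧ w ≠ v}, f w := by
  classical
  rw [← Finset.add_sum_erase _ f (Finset.mem_univ u),
    ← Finset.add_sum_erase _ f (Finset.mem_erase.2 ⟨huv.symm, Finset.mem_univ v⟩), ← add_assoc]
  congr 1
  exact Finset.sum_subtype _ (by simp [and_comm]) f

theorem sum_sum_eq_add_sum_sum {u v : V} (huv : u ≠ v) {f : V → V → ℝ}
    (hf : ∀ u v, f u v = f v u) [Fintype {w // w ≠ u ∧ w ≠ v}] :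
    ∑ a, ∑ b, f a b = f u u + f v v + 2 * f u v +
      2 * ∑ w : {w // w ≠ u ∧ w ≠ v}, (f u w + f v w) +
      ∑ a : {w // w ≠ u ∧ w ≠ v}, ∑ b : {w // w ≠ u ∧ w ≠ v}, f a b := by
  have e : ∀ a, ∑ b, f a b = f a u + f a v + ∑ b : {w // w ≠ u ∧ w ≠ v}, f a b := fun a =>
    sum_eq_add_add_sum huv (f a)
  simp only [e]
  rw [sum_eq_add_add_sum huv]
  simp only [Finset.sum_add_distrib, fun w : {w // w ≠ u ∧ w ≠ v} => hf w u,
    fun w : {w // w ≠ u ∧ w ≠ v} => hf w v]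
  rw [hf v u]
  ring

theorem sum_excess_deletePair (hG : ¬ HasRainbowTriangle G) {u v : V} (h : 2 ≤ excess G u v)
    (huv : u ≠ v) [Fintype {w // w ≠ u ∧ w ≠ v}] :
    ∑ a, ∑ b, (excess G a b : ℝ) - 2 * (Fintype.card {w // w ≠ u ∧ w ≠ v} : ℝ) - 2 ≤
      ∑ a, ∑ b, (excess (deletePair G u v) a b : ℝ) := by
  rw [sum_sum_eq_add_sum_sum huv fun a b => by rw [excess_comm]]
  have h1 : ∑ w : {w // w ≠ u ∧ w ≠ v}, ((excess G u w : ℝ) + excess G v w) ≤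
      Fintype.card {w // w ≠ u ∧ w ≠ v} := by
    refine (Finset.sum_le_sum (g := fun _ => (1 : ℝ)) fun w _ => ?_).trans_eq (by simp)
    exact_mod_cast excess_add_le_one_of_triple hG h w
  have h2 : (excess G u v : ℝ) = 2 := by
    simp [excess, ind_eq_one_of_triple h]
  rw [excess_self, excess_self, h2]
  have h3 : ∑ a, ∑ b, (excess (deletePair G u v) a b : ℝ) =
    ∑ a : {w // w ≠ u ∧ w ≠ v}, ∑ b : {w // w ≠ u ∧ w ≠ v}, (excess G a b : ℝ) := rfl
  push_cast
  linarith

theorem sum_excessOff_deletePair (hG : ¬ HasRainbowTriangle G) {u v : V} (h : 2 ≤ excess G u v)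
    (huv : u ≠ v) (k : Fin 3) [Fintype {w // w ≠ u ∧ w ≠ v}] :
    ∑ a, ∑ b, (excessOff G k a b : ℝ) ≤ ∑ a, ∑ b, (excessOff (deletePair G u v) k a b : ℝ) := by
  rw [sum_sum_eq_add_sum_sum huv fun a b => by rw [excessOff_comm]]
  have h1 : ∑ w : {w // w ≠ u ∧ w ≠ v}, ((excessOff G k u w : ℝ) + excessOff G k v w) ≤ 0 := by
    refine Finset.sum_nonpos fun w _ => ?_
    exact_mod_cast excessOff_add_nonpos_of_triple hG h k w
  have h2 : (excessOff G k u v : ℝ) = 1 := by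
    simp [excessOff, excess, ind_eq_one_of_triple h]
  rw [excessOff_self, excessOff_self, h2]
  have h3 : ∑ a, ∑ b, (excessOff (deletePair G u v) k a b : ℝ) =
    ∑ a : {w // w ≠ u ∧ w ≠ v}, ∑ b : {w // w ≠ u ∧ w ≠ v}, (excessOff G k a b : ℝ) := rfl
  push_cast
  linarith

end Deletion

/-- The density bound: a template whose excess sums exceed the thresholds has a rainbow triangle. -/
theorem hasRainbowTriangle_of_excess {V : Type*} [Fintype V] {G : ColouringTemplate 3 V}
    {x y z : ℝ} (hzy : z ≤ y) (hyx : y ≤ x) (hxyz : x + y + z = 1)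
    (hV : 1 / 2 ≤ x ^ 2 + y ^ 2 + z ^ 2) {t : Fin 3 → ℝ} (htz : ∀ k, z ≤ t k)
    (hty : ∀ j k, j ≠ k → y + z ≤ t j + t k)
    (ht : ∀ k, t k = 0 ∨ t k ^ 2 * (Fintype.card V : ℝ) ^ 2 < ∑ u, ∑ v, (excessOff G k u v : ℝ))
    (hS : (x ^ 2 + y ^ 2 + z ^ 2) * (Fintype.card V : ℝ) ^ 2 < ∑ u, ∑ v, (excess G u v : ℝ)) :
    HasRainbowTriangle G := by
  by_contra hG
  induction hn : Fintype.card V using Nat.strong_induction_on generalizing V with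
  | _ n ih =>
  have hne : Nonempty V := by
    by_contra h
    rw [not_nonempty_iff] at h
    simp at hS
  by_cases hF : NoTriple G
  · exact false_of_noTriple hG hF hzy hyx hxyz hV htz hty ht hS
  classical
  unfold NoTriple at hF
  push Not at hF
  obtain ⟨u, v, huv⟩ := hF
  have h2 : 2 ≤ excess G u v := by omega
  have hne : u ≠ v := by
    rintro rfl
    rw [excess_self] at h2
    norm_num at h2
  have hcard : Fintype.card V = Fintype.card {w // w ≠ u ∧ w ≠ v} + 2 := by
    have := sum_eq_add_add_sum hne fun _ => 1
    simp only [Finset.sum_const, Finset.card_univ, smul_eq_mul, mul_one] at this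
    omega
  set m := Fintype.card {w // w ≠ u ∧ w ≠ v} with hm
  rw [hcard] at hS ht
  push_cast at hS ht
  refine ih m (by omega) (V := {w // w ≠ u ∧ w ≠ v}) (G := deletePair G u v) (fun k => ?_) ?_
    (not_hasRainbowTriangle_deletePair hG u v) rfl
  · refine (ht k).imp_right fun h => ?_
    refine lt_of_le_of_lt ?_ (h.trans_le (sum_excessOff_deletePair hG h2 hne k))
    exact mul_le_mul_of_nonneg_left (by rw [← hm]; gcongr; linarith) (sq_nonneg _)
  · refine lt_of_lt_of_le ?_ (sum_excess_deletePair hG h2 hne)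
    -- The deletion costs at most `2 * m + 2`, while the threshold drops by `x ^ 2 + y ^ 2 + z ^ 2 ≥
    -- 1 / 2` times `(m + 2) ^ 2 - m ^ 2 = 4 * m + 4`.
    rw [← hm]
    have : (0 : ℝ) ≤ m := by positivity
    nlinarith

/-! ### From edge counts to excess sums -/

section EdgeCount

theorem edgeCount_eq_card_edgeFinset {V : Type*} (G : SimpleGraph V)
    [Fintype G.edgeSet] : edgeCount G = G.edgeFinset.card := by
  rw [edgeCount, Set.ncard_eq_toFinset_card']
  rfl

variable {V : Type*} [Fintype V]

theorem two_mul_edgeCount (G : ColouringTemplate 3 V) (i : Fin 3) :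
    2 * (edgeCount (G i) : ℝ) = ∑ u, ∑ v, (ind G i u v : ℝ) := by
  classical
  have h2 : ∀ u, ∑ v, (ind G i u v : ℝ) = (G i).degree u := fun u => by
    rw [← SimpleGraph.card_neighborFinset_eq_degree, SimpleGraph.neighborFinset_eq_filter]
    simp [ind]
  simp only [h2, edgeCount_eq_card_edgeFinset]
  exact_mod_cast (G i).sum_degrees_eq_twice_card_edges.symm

theorem sum_excess_eq (G : ColouringTemplate 3 V) :
    ∑ u, ∑ v, (excess G u v : ℝ) = 2 * (edgeCount (G 0) : ℝ) + 2 * (edgeCount (G 1) : ℝ) +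
      2 * (edgeCount (G 2) : ℝ) - (Fintype.card V : ℝ) ^ 2 := by
  simp only [two_mul_edgeCount, excess]
  push_cast
  simp only [Finset.sum_sub_distrib, Finset.sum_add_distrib]
  simp [sq]

theorem sum_excessOff_eq (G : ColouringTemplate 3 V) {i j k : Fin 3} (h : Distinct i j k) :
    ∑ u, ∑ v, (excessOff G k u v : ℝ) = 2 * (edgeCount (G i) : ℝ) + 2 * (edgeCount (G j) : ℝ) -
      (Fintype.card V : ℝ) ^ 2 := by
  simp only [two_mul_edgeCount, excessOff_eq h.rotate.rotate]
  push_cast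
  simp only [Finset.sum_sub_distrib, Finset.sum_add_distrib]
  simp [sq]

/-- The numbers `x ≥ y ≥ z` witness that the densities `α` force a rainbow triangle. -/
structure IsWitness (α : Fin 3 → ℝ) (x y z : ℝ) : Prop where
  z_le_y : z ≤ y
  y_le_x : y ≤ x
  sum_eq : x + y + z = 1
  half_le : 1 / 2 ≤ x ^ 2 + y ^ 2 + z ^ 2
  zero_one : y ^ 2 ≤ α 0 + α 1 - 1
  zero_two : y ^ 2 ≤ α 0 + α 2 - 1
  one_two : z = 0 ∨ z ^ 2 ≤ α 1 + α 2 - 1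
  total : x ^ 2 + y ^ 2 + z ^ 2 ≤ α 0 + α 1 + α 2 - 1

theorem IsWitness.hasRainbowTriangle {α : Fin 3 → ℝ} {x y z : ℝ} (hα : IsWitness α x y z)
    {G : ColouringTemplate 3 V}
    (hG : ∀ i, α i * (Fintype.card V : ℝ) ^ 2 < 2 * (edgeCount (G i) : ℝ)) :
    HasRainbowTriangle G := by
  obtain ⟨h1, h2, h3, h4, h5, h6, h7, h8⟩ := hα
  have h012 : Distinct 0 1 2 := by unfold Distinct; decide
  have g0 := hG 0
  have g1 := hG 1
  have g2 := hG 2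
  set n := (Fintype.card V : ℝ)
  have hn : 0 ≤ n ^ 2 := sq_nonneg n
  -- Entry `k` of `t` governs the two colours other than `k`, so `z` belongs to colours 1 and 2. If
  -- `z = 0`, nothing is required there, even when `α 1 + α 2 < 1`.
  refine hasRainbowTriangle_of_excess (t := ![z, y, y]) h1 h2 h3 h4 ?_ ?_ ?_ ?_
  · intro k
    fin_cases k <;> simp [h1]
  · intro j k hjk
    fin_cases j <;> fin_cases k <;> simp [h1, add_comm] at hjk ⊢
  · intro k
    fin_cases k
    · refine h7.imp id fun h7 => ?_
      change z ^ 2 * n ^ 2 < ∑ u, ∑ v, (excessOff G 0 u v : ℝ)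
      rw [sum_excessOff_eq G h012.rotate]
      nlinarith
    · right
      change y ^ 2 * n ^ 2 < ∑ u, ∑ v, (excessOff G 1 u v : ℝ)
      rw [sum_excessOff_eq G h012.swap]
      nlinarith
    · right
      change y ^ 2 * n ^ 2 < ∑ u, ∑ v, (excessOff G 2 u v : ℝ)
      rw [sum_excessOff_eq G h012]
      nlinarith
  · rw [sum_excess_eq]
    nlinarith

end EdgeCount

/-! ### Forcing triples from witnesses and from complete colour classes -/

section Forcing

theorem choose_two_cast (n : ℕ) : (n.choose 2 : ℝ) = n * (n - 1) / 2 := Nat.cast_choose_two ℝ n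

theorem IsWitness.forcesUpToLinear {α : Fin 3 → ℝ} {x y z K : ℝ} (hα : IsWitness α x y z)
    (h1 : ∀ i, α i ≤ 1) (hK : 1 ≤ K) : ForcesUpToLinear K α := by
  intro n hn G hG
  refine hα.hasRainbowTriangle fun i => ?_
  have := hG i
  rw [choose_two_cast] at this
  rw [Fintype.card_fin]
  have hn' : (1 : ℝ) ≤ n := by exact_mod_cast hn
  nlinarith [h1 i, mul_nonneg (sub_nonneg.2 (h1 i)) (by linarith : (0 : ℝ) ≤ n),
    mul_nonneg (sub_nonneg.2 hK) (by linarith : (0 : ℝ) ≤ n)]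

theorem eventually_lt_choose_two {a b : ℝ} (ha : a < 1) :
    ∀ᶠ n : ℕ in Filter.atTop, a / 2 * (n : ℝ) ^ 2 < (n.choose 2 : ℝ) - b * n - 1 := by
  obtain ⟨N, hN⟩ := exists_nat_gt ((1 + 2 * |b| + 2) / (1 - a))
  filter_upwards [Filter.eventually_ge_atTop (N + 1)] with n hn
  have hn1 : (1 : ℝ) ≤ n := by exact_mod_cast (by omega : 1 ≤ n)
  have hn2 : (N : ℝ) ≤ n := by exact_mod_cast (by omega : N ≤ n)
  rw [div_lt_iff₀ (by linarith)] at hN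
  have h3 : 1 + 2 * |b| + 2 < n * (1 - a) := by nlinarith
  have h4 := mul_lt_mul_of_pos_right h3 (by linarith : (0 : ℝ) < n)
  have h5 := mul_le_mul_of_nonneg_right (le_abs_self b) (by linarith : (0 : ℝ) ≤ n)
  rw [choose_two_cast]
  nlinarith

/-- Because `α i < 1`, the bound `α i / 2 * n ^ 2` is eventually below the cap `n.choose 2 - 1` as
well, so `β i = 1` needs no separate treatment. -/
theorem IsWitness.isForcingTriple {α β : Fin 3 → ℝ} {x y z : ℝ} (hα : IsWitness α x y z)
    (h1 : ∀ i, α i < 1) (hβ : ∀ i, β i ∈ Set.Icc (0 : ℝ) 1) (hαβ : ∀ i, α i ≤ β i) :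
    IsForcingTriple β := by
  refine ⟨hβ, ?_⟩
  filter_upwards [Filter.eventually_all.2 fun i => eventually_lt_choose_two (b := 0) (h1 i)]
    with n hn G hG
  refine hα.hasRainbowTriangle fun i => ?_
  rw [Fintype.card_fin]
  have h2 : α i / 2 * (n : ℝ) ^ 2 ≤ min (β i / 2 * (n : ℝ) ^ 2) ((n.choose 2 : ℝ) - 1) :=
    le_min (by nlinarith [hαβ i, sq_nonneg (n : ℝ)]) (by linarith [hn i])
  linarith [hG i]

theorem eq_top_of_choose_lt {n : ℕ} {G : SimpleGraph (Fin n)}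
    (h : (n.choose 2 : ℝ) - 1 < edgeCount G) : G = ⊤ := by
  classical
  rw [← SimpleGraph.edgeFinset_inj]
  refine Finset.eq_of_subset_of_card_le (SimpleGraph.edgeFinset_mono le_top) ?_
  rw [SimpleGraph.card_edgeFinset_top_eq_card_choose_two, Fintype.card_fin]
  rw [edgeCount_eq_card_edgeFinset] at h
  have : (n.choose 2 : ℝ) < G.edgeFinset.card + 1 := by linarith
  exact Nat.lt_succ_iff.1 (by exact_mod_cast this)

theorem min_eq_of_one (n : ℕ) :
    min ((1 : ℝ) / 2 * (n : ℝ) ^ 2) ((n.choose 2 : ℝ) - 1) = (n.choose 2 : ℝ) - 1 := by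
  refine min_eq_right ?_
  rw [choose_two_cast]
  nlinarith [(Nat.cast_nonneg n : (0 : ℝ) ≤ n)]

theorem isForcingTriple_of_one_one {β : Fin 3 → ℝ} (hβ : ∀ i, β i ∈ Set.Icc (0 : ℝ) 1)
    (h0 : β 0 = 1) (h1 : β 1 = 1) : IsForcingTriple β := by
  refine ⟨hβ, ?_⟩
  filter_upwards [Filter.eventually_ge_atTop 3] with n hn G hG
  have e0 : G 0 = ⊤ := eq_top_of_choose_lt (by have := hG 0; rwa [h0, min_eq_of_one] at this)
  have e1 : G 1 = ⊤ := eq_top_of_choose_lt (by have := hG 1; rwa [h1, min_eq_of_one] at this)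
  have e2 : (0 : ℝ) < edgeCount (G 2) := by
    refine lt_of_le_of_lt (le_min ?_ ?_) (hG 2)
    · have := (hβ 2).1
      positivity
    · have : 1 ≤ n.choose 2 := Nat.choose_pos (by omega)
      have : (1 : ℝ) ≤ n.choose 2 := by exact_mod_cast this
      linarith
  have e3 : (G 2).edgeSet.Nonempty := by
    by_contra h
    rw [Set.not_nonempty_iff_eq_empty] at h
    simp [edgeCount, h] at e2
  obtain ⟨e, he⟩ := e3
  induction e with
  | _ u w =>
  obtain ⟨v, hv⟩ : ∃ v, v ∉ ({u, w} : Finset (Fin n)) := by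
    by_contra! h
    have := Finset.card_le_card (fun v _ => h v : Finset.univ ⊆ ({u, w} : Finset (Fin n)))
    have := Finset.card_le_two (a := u) (b := w)
    simp at *
    omega
  simp only [Finset.mem_insert, Finset.mem_singleton, not_or] at hv
  refine ⟨u, v, w, 0, 1, 2, by decide, by decide, by decide, ?_, ?_, he⟩
  · simp [e0, Ne.symm hv.1]
  · simp [e1, hv.2]

/-! ### One complete colour: edges of the other two colours meet only if they coincide -/

section Complete
variable {V : Type*} [Fintype V]

open Classical in
/-- The vertices incident with `H` but not with `K`. -/
noncomputable def onlyIn (H K : SimpleGraph V) : Finset V :=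
  Finset.univ.filter fun v => (∃ u, H.Adj v u) ∧ ∀ u, ¬ K.Adj v u

open Classical in
/-- The vertices incident with both `H` and `K`. -/
noncomputable def inBoth (H K : SimpleGraph V) : Finset V :=
  Finset.univ.filter fun v => (∃ u, H.Adj v u) ∧ ∃ u, K.Adj v u

theorem card_onlyIn_add_le (H K : SimpleGraph V) :
    (onlyIn H K).card + (onlyIn K H).card + (inBoth H K).card ≤ Fintype.card V := by
  classical
  have h1 : Disjoint (onlyIn H K) (onlyIn K H) := by
    rw [Finset.disjoint_left]
    simp only [onlyIn, Finset.mem_filter, Finset.mem_univ, true_and]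
    rintro v ⟨⟨u, hu⟩, -⟩ ⟨-, h⟩
    exact h u hu
  have h2 : Disjoint (onlyIn H K ∪ onlyIn K H) (inBoth H K) := by
    rw [Finset.disjoint_left]
    simp only [onlyIn, inBoth, Finset.mem_union, Finset.mem_filter, Finset.mem_univ, true_and]
    rintro v (⟨-, h⟩ | ⟨-, h⟩) ⟨⟨u, hu⟩, w, hw⟩
    exacts [h w hw, h u hu]
  rw [← Finset.card_union_of_disjoint h1, ← Finset.card_union_of_disjoint h2]
  exact Finset.card_le_univ _

/-- A vertex incident with both graphs has only one `H`-neighbour, namely its `K`-neighbour. The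
`H`-neighbours of a vertex incident with `H` only are again of that kind. -/
theorem two_mul_edgeCount_le {H K : SimpleGraph V}
    (hHK : ∀ u v w, H.Adj u v → K.Adj v w → u = w) :
    2 * edgeCount H ≤ (onlyIn H K).card * ((onlyIn H K).card - 1) + (inBoth H K).card := by
  classical
  have hdeg : ∀ v, H.degree v ≤ (if v ∈ onlyIn H K then (onlyIn H K).card - 1 else 0) +
      if v ∈ inBoth H K then 1 else 0 := by
    intro v
    by_cases h0 : ∃ u, H.Adj v u
    · by_cases h1 : ∃ w, K.Adj v w
      · obtain ⟨w, hw⟩ := h1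
        have hv : v ∈ inBoth H K := Finset.mem_filter.2 ⟨Finset.mem_univ _, h0, w, hw⟩
        rw [if_pos hv]
        refine le_trans ?_ (Nat.le_add_left _ _)
        rw [← SimpleGraph.card_neighborFinset_eq_degree]
        refine (Finset.card_le_card (t := {w}) fun u hu => ?_).trans (by simp)
        rw [SimpleGraph.mem_neighborFinset] at hu
        exact Finset.mem_singleton.2 (hHK u v w hu.symm hw)
      · push Not at h1
        have hv : v ∈ onlyIn H K := by simp [onlyIn, h0, h1]
        rw [if_pos hv, ← Finset.card_erase_of_mem hv]
        refine le_trans ?_ (Nat.le_add_right _ _)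
        rw [← SimpleGraph.card_neighborFinset_eq_degree]
        refine Finset.card_le_card fun u hu => ?_
        rw [SimpleGraph.mem_neighborFinset] at hu
        refine Finset.mem_erase.2 ⟨hu.ne', ?_⟩
        simp only [onlyIn, Finset.mem_filter, Finset.mem_univ, true_and]
        refine ⟨⟨v, hu.symm⟩, fun w hw => ?_⟩
        obtain rfl := hHK v u w hu hw
        exact h1 u hw.symm
    · have : H.degree v = 0 := by
        rw [← SimpleGraph.card_neighborFinset_eq_degree, Finset.card_eq_zero,
          Finset.eq_empty_iff_forall_notMem]
        exact fun u hu => h0 ⟨u, (SimpleGraph.mem_neighborFinset ..).1 hu⟩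
      rw [this]
      exact Nat.zero_le _
  rw [edgeCount_eq_card_edgeFinset, ← H.sum_degrees_eq_twice_card_edges]
  refine (Finset.sum_le_sum fun v _ => hdeg v).trans_eq ?_
  rw [Finset.sum_add_distrib, Finset.sum_ite_mem, Finset.sum_ite_mem]
  simp

theorem false_of_star_sums {n p q r s e f : ℝ} (hp : 0 ≤ p) (hq : 0 ≤ q) (hr : 0 ≤ r)
    (hpr : r ≤ p ∨ p + 1 ≤ r) (hr1 : r ≤ r ^ 2) (hn : 4 ≤ n) (hs : 1 / 2 ≤ s)
    (hsum : p + q + r ≤ n) (he : e ≤ p * (p - 1) + r) (hf : f ≤ q * (q - 1) + r)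
    (he' : s ^ 2 * n ^ 2 < e) (hf' : (1 - s) ^ 2 * n ^ 2 < f) : False := by
  rcases hpr with h | h
  -- If `r ≤ p`, the correction `r` in `e` is absorbed by `-p`, and `f ≤ (q + r) ^ 2`. So the parts
  -- exceed `s * n` and `(1 - s) * n`, more than `n` in total.
  · have h1 : s * n < p := by
      refine lt_of_pow_lt_pow_left₀ 2 hp ?_
      nlinarith
    have h2 : (1 - s) * n < q + r := by
      refine lt_of_pow_lt_pow_left₀ 2 (by linarith) ?_
      nlinarith [mul_nonneg hq hr]
    nlinarith
  -- If `p + 1 ≤ r`, then `p < n / 2` and `e ≤ p ^ 2 - 2 * p + n ≤ n ^ 2 / 4`, contrary to `1 / 2 ≤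
  -- s`. The last estimate uses `4 ≤ n`.
  · have h1 := mul_nonneg (by nlinarith : 0 ≤ s ^ 2 - 1 / 4) (sq_nonneg n)
    have h2 := mul_nonneg (by linarith : 0 ≤ n / 2 - p) (by linarith : 0 ≤ n / 2 + p - 2)
    nlinarith

theorem isForcingTriple_of_one {β : Fin 3 → ℝ} (hβ : ∀ i, β i ∈ Set.Icc (0 : ℝ) 1)
    (h0 : β 0 = 1) {s : ℝ} (hs : 1 / 2 ≤ s) (hs1 : s < 1) (h1 : s ^ 2 ≤ β 1)
    (h2 : (1 - s) ^ 2 ≤ β 2) : IsForcingTriple β := by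
  refine ⟨hβ, ?_⟩
  filter_upwards [Filter.eventually_ge_atTop 4,
    eventually_lt_choose_two (b := 0) (by nlinarith : s ^ 2 < 1),
    eventually_lt_choose_two (b := 0) (by nlinarith : (1 - s) ^ 2 < 1)] with n hn hn1 hn2 G hG
  have e0 : G 0 = ⊤ := eq_top_of_choose_lt (by have := hG 0; rwa [h0, min_eq_of_one] at this)
  have e1 : s ^ 2 * (n : ℝ) ^ 2 < 2 * edgeCount (G 1) := by
    have : s ^ 2 / 2 * (n : ℝ) ^ 2 ≤ min (β 1 / 2 * (n : ℝ) ^ 2) ((n.choose 2 : ℝ) - 1) :=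
      le_min (by nlinarith [sq_nonneg (n : ℝ)]) (by linarith)
    linarith [hG 1]
  have e2 : (1 - s) ^ 2 * (n : ℝ) ^ 2 < 2 * edgeCount (G 2) := by
    have : (1 - s) ^ 2 / 2 * (n : ℝ) ^ 2 ≤ min (β 2 / 2 * (n : ℝ) ^ 2) ((n.choose 2 : ℝ) - 1) :=
      le_min (by nlinarith [sq_nonneg (n : ℝ)]) (by linarith)
    linarith [hG 2]
  by_contra hR
  have hHK : ∀ u v w, (G 1).Adj u v → (G 2).Adj v w → u = w := by
    intro u v w h h'
    by_contra hne
    refine hR ⟨u, v, w, 1, 2, 0, by decide, by decide, by decide, h, h', ?_⟩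
    simpa [e0] using hne
  have hKH : ∀ u v w, (G 2).Adj u v → (G 1).Adj v w → u = w :=
    fun u v w h h' => (hHK w v u h'.symm h.symm).symm
  have f1 := two_mul_edgeCount_le hHK
  have f2 := two_mul_edgeCount_le hKH
  have f3 := card_onlyIn_add_le (G 1) (G 2)
  have hb : inBoth (G 2) (G 1) = inBoth (G 1) (G 2) := by
    ext v
    simp only [inBoth, Finset.mem_filter]
    exact and_congr_right fun _ => and_comm
  rw [hb] at f2
  rw [Fintype.card_fin] at f3
  set p := (onlyIn (G 1) (G 2)).card
  set q := (onlyIn (G 2) (G 1)).card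
  set r := (inBoth (G 1) (G 2)).card
  have hcast : ∀ m : ℕ, ((m * (m - 1) : ℕ) : ℝ) = m * (m - 1) := by
    intro m
    rcases m with _ | m
    · simp
    · push_cast
      simp
  have hr1 : r ≤ r ^ 2 := Nat.le_self_pow two_ne_zero r
  refine false_of_star_sums (n := n) (p := p) (q := q) (r := r) (s := s) (Nat.cast_nonneg _)
    (Nat.cast_nonneg _) (Nat.cast_nonneg _) ?_ (by exact_mod_cast hr1) (by exact_mod_cast hn) hs
    (by exact_mod_cast f3) ?_ ?_ e1 e2
  · rcases le_or_gt r p with h | h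
    · left; exact_mod_cast h
    · right; exact_mod_cast h
  · rw [← hcast]; exact_mod_cast f1
  · rw [← hcast]; exact_mod_cast f2

end Complete

end Forcing

theorem HasRainbowTriangle.exists_ordered {V : Type*} {G : ColouringTemplate 3 V}
    (h : HasRainbowTriangle G) : ∃ u v w, (G 0).Adj u v ∧ (G 1).Adj v w ∧ (G 2).Adj w u := by
  obtain ⟨u, v, w, i, j, k, h1, h2, h3, a, b, c⟩ := h
  have h : Distinct i j k := ⟨h1, h2, h3⟩
  have key : ∀ i j k : Fin 3, i ≠ j ∧ j ≠ k ∧ i ≠ k →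
      (i = 0 ∧ j = 1 ∧ k = 2) ∨ (i = 0 ∧ j = 2 ∧ k = 1) ∨ (i = 1 ∧ j = 0 ∧ k = 2) ∨
      (i = 1 ∧ j = 2 ∧ k = 0) ∨ (i = 2 ∧ j = 0 ∧ k = 1) ∨ (i = 2 ∧ j = 1 ∧ k = 0) := by
    intro i j k
    fin_cases i <;> fin_cases j <;> fin_cases k <;> simp
  rcases key i j k h with h | h | h | h | h | h <;> obtain ⟨rfl, rfl, rfl⟩ := h
  · exact ⟨u, v, w, a, b, c.symm⟩
  · exact ⟨v, u, w, a.symm, c, b.symm⟩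
  · exact ⟨w, v, u, b.symm, a.symm, c⟩
  · exact ⟨w, u, v, c.symm, a, b⟩
  · exact ⟨v, w, u, b, c.symm, a⟩
  · exact ⟨u, w, v, c, b.symm, a.symm⟩

/-! ### The templates are rainbow-triangle-free; their edge counts -/

section Templates
variable {V : Type*} {A B C : Set V}

/-- Edges of the first two colours that meet must both lie in `A`, since `B` and `C` are disjoint;
then the closing pair lies in `A` and misses the third colour. -/
theorem not_hasRainbowTriangle_templateF (hAB : Disjoint A B) (hAC : Disjoint A C)
    (hBC : Disjoint B C) : ¬ HasRainbowTriangle (templateF A B C) := by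
  intro h
  obtain ⟨u, v, w, h0, h1, h2⟩ := h.exists_ordered
  have hBC := Set.disjoint_left.1 hBC
  have hAB := Set.disjoint_left.1 hAB
  have hAC := Set.disjoint_left.1 hAC
  simp only [templateF, Matrix.cons_val, SimpleGraph.sup_adj, SimpleGraph.compl_adj,
    pairsIn] at h0 h1 h2
  grind

/-- The edge of the second colour lies in `A`, so the edge of the third colour leads from it to `B`;
the remaining pair joins `A` and `B` and misses the first colour. -/
theorem not_hasRainbowTriangle_templateH (hAB : Disjoint A B) (hAC : Disjoint A C)
    (hBC : Disjoint B C) : ¬ HasRainbowTriangle (templateH A B C) := by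
  intro h
  obtain ⟨u, v, w, h0, h1, h2⟩ := h.exists_ordered
  have hBC := Set.disjoint_left.1 hBC
  have hAB := Set.disjoint_left.1 hAB
  have hAC := Set.disjoint_left.1 hAC
  simp only [templateH, Matrix.cons_val, SimpleGraph.sup_adj, pairsIn, pairsBetween,
    Set.mem_union] at h0 h1 h2
  grind

-- A weight defined on all ordered pairs may also count the diagonal, at a cost of at most one per
-- vertex. This lets `ω` be a product of indicators.
open Classical in
theorem sum_sub_card_le [Fintype V] (G : ColouringTemplate 3 V) (i : Fin 3) {ω : V → V → ℝ}
    (hω : ∀ u v, u ≠ v → ω u v ≤ if (G i).Adj u v then 1 else 0) (hd : ∀ u, ω u u ≤ 1) :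
    ∑ u, ∑ v, ω u v - Fintype.card V ≤ 2 * (edgeCount (G i) : ℝ) := by
  rw [two_mul_edgeCount]
  have h : ∀ u v, ω u v ≤ ind G i u v + if u = v then 1 else 0 := by
    intro u v
    by_cases huv : u = v
    · subst huv; simpa [ind_self] using hd u
    · have := hω u v huv
      rw [if_neg huv, add_zero]
      unfold ind
      push_cast
      exact this
  have h1 := Finset.sum_le_sum fun u (_ : u ∈ Finset.univ) =>
    Finset.sum_le_sum fun v (_ : v ∈ Finset.univ) => h u v
  simp only [Finset.sum_add_distrib] at h1
  simp at h1
  linarith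

open Classical in
/-- The indicator of membership in `S`. -/
noncomputable def chi (S : Set V) (u : V) : ℝ := if u ∈ S then 1 else 0

theorem sum_chi [Fintype V] (S : Set V) : ∑ u, chi S u = S.ncard := by
  classical
  simp [chi, Set.ncard_eq_toFinset_card']

theorem sum_chi_mul_chi [Fintype V] (S T : Set V) :
    ∑ u, ∑ v, chi S u * chi T v = S.ncard * T.ncard := by
  rw [← Finset.sum_mul_sum, sum_chi, sum_chi]

theorem mem_cases_of_partition (hABC : A ∪ B ∪ C = Set.univ) (hAB : Disjoint A B)
    (hAC : Disjoint A C) (hBC : Disjoint B C) (u : V) :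
    (u ∈ A ∧ u ∉ B ∧ u ∉ C) ∨ (u ∉ A ∧ u ∈ B ∧ u ∉ C) ∨ (u ∉ A ∧ u ∉ B ∧ u ∈ C) := by
  have h : u ∈ A ∪ B ∪ C := hABC ▸ Set.mem_univ u
  have h1 := @Set.disjoint_left.1 hBC u
  have h2 := @Set.disjoint_left.1 hAB u
  have h3 := @Set.disjoint_left.1 hAC u
  simp only [Set.mem_union] at h
  tauto

theorem edgeCount_templateF_ge [Fintype V] (hABC : A ∪ B ∪ C = Set.univ) (hAB : Disjoint A B)
    (hAC : Disjoint A C) (hBC : Disjoint B C) :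
    (A.ncard : ℝ) ^ 2 + (B.ncard : ℝ) ^ 2 - Fintype.card V ≤
      2 * (edgeCount (templateF A B C 0) : ℝ) ∧
    (A.ncard : ℝ) ^ 2 + (C.ncard : ℝ) ^ 2 - Fintype.card V ≤
      2 * (edgeCount (templateF A B C 1) : ℝ) ∧
    (Fintype.card V : ℝ) ^ 2 - (A.ncard : ℝ) ^ 2 - Fintype.card V ≤
      2 * (edgeCount (templateF A B C 2) : ℝ) := by
  classical
  have hm := mem_cases_of_partition hABC hAB hAC hBC
  refine ⟨?_, ?_, ?_⟩
  · have := sum_sub_card_le (templateF A B C) 0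
      (ω := fun u v => chi A u * chi A v + chi B u * chi B v)
      (fun u v huv => by
        rcases hm u with ⟨h1, h2, h3⟩ | ⟨h1, h2, h3⟩ | ⟨h1, h2, h3⟩ <;>
          rcases hm v with ⟨h4, h5, h6⟩ | ⟨h4, h5, h6⟩ | ⟨h4, h5, h6⟩ <;>
          simp [templateF, pairsIn, chi, huv, h1, h2, h3, h4, h5, h6])
      fun u => by
        rcases hm u with ⟨h1, h2, h3⟩ | ⟨h1, h2, h3⟩ | ⟨h1, h2, h3⟩ <;> simp [chi, h1, h2, h3]
    simp only [Finset.sum_add_distrib, sum_chi_mul_chi, ← sq] at this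
    exact this
  · have := sum_sub_card_le (templateF A B C) 1
      (ω := fun u v => chi A u * chi A v + chi C u * chi C v)
      (fun u v huv => by
        rcases hm u with ⟨h1, h2, h3⟩ | ⟨h1, h2, h3⟩ | ⟨h1, h2, h3⟩ <;>
          rcases hm v with ⟨h4, h5, h6⟩ | ⟨h4, h5, h6⟩ | ⟨h4, h5, h6⟩ <;>
          simp [templateF, pairsIn, chi, huv, h1, h2, h3, h4, h5, h6])
      fun u => by
        rcases hm u with ⟨h1, h2, h3⟩ | ⟨h1, h2, h3⟩ | ⟨h1, h2, h3⟩ <;> simp [chi, h1, h2, h3]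
    simp only [Finset.sum_add_distrib, sum_chi_mul_chi, ← sq] at this
    exact this
  · have := sum_sub_card_le (templateF A B C) 2
      (ω := fun u v => 1 - chi A u * chi A v)
      (fun u v huv => by
        rcases hm u with ⟨h1, h2, h3⟩ | ⟨h1, h2, h3⟩ | ⟨h1, h2, h3⟩ <;>
          rcases hm v with ⟨h4, h5, h6⟩ | ⟨h4, h5, h6⟩ | ⟨h4, h5, h6⟩ <;>
          simp [templateF, pairsIn, chi, huv, h1, h2, h3, h4, h5, h6])
      fun u => by
        rcases hm u with ⟨h1, h2, h3⟩ | ⟨h1, h2, h3⟩ | ⟨h1, h2, h3⟩ <;> simp [chi, h1, h2, h3]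
    simp only [Finset.sum_sub_distrib, sum_chi_mul_chi, ← sq, Finset.sum_const, Finset.card_univ,
      nsmul_eq_mul, mul_one] at this
    exact this

theorem edgeCount_templateH_ge [Fintype V] (hABC : A ∪ B ∪ C = Set.univ) (hAB : Disjoint A B)
    (hAC : Disjoint A C) (hBC : Disjoint B C) :
    (Fintype.card V : ℝ) ^ 2 - 2 * (A.ncard * B.ncard : ℝ) - Fintype.card V ≤
      2 * (edgeCount (templateH A B C 0) : ℝ) ∧
    (A.ncard : ℝ) ^ 2 - Fintype.card V ≤ 2 * (edgeCount (templateH A B C 1) : ℝ) ∧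
    ((Fintype.card V : ℝ) - A.ncard) ^ 2 + 2 * (A.ncard * B.ncard : ℝ) - Fintype.card V ≤
      2 * (edgeCount (templateH A B C 2) : ℝ) := by
  classical
  have hm := mem_cases_of_partition hABC hAB hAC hBC
  refine ⟨?_, ?_, ?_⟩
  · have := sum_sub_card_le (templateH A B C) 0
      (ω := fun u v => 1 - chi A u * chi B v - chi B u * chi A v)
      (fun u v huv => by
        rcases hm u with ⟨h1, h2, h3⟩ | ⟨h1, h2, h3⟩ | ⟨h1, h2, h3⟩ <;>
          rcases hm v with ⟨h4, h5, h6⟩ | ⟨h4, h5, h6⟩ | ⟨h4, h5, h6⟩ <;>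
          simp [templateH, pairsIn, pairsBetween, chi, huv, h1, h2, h3, h4, h5, h6])
      fun u => by
        rcases hm u with ⟨h1, h2, h3⟩ | ⟨h1, h2, h3⟩ | ⟨h1, h2, h3⟩ <;> simp [chi, h1, h2, h3]
    simp only [Finset.sum_sub_distrib, sum_chi_mul_chi, Finset.sum_const, Finset.card_univ,
      nsmul_eq_mul, mul_one] at this
    linarith
  · have := sum_sub_card_le (templateH A B C) 1
      (ω := fun u v => chi A u * chi A v)
      (fun u v huv => by
        rcases hm u with ⟨h1, h2, h3⟩ | ⟨h1, h2, h3⟩ | ⟨h1, h2, h3⟩ <;>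
          rcases hm v with ⟨h4, h5, h6⟩ | ⟨h4, h5, h6⟩ | ⟨h4, h5, h6⟩ <;>
          simp [templateH, pairsIn, pairsBetween, chi, huv, h1, h2, h3, h4, h5, h6])
      fun u => by
        rcases hm u with ⟨h1, h2, h3⟩ | ⟨h1, h2, h3⟩ | ⟨h1, h2, h3⟩ <;> simp [chi, h1, h2, h3]
    simp only [sum_chi_mul_chi, ← sq] at this
    exact this
  · have := sum_sub_card_le (templateH A B C) 2
      (ω := fun u v => (1 - chi A u) * (1 - chi A v) + (chi A u * chi B v + chi B u * chi A v))
      (fun u v huv => by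
        rcases hm u with ⟨h1, h2, h3⟩ | ⟨h1, h2, h3⟩ | ⟨h1, h2, h3⟩ <;>
          rcases hm v with ⟨h4, h5, h6⟩ | ⟨h4, h5, h6⟩ | ⟨h4, h5, h6⟩ <;>
          simp [templateH, pairsIn, pairsBetween, chi, huv, h1, h2, h3, h4, h5, h6])
      fun u => by
        rcases hm u with ⟨h1, h2, h3⟩ | ⟨h1, h2, h3⟩ | ⟨h1, h2, h3⟩ <;> simp [chi, h1, h2, h3]
    simp only [Finset.sum_add_distrib, sum_chi_mul_chi, ← Finset.sum_mul_sum,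
      Finset.sum_sub_distrib, sum_chi, Finset.sum_const, Finset.card_univ, nsmul_eq_mul,
      mul_one] at this
    linarith

end Templates

/-! ### Limiting densities, rounding errors, and non-forcing below a density -/

section Densities

/-- The limiting edge densities of the templates `templateF` with parts of proportions `x`, `y`. -/
noncomputable def densityF (x y : ℝ) : Fin 3 → ℝ :=
  ![x ^ 2 + y ^ 2, x ^ 2 + (1 - x - y) ^ 2, 1 - x ^ 2]

/-- The limiting edge densities of the templates `templateH` with parts of proportions `p`, `q`. -/
noncomputable def densityH (p q : ℝ) : Fin 3 → ℝ :=
  ![1 - 2 * (p * q), p ^ 2, (1 - p) ^ 2 + 2 * (p * q)]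

theorem floor_add_floor_le {x y : ℝ} (hx : 0 ≤ x) (hy : 0 ≤ y) (hxy : x + y ≤ 1) (n : ℕ) :
    ⌊x * n⌋₊ + ⌊y * n⌋₊ ≤ n := by
  have h1 := Nat.floor_le (mul_nonneg hx n.cast_nonneg)
  have h2 := Nat.floor_le (mul_nonneg hy n.cast_nonneg)
  have h3 : (x + y) * n ≤ 1 * n := mul_le_mul_of_nonneg_right hxy n.cast_nonneg
  have : ((⌊x * n⌋₊ + ⌊y * n⌋₊ : ℕ) : ℝ) ≤ n := by
    push_cast
    linarith
  exact_mod_cast this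

theorem mul_choose_two_sub_le {D K e : ℝ} {n : ℕ} (hD : 0 ≤ D) (hK : 3 ≤ K)
    (h : D * (n : ℝ) ^ 2 - 6 * n ≤ 2 * e) : D * (n.choose 2 : ℝ) - K * n ≤ e := by
  have hn : (0 : ℝ) ≤ n := n.cast_nonneg
  rw [choose_two_cast]
  nlinarith [mul_nonneg hD hn, mul_nonneg (sub_nonneg.2 hK) hn]

theorem sq_floor_ge {x : ℝ} (hx : 0 ≤ x) (hx1 : x ≤ 1) (n : ℕ) :
    x ^ 2 * (n : ℝ) ^ 2 - 2 * n ≤ (⌊x * n⌋₊ : ℝ) ^ 2 := by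
  have hn : (0 : ℝ) ≤ n := n.cast_nonneg
  have h1 := Nat.floor_le (mul_nonneg hx hn)
  have h2 := (Nat.lt_floor_add_one (x * n)).le
  have h3 : x * n ≤ 1 * n := mul_le_mul_of_nonneg_right hx1 hn
  have h4 : (0 : ℝ) ≤ ⌊x * n⌋₊ := Nat.cast_nonneg _
  nlinarith

theorem isMatchingExample_templateF {x y K : ℝ} (hx : 0 ≤ x) (hy : 0 ≤ y) (hxy : x + y ≤ 1)
    (hK : 3 ≤ K) {n : ℕ} {A B C : Set (Fin n)}
    (h : IsTripartition A B C ⌊x * n⌋₊ ⌊y * n⌋₊ (n - ⌊x * n⌋₊ - ⌊y * n⌋₊)) :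
    IsMatchingExample K (densityF x y) (templateF A B C) := by
  obtain ⟨hABC, hAB, hAC, hBC, hA, hB, hC⟩ := h
  refine ⟨fun i => ?_, not_hasRainbowTriangle_templateF hAB hAC hBC⟩
  obtain ⟨e0, e1, e2⟩ := edgeCount_templateF_ge hABC hAB hAC hBC
  have hn : (0 : ℝ) ≤ n := n.cast_nonneg
  have hab := floor_add_floor_le hx hy hxy n
  have hc : (1 - x - y) * n ≤ (n - ⌊x * n⌋₊ - ⌊y * n⌋₊ : ℕ) := by
    rw [Nat.sub_sub, Nat.cast_sub hab]
    push_cast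
    linarith [Nat.floor_le (mul_nonneg hx hn), Nat.floor_le (mul_nonneg hy hn)]
  rw [Fintype.card_fin] at e0 e1 e2
  rw [hA] at e0 e1 e2
  rw [hB] at e0
  rw [hC] at e1
  have f1 := sq_floor_ge hx (by linarith) n
  have f2 := sq_floor_ge hy (by linarith) n
  have f3 : ((1 - x - y) * n) ^ 2 ≤ ((n - ⌊x * n⌋₊ - ⌊y * n⌋₊ : ℕ) : ℝ) ^ 2 :=
    pow_le_pow_left₀ (mul_nonneg (by linarith) hn) hc 2
  have f4 : (⌊x * n⌋₊ : ℝ) ^ 2 ≤ (x * n) ^ 2 :=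
    pow_le_pow_left₀ (Nat.cast_nonneg _) (Nat.floor_le (mul_nonneg hx hn)) 2
  have g0 : (x ^ 2 + y ^ 2) * (n : ℝ) ^ 2 - 6 * n ≤ 2 * edgeCount (templateF A B C 0) := by
    linarith
  have g1 : (x ^ 2 + (1 - x - y) ^ 2) * (n : ℝ) ^ 2 - 6 * n ≤
      2 * edgeCount (templateF A B C 1) := by
    linarith
  have g2 : (1 - x ^ 2) * (n : ℝ) ^ 2 - 6 * n ≤ 2 * edgeCount (templateF A B C 2) := by
    linarith
  fin_cases i
  · exact mul_choose_two_sub_le (D := x ^ 2 + y ^ 2) (by positivity) hK g0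
  · exact mul_choose_two_sub_le (D := x ^ 2 + (1 - x - y) ^ 2) (by positivity) hK g1
  · exact mul_choose_two_sub_le (D := 1 - x ^ 2) (by nlinarith) hK g2

theorem isMatchingExample_templateH {p q K : ℝ} (hp : 0 ≤ p) (hq : 0 ≤ q) (hpq : p + q ≤ 1)
    (hK : 3 ≤ K) {n : ℕ} {A B C : Set (Fin n)}
    (h : IsTripartition A B C ⌊p * n⌋₊ ⌊q * n⌋₊ (n - ⌊p * n⌋₊ - ⌊q * n⌋₊)) :
    IsMatchingExample K (densityH p q) (templateH A B C) := by
  obtain ⟨hABC, hAB, hAC, hBC, hA, hB, hC⟩ := h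
  refine ⟨fun i => ?_, not_hasRainbowTriangle_templateH hAB hAC hBC⟩
  obtain ⟨e0, e1, e2⟩ := edgeCount_templateH_ge hABC hAB hAC hBC
  have hn : (0 : ℝ) ≤ n := n.cast_nonneg
  have ha := Nat.floor_le (mul_nonneg hp hn)
  have hb := Nat.floor_le (mul_nonneg hq hn)
  have ha' := (Nat.lt_floor_add_one (p * n)).le
  have hb' := (Nat.lt_floor_add_one (q * n)).le
  rw [Fintype.card_fin] at e0 e1 e2
  rw [hA] at e0 e1 e2
  rw [hB] at e0 e2
  have f1 := sq_floor_ge hp (by linarith) n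
  have hpn : p * n ≤ 1 * n := mul_le_mul_of_nonneg_right (by linarith) hn
  have hqn : q * n ≤ 1 * n := mul_le_mul_of_nonneg_right (by linarith) hn
  have h0 : (0 : ℝ) ≤ ⌊p * n⌋₊ := Nat.cast_nonneg _
  have h0' : (0 : ℝ) ≤ ⌊q * n⌋₊ := Nat.cast_nonneg _
  have f2 : (⌊p * n⌋₊ : ℝ) * ⌊q * n⌋₊ ≤ (p * n) * (q * n) :=
    mul_le_mul ha hb h0' (by positivity)
  have f3 : ((1 - p) * n) ^ 2 ≤ ((n : ℝ) - ⌊p * n⌋₊) ^ 2 :=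
    pow_le_pow_left₀ (mul_nonneg (by linarith) hn) (by linarith) 2
  have f4 : (p * n) * (q * n) ≤ (⌊p * n⌋₊ : ℝ) * ⌊q * n⌋₊ + 2 * n := by
    have k1 := mul_le_mul_of_nonneg_left hb' (mul_nonneg hp hn)
    have k2 := mul_le_mul_of_nonneg_left ha' h0'
    linarith
  have h1 : p * q ≤ 1 / 4 := by nlinarith [sq_nonneg (p - q)]
  have g0 : (1 - 2 * (p * q)) * (n : ℝ) ^ 2 - 6 * n ≤ 2 * edgeCount (templateH A B C 0) := by
    linarith
  have g1 : p ^ 2 * (n : ℝ) ^ 2 - 6 * n ≤ 2 * edgeCount (templateH A B C 1) := by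
    linarith
  have g2 : ((1 - p) ^ 2 + 2 * (p * q)) * (n : ℝ) ^ 2 - 6 * n ≤
      2 * edgeCount (templateH A B C 2) := by
    linarith
  fin_cases i
  · exact mul_choose_two_sub_le (D := 1 - 2 * (p * q)) (by linarith) hK g0
  · exact mul_choose_two_sub_le (D := p ^ 2) (by positivity) hK g1
  · exact mul_choose_two_sub_le (D := (1 - p) ^ 2 + 2 * (p * q)) (by positivity) hK g2

theorem exists_isTripartition {n a b : ℕ} (h : a + b ≤ n) :
    ∃ A B C : Set (Fin n), IsTripartition A B C a b (n - a - b) := by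
  refine ⟨{i | (i : ℕ) < a}, {i | a ≤ (i : ℕ) ∧ (i : ℕ) < a + b}, {i | a + b ≤ (i : ℕ)},
    ?_, ?_, ?_, ?_, ?_, ?_, ?_⟩
  · ext i
    simp only [Set.mem_union, Set.mem_ofPred_eq, Set.mem_univ, iff_true]
    omega
  · exact Set.disjoint_left.2 fun i h1 h2 => by simp only [Set.mem_ofPred_eq] at h1 h2; omega
  · exact Set.disjoint_left.2 fun i h1 h2 => by simp only [Set.mem_ofPred_eq] at h1 h2; omega
  · exact Set.disjoint_left.2 fun i h1 h2 => by simp only [Set.mem_ofPred_eq] at h1 h2; omega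
  all_goals
    rw [← Set.ncard_image_of_injective _ Fin.val_injective]
  · have : Fin.val '' {i : Fin n | (i : ℕ) < a} = Set.Ico 0 a := by
      ext m
      simp only [Set.mem_image, Set.mem_ofPred_eq, Set.mem_Ico]
      exact ⟨fun ⟨i, h1, h2⟩ => by omega, fun h1 => ⟨⟨m, by omega⟩, by simp; omega⟩⟩
    rw [this, ← Finset.coe_Ico, Set.ncard_coe_finset, Nat.card_Ico, Nat.sub_zero]
  · have : Fin.val '' {i : Fin n | a ≤ (i : ℕ) ∧ (i : ℕ) < a + b} = Set.Ico a (a + b) := by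
      ext m
      simp only [Set.mem_image, Set.mem_ofPred_eq, Set.mem_Ico]
      exact ⟨fun ⟨i, h1, h2⟩ => by omega, fun h1 => ⟨⟨m, by omega⟩, by simp; omega⟩⟩
    rw [this, ← Finset.coe_Ico, Set.ncard_coe_finset, Nat.card_Ico]
    omega
  · have : Fin.val '' {i : Fin n | a + b ≤ (i : ℕ)} = Set.Ico (a + b) n := by
      ext m
      simp only [Set.mem_image, Set.mem_ofPred_eq, Set.mem_Ico]
      exact ⟨fun ⟨i, h1, h2⟩ => by omega, fun h1 => ⟨⟨m, by omega⟩, by simp; omega⟩⟩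
    rw [this, ← Finset.coe_Ico, Set.ncard_coe_finset, Nat.card_Ico]
    omega

/-- A strict gap in density is quadratic in `n` and absorbs the linear error; a complete graph
exceeds the cap `n.choose 2 - 1` outright. -/
theorem not_isForcingTriple_of_examples {β D : Fin 3 → ℝ} {K : ℝ}
    (h : ∀ n : ℕ, 1 ≤ n → ∃ G : ColouringTemplate 3 (Fin n), IsMatchingExample K D G ∧
      ∀ i, β i < D i ∨ G i = ⊤) (hD : ∀ i, D i ≤ 1) : ¬ IsForcingTriple β := by
  rintro ⟨-, hβ⟩
  have hev : ∀ i, ∀ᶠ n : ℕ in Filter.atTop, β i < D i →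
      β i / 2 * (n : ℝ) ^ 2 < D i * (n.choose 2 : ℝ) - K * n := by
    intro i
    by_cases hi : β i < D i
    · have := eventually_lt_choose_two (a := 1 - (D i - β i)) (b := |K| + 1) (by linarith)
      filter_upwards [this] with n hn _
      rw [choose_two_cast] at hn ⊢
      have hn0 : (0 : ℝ) ≤ n := n.cast_nonneg
      have := mul_le_mul_of_nonneg_right (le_abs_self K) hn0
      have := mul_nonneg (sub_nonneg.2 (hD i)) hn0
      nlinarith
    · exact Filter.Eventually.of_forall fun n h => absurd h hi
  obtain ⟨n, h1, h2, h3⟩ := (hβ.and ((Filter.eventually_all.2 hev).and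
    (Filter.eventually_ge_atTop 1))).exists
  obtain ⟨G, ⟨hG, hR⟩, hG'⟩ := h n h3
  refine hR (h1 G fun i => ?_)
  rcases hG' i with h4 | h4
  · exact (min_le_left _ _).trans_lt ((h2 i h4).trans_le (hG i))
  · refine (min_le_right _ _).trans_lt ?_
    rw [h4, edgeCount_eq_card_edgeFinset, SimpleGraph.card_edgeFinset_top_eq_card_choose_two,
      Fintype.card_fin]
    linarith

theorem not_isForcingTriple_of_lt_densityF {β : Fin 3 → ℝ} {x y : ℝ} (hx : 0 ≤ x) (hy : 0 ≤ y)
    (hxy : x + y ≤ 1) (h0 : β 0 < x ^ 2 + y ^ 2) (h1 : β 1 < x ^ 2 + (1 - x - y) ^ 2)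
    (h2 : β 2 < 1 - x ^ 2) : ¬ IsForcingTriple β := by
  refine not_isForcingTriple_of_examples (D := densityF x y) (K := 3) (fun n hn => ?_) fun i => ?_
  · obtain ⟨A, B, C, h⟩ := exists_isTripartition (floor_add_floor_le hx hy hxy n)
    refine ⟨_, isMatchingExample_templateF hx hy hxy le_rfl h, fun i => .inl ?_⟩
    fin_cases i
    exacts [h0, h1, h2]
  · fin_cases i
    · change x ^ 2 + y ^ 2 ≤ 1
      nlinarith [mul_nonneg hx hy]
    · change x ^ 2 + (1 - x - y) ^ 2 ≤ 1
      nlinarith [mul_nonneg hx (sub_nonneg.2 hxy), mul_nonneg hy (sub_nonneg.2 hxy)]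
    · change 1 - x ^ 2 ≤ 1
      nlinarith

theorem densityH_le_one {p q : ℝ} (hp : 0 ≤ p) (hq : 0 ≤ q) (hpq : p + q ≤ 1) (i : Fin 3) :
    densityH p q i ≤ 1 := by
  have := mul_nonneg hp hq
  have := mul_nonneg hp (sub_nonneg.2 hpq)
  fin_cases i
  · change 1 - 2 * (p * q) ≤ 1
    linarith
  · change p ^ 2 ≤ 1
    nlinarith
  · change (1 - p) ^ 2 + 2 * (p * q) ≤ 1
    nlinarith

theorem not_isForcingTriple_of_lt_densityH {β : Fin 3 → ℝ} {p q : ℝ} (hp : 0 ≤ p) (hq : 0 ≤ q)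
    (hpq : p + q ≤ 1) (h0 : β 0 < 1 - 2 * (p * q)) (h1 : β 1 < p ^ 2)
    (h2 : β 2 < (1 - p) ^ 2 + 2 * (p * q)) : ¬ IsForcingTriple β := by
  refine not_isForcingTriple_of_examples (D := densityH p q) (K := 3) (fun n hn => ?_)
    (densityH_le_one hp hq hpq)
  obtain ⟨A, B, C, h⟩ := exists_isTripartition (floor_add_floor_le hp hq hpq n)
  refine ⟨_, isMatchingExample_templateH hp hq hpq le_rfl h, fun i => .inl ?_⟩
  fin_cases i
  exacts [h0, h1, h2]

theorem templateH_zero_of_empty {V : Type*} {A B C : Set V} (hABC : A ∪ B ∪ C = Set.univ)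
    (hB : B = ∅) : templateH A B C 0 = ⊤ := by
  subst hB
  ext u v
  have hu : u ∈ A ∪ ∅ ∪ C := hABC ▸ Set.mem_univ u
  have hv : v ∈ A ∪ ∅ ∪ C := hABC ▸ Set.mem_univ v
  simp only [Set.union_empty, Set.mem_union] at hu hv
  simp only [templateH, Matrix.cons_val, SimpleGraph.sup_adj, pairsIn, pairsBetween,
    Set.empty_union, SimpleGraph.top_adj]
  tauto

/-- With `B` empty the first graph is complete, so nothing is needed of `β 0`, which may be one. -/
theorem not_isForcingTriple_of_complete {β : Fin 3 → ℝ} {p : ℝ} (hp : 0 ≤ p) (hp1 : p ≤ 1)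
    (h1 : β 1 < p ^ 2) (h2 : β 2 < (1 - p) ^ 2) : ¬ IsForcingTriple β := by
  refine not_isForcingTriple_of_examples (D := densityH p 0) (K := 3) (fun n hn => ?_)
    (densityH_le_one hp le_rfl (by linarith))
  obtain ⟨A, B, C, h⟩ := exists_isTripartition (floor_add_floor_le hp le_rfl (by linarith) n)
  refine ⟨_, isMatchingExample_templateH hp le_rfl (by linarith) le_rfl h, fun i => ?_⟩
  fin_cases i
  · refine .inr (templateH_zero_of_empty h.1 ?_)
    have := h.2.2.2.2.2.1
    rwa [zero_mul, Nat.floor_zero, Set.ncard_eq_zero] at this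
  · exact .inl h1
  · refine .inl (h2.trans_le ?_)
    change (1 - p) ^ 2 ≤ (1 - p) ^ 2 + 2 * (p * 0)
    linarith

end Densities

/-! ### Non-forcing when the first two coordinates equal the densities -/

section Perturbation

theorem not_isForcingTriple_of_densityF {α₁ α₂ t x y : ℝ} (hx : 0 ≤ x) (hy : 0 < y)
    (hyx : y ≤ x) (hxy : x + y ≤ 1) (h0 : α₁ ≤ x ^ 2 + y ^ 2)
    (h1 : α₂ ≤ x ^ 2 + (1 - x - y) ^ 2) (h2 : t < 1 - x ^ 2) :
    ¬ IsForcingTriple ![α₁, α₂, t] := by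
  obtain ⟨ε, hε, hεy, hεt⟩ : ∃ ε : ℝ, 0 < ε ∧ ε ≤ y ∧ 4 * ε ≤ 1 - x ^ 2 - t :=
    ⟨min y ((1 - x ^ 2 - t) / 4), lt_min hy (by linarith), min_le_left .., by
      linarith [min_le_right y ((1 - x ^ 2 - t) / 4)]⟩
  -- Moving `ε` from the second part to the larger first part strictly raises the first two
  -- densities, at the expense of the third, which has room.
  refine not_isForcingTriple_of_lt_densityF (x := x + ε) (y := y - ε) (by linarith) (by linarith)
    (by linarith) (h0.trans_lt ?_) (h1.trans_lt ?_) ?_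
  · nlinarith [mul_nonneg hε.le (sub_nonneg.2 hyx)]
  · nlinarith [mul_nonneg hε.le hx]
  · change t < 1 - (x + ε) ^ 2
    nlinarith

theorem not_isForcingTriple_of_densityH {α₁ α₂ t s b : ℝ} (hs : 0 < s) (hb : 0 < b)
    (hsb : s + b ≤ 1) (h0 : α₁ ≤ 1 - 2 * (s * b)) (h1 : α₂ ≤ s ^ 2)
    (h2 : t < (1 - s) ^ 2 + 2 * (s * b)) : ¬ IsForcingTriple ![α₁, α₂, t] := by
  set g := (1 - s) ^ 2 + 2 * (s * b) - t with hg
  have hsb0 := mul_pos hs hb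
  obtain ⟨ε, hε, hε1, hε2⟩ : ∃ ε : ℝ, 0 < ε ∧ ε ≤ s * b ∧ 7 * ε ≤ g :=
    ⟨min (s * b) (g / 7), lt_min hsb0 (by linarith), min_le_left .., by
      linarith [min_le_right (s * b) (g / 7)]⟩
  -- The parts become `s * (1 + η)` and `b - η`. The first part grows, the sum does not, and the
  -- product strictly falls because `b < 1`.
  obtain ⟨η, rfl⟩ : ∃ η, ε = s * η := ⟨ε / s, by field_simp⟩
  have hη : 0 < η := by by_contra! h; nlinarith
  have hηb : η ≤ b := le_of_mul_le_mul_left hε1 hs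
  have e : (s + s * η) * (b - η) = s * b - s * η + s * η * b - s * η * η := by ring
  have k1 : s * η * b ≤ s * η * 1 := mul_le_mul_of_nonneg_left (by linarith) hε.le
  have k2 : 0 < s * η * η := mul_pos hε hη
  have k3 : s * η * η ≤ s * η * b := mul_le_mul_of_nonneg_left hηb hε.le
  have k4 : s * η ≤ 1 * η := mul_le_mul_of_nonneg_right (by linarith) hη.le
  refine not_isForcingTriple_of_lt_densityH (p := s + s * η) (q := b - η) (by linarith)
    (by linarith) (by linarith) (h0.trans_lt (by linarith)) (h1.trans_lt (by nlinarith)) ?_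
  change t < (1 - (s + s * η)) ^ 2 + 2 * ((s + s * η) * (b - η))
  have k5 : s * (s * η) ≥ 0 := by positivity
  nlinarith [sq_nonneg (s * η)]

theorem not_isForcingTriple_of_lt_one {β : Fin 3 → ℝ} (hβ : ∀ i, β i ∈ Set.Icc (0 : ℝ) 1)
    (h0 : β 0 < 1) (h1 : β 1 < 1) (h2 : β 2 = 0) : ¬ IsForcingTriple β := by
  obtain ⟨m, hm0, hm1, hm2, hm3⟩ : ∃ m : ℝ, 0 ≤ m ∧ m < 1 ∧ β 0 ≤ m ∧ β 1 ≤ m :=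
    ⟨max (β 0) (β 1), (hβ 0).1.trans (le_max_left ..), max_lt h0 h1, le_max_left ..,
      le_max_right ..⟩
  have hm : m < ((1 + m) / 2) ^ 2 := by nlinarith [mul_pos (sub_pos.2 hm1) (sub_pos.2 hm1)]
  -- `((1 + m) / 2) ^ 2` exceeds `m` by a quarter of `(1 - m) ^ 2`.
  refine not_isForcingTriple_of_lt_densityF (x := (1 + m) / 2) (y := 0) (by linarith) le_rfl
    (by linarith) (by linarith) (by nlinarith [sq_nonneg (1 - (1 + m) / 2 - 0)]) ?_
  rw [h2]
  nlinarith

end Perturbation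

/-! ### Threshold and minimality statements in the two regions -/

section Threshold

theorem isForcingThreshold_of {α : Fin 3 → ℝ} (hα : ∀ i, α i ≤ 1)
    (hlo : ∀ β : Fin 3 → ℝ, (∀ i, β i ∈ Set.Icc (0 : ℝ) 1) → (∀ i, β i < α i ∨ β i = 0) →
      ¬ IsForcingTriple β)
    (hup : ∀ β : Fin 3 → ℝ, (∀ i, β i ∈ Set.Icc (0 : ℝ) 1) → (∀ i, α i ≤ β i) →
      IsForcingTriple β) : IsForcingThreshold α :=
  fun β hβ => ⟨hlo β hβ, fun h => hup β hβ fun i => (h i).elim le_of_lt fun h => h ▸ hα i⟩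

theorem isLeast_of {α₁ α₂ α₃ : ℝ} (hα : ∀ i, ![α₁, α₂, α₃] i ∈ Set.Icc (0 : ℝ) 1)
    (hlo : ∀ t, 0 ≤ t → t < α₃ → ¬ IsForcingTriple ![α₁, α₂, t])
    (hup : ∀ β : Fin 3 → ℝ, (∀ i, β i ∈ Set.Icc (0 : ℝ) 1) → (∀ i, ![α₁, α₂, α₃] i ≤ β i) →
      IsForcingTriple β) : IsLeast {t : ℝ | IsForcingTriple ![α₁, α₂, t]} α₃ := by
  refine ⟨hup _ hα fun _ => le_rfl, fun t ht => ?_⟩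
  by_contra! h
  exact hlo t (ht.1 2).1 h ht

theorem mem_Icc_vec {a b c : ℝ} (ha : a ∈ Set.Icc (0 : ℝ) 1) (hb : b ∈ Set.Icc (0 : ℝ) 1)
    (hc : c ∈ Set.Icc (0 : ℝ) 1) (i : Fin 3) : ![a, b, c] i ∈ Set.Icc (0 : ℝ) 1 := by
  fin_cases i
  exacts [ha, hb, hc]

/-- If `x` increases with `x ^ 2 + y ^ 2` fixed, then `y ≤ 1 / 2 ≤ x` makes `y` decrease at least as
much. So `1 - x - y` does not decrease, and `α₂` grows strictly. -/
theorem IsCanonicalRep.unique {α₁ α₂ x y x' y' : ℝ} (h : IsCanonicalRep α₁ α₂ x y)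
    (h' : IsCanonicalRep α₁ α₂ x' y') : x = x' ∧ y = y' := by
  have key : ∀ {x y x' y' : ℝ}, IsCanonicalRep α₁ α₂ x y → IsCanonicalRep α₁ α₂ x' y' →
      ¬ x < x' := by
    intro x y x' y' h h' hlt
    obtain ⟨h1, h2, h3, h4, h5, h6⟩ := h
    obtain ⟨h1', h2', h3', h4', h5', h6'⟩ := h'
    have e1 : (x' - x) * (x' + x) = (y - y') * (y + y') := by nlinarith
    have e2 : x' - x ≤ y - y' := by
      by_contra! hc
      have h7 : (y - y') * (y + y') ≤ (x' - x) * (y + y') :=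
        mul_le_mul_of_nonneg_right hc.le (by linarith)
      have h8 : (x' - x) * (y + y') < (x' - x) * (x' + x) :=
        mul_lt_mul_of_pos_left (by linarith) (by linarith)
      linarith
    have h9 : (1 - x - y) ^ 2 ≤ (1 - x' - y') ^ 2 :=
      pow_le_pow_left₀ (by linarith) (by linarith) 2
    nlinarith
  have hx : x = x' := le_antisymm (not_lt.1 (key h' h)) (not_lt.1 (key h h'))
  subst hx
  refine ⟨rfl, (pow_left_inj₀ h.2.1 h'.2.1 two_ne_zero).1 ?_⟩
  have h1 := h.2.2.2.2.1
  have h2 := h'.2.2.2.2.1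
  linarith

theorem isWitness_of_isCanonicalRep {α₁ α₂ x y : ℝ} (h : IsCanonicalRep α₁ α₂ x y)
    (hle : α₂ ≤ α₁) (h1 : 1 ≤ 2 * x ^ 2 + (1 - x - y) ^ 2) :
    IsWitness ![α₁, α₂, 1 - x ^ 2] x y (1 - x - y) := by
  obtain ⟨hx, hy, hx2, hxy, rfl, rfl⟩ := h
  have hzy : 1 - x - y ≤ y := by
    refine le_of_pow_le_pow_left₀ two_ne_zero hy ?_
    linarith
  refine ⟨hzy, by linarith, by ring, by nlinarith, ?_, ?_, .inr ?_, ?_⟩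
  · change y ^ 2 ≤ x ^ 2 + y ^ 2 + (x ^ 2 + (1 - x - y) ^ 2) - 1
    linarith
  · change y ^ 2 ≤ x ^ 2 + y ^ 2 + (1 - x ^ 2) - 1
    linarith
  · change (1 - x - y) ^ 2 ≤ x ^ 2 + (1 - x - y) ^ 2 + (1 - x ^ 2) - 1
    linarith
  · change _ ≤ x ^ 2 + y ^ 2 + (x ^ 2 + (1 - x - y) ^ 2) + (1 - x ^ 2) - 1
    linarith

theorem isForcingThreshold_of_isCanonicalRep {α₁ α₂ x y : ℝ} (h : IsCanonicalRep α₁ α₂ x y)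
    (hα₁ : α₁ ∈ Set.Icc (0 : ℝ) 1) (hα₂ : α₂ ∈ Set.Icc (0 : ℝ) 1)
    (hle : α₂ ≤ α₁) (h1 : 1 ≤ 2 * x ^ 2 + (1 - x - y) ^ 2) :
    IsForcingThreshold ![α₁, α₂, 1 - x ^ 2] ∧
      IsLeast {t : ℝ | IsForcingTriple ![α₁, α₂, t]} (1 - x ^ 2) := by
  have hW := isWitness_of_isCanonicalRep h hle h1
  have hzy := hW.z_le_y
  obtain ⟨hx, hy, hx2, hxy, e1, e2⟩ := h
  have hα := mem_Icc_vec hα₁ hα₂ (c := 1 - x ^ 2) ⟨by nlinarith, by nlinarith⟩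
  -- If `y = 0`, then `x = 1` and the triple is `(1, 1, 0)`: the witness argument needs densities
  -- below one, and the perturbation needs `y > 0`.
  rcases hy.eq_or_lt with hy0 | hy0
  · have hx1 : x = 1 := by linarith
    have e1 : α₁ = 1 := by rw [e1, ← hy0, hx1]; norm_num
    have e2 : α₂ = 1 := by rw [e2, ← hy0, hx1]; norm_num
    have hup : ∀ β : Fin 3 → ℝ, (∀ i, β i ∈ Set.Icc (0 : ℝ) 1) →
        (∀ i, ![α₁, α₂, 1 - x ^ 2] i ≤ β i) → IsForcingTriple β := fun β hβ h =>
      isForcingTriple_of_one_one hβ (le_antisymm (hβ 0).2 (e1 ▸ h 0))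
        (le_antisymm (hβ 1).2 (e2 ▸ h 1))
    refine ⟨isForcingThreshold_of (fun i => (hα i).2) (fun β hβ h => ?_) hup,
      isLeast_of hα (fun t ht h => ?_) hup⟩
    · have h0 := h 0
      have h1 := h 1
      have h2 := h 2
      simp only [Matrix.cons_val, e1, e2, hx1] at h0 h1 h2
      refine not_isForcingTriple_of_lt_one hβ (h0.elim id fun h => by linarith)
        (h1.elim id fun h => by linarith) (h2.elim (fun h => ?_) id)
      linarith [(hβ 2).1]
    · rw [hx1] at h
      linarith
  · have l0 : α₁ < 1 := by nlinarith
    have hup : ∀ β : Fin 3 → ℝ, (∀ i, β i ∈ Set.Icc (0 : ℝ) 1) →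
        (∀ i, ![α₁, α₂, 1 - x ^ 2] i ≤ β i) → IsForcingTriple β := fun β hβ h =>
      hW.isForcingTriple (fun i => by
        fin_cases i
        · exact l0
        · exact hle.trans_lt l0
        · change 1 - x ^ 2 < 1
          nlinarith) hβ h
    refine ⟨isForcingThreshold_of (fun i => (hα i).2) (fun β hβ h => ?_) hup,
      isLeast_of hα (fun t ht h => not_isForcingTriple_of_densityF hx hy0 (by linarith) hxy e1.le
        e2.le h) hup⟩
    have h0 := h 0
    have h1 := h 1
    have h2 := h 2
    simp only [Matrix.cons_val] at h0 h1 h2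
    refine not_isForcingTriple_of_lt_densityF hx hy hxy
      (e1 ▸ h0.elim id fun h => ?_) (e2 ▸ h1.elim id fun h => ?_) (h2.elim id fun h => ?_)
    · rw [h]; nlinarith
    · rw [h]; nlinarith
    · rw [h]; nlinarith

theorem isWitness_of_mem_regionR2 {α₁ s : ℝ} (hs : 1 / 2 ≤ s) (hs1 : s ≤ 1)
    (h1 : 2 - 2 * s ≤ α₁) : IsWitness ![α₁, s ^ 2, 2 - α₁ - 2 * s + s ^ 2] s (1 - s) 0 := by
  refine ⟨by linarith, by linarith, by ring, by nlinarith [sq_nonneg (s - 1 / 2)], ?_, ?_,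
    .inl rfl, ?_⟩
  · change (1 - s) ^ 2 ≤ α₁ + s ^ 2 - 1
    linarith
  · change (1 - s) ^ 2 ≤ α₁ + (2 - α₁ - 2 * s + s ^ 2) - 1
    linarith
  · change s ^ 2 + (1 - s) ^ 2 + 0 ^ 2 ≤ α₁ + s ^ 2 + (2 - α₁ - 2 * s + s ^ 2) - 1
    linarith

theorem isForcingThreshold_of_mem_regionR2 {α₁ s : ℝ} (hs : 1 / 2 ≤ s) (hs1 : s ≤ 1)
    (hα₁ : α₁ ≤ 1) (h1 : 2 - 2 * s ≤ α₁) (h2 : 1 - 2 * s + 2 * s ^ 2 ≤ α₁) :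
    IsForcingThreshold ![α₁, s ^ 2, 2 - α₁ - 2 * s + s ^ 2] ∧
      IsLeast {t : ℝ | IsForcingTriple ![α₁, s ^ 2, t]} (2 - α₁ - 2 * s + s ^ 2) := by
  have hW := isWitness_of_mem_regionR2 hs hs1 h1
  set α₃ := 2 - α₁ - 2 * s + s ^ 2 with hα₃
  have hα := mem_Icc_vec (a := α₁) (b := s ^ 2) (c := α₃) ⟨by linarith, hα₁⟩
    ⟨by nlinarith, by nlinarith⟩ ⟨by nlinarith, by nlinarith⟩
  have hup : ∀ β : Fin 3 → ℝ, (∀ i, β i ∈ Set.Icc (0 : ℝ) 1) →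
      (∀ i, ![α₁, s ^ 2, α₃] i ≤ β i) → IsForcingTriple β := by
    intro β hβ h
    rcases hα₁.eq_or_lt with e1 | l1
    · have b0 : β 0 = 1 := le_antisymm (hβ 0).2 (e1 ▸ h 0)
      rcases hs1.eq_or_lt with e2 | l2
      · refine isForcingTriple_of_one_one hβ b0 (le_antisymm (hβ 1).2 (le_trans ?_ (h 1)))
        change 1 ≤ s ^ 2
        rw [e2]; norm_num
      · refine isForcingTriple_of_one hβ b0 hs l2 (h 1) (le_trans ?_ (h 2))
        change (1 - s) ^ 2 ≤ α₃
        nlinarith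
    · refine hW.isForcingTriple (fun i => ?_) hβ h
      have : s ^ 2 < 1 := by
        rcases hs1.eq_or_lt with e2 | l2
        · rw [e2] at h2; linarith
        · nlinarith
      fin_cases i
      · exact l1
      · exact this
      · change α₃ < 1
        linarith
  -- This second part solves `1 - 2 * (p * q) = α₁` for `p = s`.
  have hq0 : 0 ≤ (1 - α₁) / (2 * s) := div_nonneg (by linarith) (by linarith)
  have hsq : s * ((1 - α₁) / (2 * s)) = (1 - α₁) / 2 := by field_simp
  have hq1 : s + (1 - α₁) / (2 * s) ≤ 1 := by
    rw [← le_sub_iff_add_le', div_le_iff₀ (by linarith)]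
    nlinarith
  refine ⟨isForcingThreshold_of (fun i => (hα i).2) (fun β hβ h => ?_) hup,
    isLeast_of hα (fun t ht h => ?_) hup⟩
  · have b0 := h 0
    have b1 := h 1
    have b2 := h 2
    simp only [Matrix.cons_val] at b0 b1 b2
    have l0 : β 0 < α₁ := b0.elim id fun h => by rw [h]; nlinarith [sq_nonneg (s - 1 / 2)]
    have l1 : β 1 < s ^ 2 := b1.elim id fun h => by rw [h]; nlinarith
    have h3 : 0 ≤ α₃ := (hα 2).1
    rcases h3.eq_or_lt with e3 | l3
    · exact not_isForcingTriple_of_lt_one hβ (by linarith) (by nlinarith)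
        (b2.elim (fun h => by linarith [(hβ 2).1]) id)
    · refine not_isForcingTriple_of_lt_densityH (p := s) (q := (1 - α₁) / (2 * s)) (by linarith) hq0
        hq1 (by rw [hsq]; linarith) l1 ?_
      rw [hsq]
      have l2 : β 2 < α₃ := b2.elim id fun h => by linarith
      linarith
  -- For `α₁ = 1` the second part is empty and cannot be perturbed. The complete template is used
  -- instead, with `p` slightly above `s`.
  · rcases hα₁.eq_or_lt with e1 | l1
    · have hlt : t < (1 - s) ^ 2 := by rw [hα₃, e1] at h; linarith
      refine not_isForcingTriple_of_complete (p := s + ((1 - s) ^ 2 - t) / 4) (by linarith)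
        (by nlinarith) ?_ ?_
      · change s ^ 2 < _
        nlinarith
      · change t < _
        nlinarith [sq_nonneg ((1 - s) ^ 2 - t)]
    · refine not_isForcingTriple_of_densityH (by linarith)
        (div_pos (by linarith) (by linarith : 0 < 2 * s)) hq1 (by rw [hsq]; linarith) le_rfl ?_
      rw [hsq]
      linarith

end Threshold

/-! ### Non-forcing outside the two regions -/

section Outside

theorem nine_mul_tau_sq : 9 * tau ^ 2 - 8 * tau + 1 = 0 := by
  have h : √7 ^ 2 = (7 : ℝ) := Real.sq_sqrt (by norm_num)
  unfold tau
  linarith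

theorem tau_mem : 0 < tau ∧ tau < 1 / 3 := by
  have h1 : √7 < 4 := by rw [Real.sqrt_lt' (by norm_num)]; norm_num
  have h2 : 1 < √7 := by rw [Real.lt_sqrt (by norm_num)]; norm_num
  unfold tau
  constructor <;> linarith

theorem exists_isCanonicalRep {α₁ s : ℝ} (hs0 : 0 ≤ s) (hs1 : s ≤ 1) (hs : 1 / 2 ≤ s ^ 2)
    (hle : s ^ 2 ≤ α₁) (h : α₁ < 1 - 2 * s + 2 * s ^ 2) :
    ∃ x y, IsCanonicalRep α₁ (s ^ 2) x y := by
  -- The third part `z` is the parameter: `x = √(s ^ 2 - z ^ 2)` keeps `α₂` fixed, and `f z` is the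
  -- resulting first density. At `1 / 5` one has `3 / 5 ≤ x ≤ 1`, so `(4 / 5 - x) ^ 2 ≤ (1 / 5) ^ 2`
  -- and `f` is at most `s ^ 2`.
  set f : ℝ → ℝ := fun z => (s ^ 2 - z ^ 2) + (1 - √(s ^ 2 - z ^ 2) - z) ^ 2 with hf
  have hcont : ContinuousOn f (Set.Icc 0 (1 / 5)) := by
    refine Continuous.continuousOn ?_
    fun_prop
  have h0 : α₁ ≤ f 0 := by
    have : f 0 = s ^ 2 + (1 - s) ^ 2 := by
      simp only [hf]
      rw [show s ^ 2 - 0 ^ 2 = s ^ 2 by ring, Real.sqrt_sq hs0]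
      ring
    rw [this]
    linarith
  have h1 : f (1 / 5) ≤ α₁ := by
    have e1 : √(s ^ 2 - (1 / 5) ^ 2) ≤ 1 := Real.sqrt_le_one.2 (by nlinarith)
    have e2 : 3 / 5 ≤ √(s ^ 2 - (1 / 5) ^ 2) := Real.le_sqrt_of_sq_le (by linarith)
    refine le_trans ?_ hle
    simp only [hf]
    nlinarith
  obtain ⟨z, ⟨hz0, hz1⟩, hz⟩ := intermediate_value_Icc' (by norm_num) hcont ⟨h1, h0⟩
  have hzs : 0 ≤ s ^ 2 - z ^ 2 := by nlinarith
  set x := √(s ^ 2 - z ^ 2) with hx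
  have hx2 : x ^ 2 = s ^ 2 - z ^ 2 := Real.sq_sqrt hzs
  have hx0 : 1 / 2 ≤ x := Real.le_sqrt_of_sq_le (by nlinarith)
  have e1 : α₁ = x ^ 2 + (1 - x - z) ^ 2 := by rw [hx2, ← hz]
  have hx1 : x ≤ 1 := by nlinarith
  refine ⟨x, 1 - x - z, by linarith, ?_, hx0, by linarith, e1, by rw [hx2]; ring⟩
  -- From `s ^ 2 ≤ α₁` the second part is at least `z` in absolute value. If it were negative, this
  -- would force `x = 1` and `z > 0`, contradicting `x ^ 2 + z ^ 2 = s ^ 2 ≤ 1`.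
  by_contra! hneg
  have h3 : z ≤ -(1 - x - z) := by
    refine le_of_pow_le_pow_left₀ two_ne_zero (by linarith) ?_
    rw [neg_sq]
    linarith
  have h4 : x = 1 := by linarith
  rw [h4] at hx2 hneg
  nlinarith

theorem not_isForcingTriple_of_ge {α₁ s : ℝ} (hs0 : 0 ≤ s) (hα₁ : α₁ ≤ 1)
    (h : 1 - 2 * s + 2 * s ^ 2 ≤ α₁) (h1 : α₁ < 2 - 2 * s) :
    ¬ IsForcingTriple ![α₁, s ^ 2, s ^ 2] := by
  rcases hα₁.eq_or_lt with e | l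
  · have : s ^ 2 < (1 / 2) ^ 2 := pow_lt_pow_left₀ (by linarith) hs0 two_ne_zero
    refine not_isForcingTriple_of_complete (p := 1 / 2) (by norm_num) (by norm_num) this ?_
    change s ^ 2 < _
    linarith
  · have hs : 0 < s := by
      rcases hs0.eq_or_lt with e | hs
      · rw [← e] at h
        linarith
      · exact hs
    have hsq : s * ((1 - α₁) / (2 * s)) = (1 - α₁) / 2 := by field_simp
    have hq1 : s + (1 - α₁) / (2 * s) ≤ 1 := by
      rw [← le_sub_iff_add_le', div_le_iff₀ (by linarith)]
      nlinarith
    refine not_isForcingTriple_of_densityH hs (div_pos (by linarith) (by linarith : 0 < 2 * s)) hq1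
      (by rw [hsq]; linarith) le_rfl ?_
    rw [hsq]
    linarith

theorem not_isForcingTriple_of_sq_lt_half {α₁ s : ℝ} (hs0 : 0 ≤ s)
    (h : α₁ < 1 - 2 * s + 2 * s ^ 2) (hs : s ^ 2 < 1 / 2) :
    ¬ IsForcingTriple ![α₁, s ^ 2, s ^ 2] := by
  obtain ⟨ε, hε, h1, h2⟩ : ∃ ε : ℝ, 0 < ε ∧ 4 * ε ≤ 1 - 2 * s + 2 * s ^ 2 - α₁ ∧
      4 * ε ≤ 1 - 2 * s ^ 2 := by
    refine ⟨min (1 - 2 * s + 2 * s ^ 2 - α₁) (1 - 2 * s ^ 2) / 4,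
      div_pos (lt_min (by linarith) (by linarith)) (by norm_num), ?_, ?_⟩
    · linarith [min_le_left (1 - 2 * s + 2 * s ^ 2 - α₁) (1 - 2 * s ^ 2)]
    · linarith [min_le_right (1 - 2 * s + 2 * s ^ 2 - α₁) (1 - 2 * s ^ 2)]
  have hs1 : s < 1 := by nlinarith
  have h3 : 0 ≤ 1 - s - ε := by nlinarith
  refine not_isForcingTriple_of_lt_densityF (x := s + ε) (y := 1 - s - ε) (by linarith) h3
    (by linarith) ?_ ?_ ?_
  · change α₁ < _
    nlinarith [mul_nonneg hs0 hε.le]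
  · change s ^ 2 < _
    nlinarith [mul_nonneg hs0 hε.le, sq_nonneg (1 - (s + ε) - (1 - s - ε))]
  · change s ^ 2 < _
    nlinarith

theorem not_isForcingTriple_of_not_mem {α₁ s : ℝ} (hs0 : 0 ≤ s) (hs1 : s ≤ 1)
    (hα₁ : α₁ ∈ Set.Icc (0 : ℝ) 1) (hle : s ^ 2 ≤ α₁) (h1 : (α₁, s ^ 2) ∉ regionR1')
    (h2 : (α₁, s ^ 2) ∉ regionR2) : ¬ IsForcingTriple ![α₁, s ^ 2, s ^ 2] := by
  have hα₂ : s ^ 2 ∈ Set.Icc (0 : ℝ) 1 := ⟨sq_nonneg s, by nlinarith⟩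
  rcases le_or_gt (1 - 2 * s + 2 * s ^ 2) α₁ with h | h
  · refine not_isForcingTriple_of_ge hs0 hα₁.2 h ?_
    by_contra! hc
    refine h2 ⟨hα₁, hα₂, ?_⟩
    simp only [Real.sqrt_sq hs0]
    exact max_le hc h
  rcases lt_or_ge (s ^ 2) (1 / 2) with hs | hs
  · exact not_isForcingTriple_of_sq_lt_half hs0 h hs
  rcases lt_or_ge α₁ ((1 + tau ^ 2) / 2) with ht | ht
  · have h3 := nine_mul_tau_sq
    obtain ⟨h4, h5⟩ := tau_mem
    -- With the second and third parts both of proportion `tau`, the equation `9 * tau ^ 2 - 8 * tau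
    -- + 1 = 0` makes all three densities equal to `(1 + tau ^ 2) / 2`.
    refine not_isForcingTriple_of_lt_densityF (x := 1 - 2 * tau) (y := tau) (by linarith) h4.le
      (by linarith) ?_ ?_ ?_
    · change α₁ < _
      nlinarith
    · change s ^ 2 < _
      nlinarith
    · change s ^ 2 < _
      nlinarith
  obtain ⟨x, y, hrep⟩ := exists_isCanonicalRep hs0 hs1 hs hle h
  -- All other conditions of the first region hold, so this one must fail. It says that the third
  -- density `1 - x ^ 2` exceeds `α₂`.
  have h3 : 2 * x ^ 2 + (1 - x - y) ^ 2 < 1 := by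
    by_contra! hc
    refine h1 ⟨⟨hα₁, hα₂, ?_, ?_⟩, x, y, hrep, hc⟩
    · exact max_le (max_le (by linarith) ht) hle
    · simp only [Real.sqrt_sq hs0]
      exact h.le
  obtain ⟨hx, hy, hx2, hxy, e1, e2⟩ := hrep
  have hy0 : 0 < y := by
    rcases hy.eq_or_lt with h0 | h0
    · rw [← h0] at e1 e2 h3
      have h6 : (1 - x) ^ 2 ≤ 0 := by nlinarith
      have h7 : 1 - x = 0 := by nlinarith [sq_nonneg (1 - x)]
      nlinarith
    · exact h0
  exact not_isForcingTriple_of_densityF hx hy0 (by linarith) hxy e1.le e2.le (by linarith)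

end Outside

end RainbowTriangle

/-! ### Assembly of the three statements -/

theorem mainTheorem1 :
    ∃ K : ℝ, 0 < K ∧ ∀ α₁ α₂ : ℝ, α₁ ∈ Set.Icc (0 : ℝ) 1 → α₂ ∈ Set.Icc (0 : ℝ) 1 → α₂ ≤ α₁ →
      -- (a)
      ((α₁, α₂) ∈ RainbowTriangle.regionR1' →
        ∀ x y α₃ : ℝ, RainbowTriangle.IsCanonicalRep α₁ α₂ x y → α₃ = 1 - x ^ 2 →
          α₃ ≤ α₂ ∧
          RainbowTriangle.ForcesUpToLinear K ![α₁, α₂, α₃] ∧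
          (∀ n a b : ℕ, 1 ≤ n → a = ⌊x * n⌋₊ → b = ⌊y * n⌋₊ → a + b ≤ n ∧
            ∀ A B C : Set (Fin n), RainbowTriangle.IsTripartition A B C a b (n - a - b) →
              RainbowTriangle.IsMatchingExample K ![α₁, α₂, α₃]
                (RainbowTriangle.templateF A B C)) ∧
          RainbowTriangle.IsForcingThreshold ![α₁, α₂, α₃] ∧
          IsLeast {t : ℝ | RainbowTriangle.IsForcingTriple ![α₁, α₂, t]} α₃) ∧
      -- (b)
      ((α₁, α₂) ∈ RainbowTriangle.regionR2 →
        ∀ α₃ : ℝ, α₃ = 2 - α₁ - 2 * √α₂ + α₂ →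
          α₃ ≤ α₂ ∧
          RainbowTriangle.ForcesUpToLinear K ![α₁, α₂, α₃] ∧
          (∀ n a b : ℕ, 1 ≤ n → a = ⌊√α₂ * n⌋₊ → b = ⌊(1 - α₁) / (2 * √α₂) * n⌋₊ → a + b ≤ n ∧
            ∀ A B C : Set (Fin n), RainbowTriangle.IsTripartition A B C a b (n - a - b) →
              RainbowTriangle.IsMatchingExample K ![α₁, α₂, α₃]
                (RainbowTriangle.templateH A B C)) ∧
          RainbowTriangle.IsForcingThreshold ![α₁, α₂, α₃] ∧
          IsLeast {t : ℝ | RainbowTriangle.IsForcingTriple ![α₁, α₂, t]} α₃) ∧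
      -- (c)
      ((α₁, α₂) ∉ RainbowTriangle.regionR1' ∪ RainbowTriangle.regionR2 →
        ¬ RainbowTriangle.IsForcingTriple ![α₁, α₂, α₂]) := by
  open RainbowTriangle in
  -- Rounding the parts and omitting the diagonal cost at most `6 * n` in twice an edge count, hence
  -- `3`; forcing only needs a constant at least one.
  refine ⟨3, by norm_num, fun α₁ α₂ hα₁ hα₂ hle => ⟨?_, ?_, ?_⟩⟩
  · rintro ⟨-, x₀, y₀, hrep₀, h1⟩ x y α₃ hrep rfl
    obtain ⟨rfl, rfl⟩ := hrep₀.unique hrep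
    have hW := isWitness_of_isCanonicalRep hrep hle h1
    have hT := isForcingThreshold_of_isCanonicalRep hrep hα₁ hα₂ hle h1
    obtain ⟨hx, hy, hx2, hxy, rfl, rfl⟩ := hrep
    refine ⟨by linarith, hW.forcesUpToLinear (fun i => ?_) (by norm_num), ?_, hT⟩
    · exact (mem_Icc_vec hα₁ hα₂ (c := 1 - x₀ ^ 2) ⟨by nlinarith, by nlinarith⟩ i).2
    · rintro n a b - rfl rfl
      exact ⟨floor_add_floor_le hx hy hxy n, fun A B C h =>
        isMatchingExample_templateF hx hy hxy le_rfl h⟩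
  · rintro ⟨-, -, hR⟩ α₃ rfl
    obtain ⟨s, hs0, rfl⟩ : ∃ s : ℝ, 0 ≤ s ∧ α₂ = s ^ 2 :=
      ⟨√α₂, Real.sqrt_nonneg _, (Real.sq_sqrt hα₂.1).symm⟩
    simp only [Real.sqrt_sq hs0] at hR ⊢
    obtain ⟨h1, h2⟩ := max_le_iff.1 hR
    have hs1 : s ≤ 1 := by nlinarith [hα₂.2]
    have hs : 1 / 2 ≤ s := by linarith [hα₁.2]
    have hW := isWitness_of_mem_regionR2 hs hs1 h1
    refine ⟨by linarith, hW.forcesUpToLinear (fun i => ?_) (by norm_num), ?_,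
      isForcingThreshold_of_mem_regionR2 hs hs1 hα₁.2 h1 h2⟩
    · exact (mem_Icc_vec hα₁ hα₂ (c := 2 - α₁ - 2 * s + s ^ 2)
        ⟨by nlinarith [hα₁.2], by nlinarith⟩ i).2
    · have hq0 : 0 ≤ (1 - α₁) / (2 * s) := div_nonneg (by linarith [hα₁.2]) (by linarith)
      have hsq : s * ((1 - α₁) / (2 * s)) = (1 - α₁) / 2 := by field_simp
      have hq1 : s + (1 - α₁) / (2 * s) ≤ 1 := by
        rw [← le_sub_iff_add_le', div_le_iff₀ (by linarith)]
        nlinarith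
      rintro n a b - rfl rfl
      refine ⟨floor_add_floor_le hs0 hq0 hq1 n, fun A B C h => ?_⟩
      have := isMatchingExample_templateH hs0 hq0 hq1 (le_refl (3 : ℝ)) h
      rw [densityH, hsq] at this
      convert this using 3
      · ring
      · congr 1; ring
  · intro h
    obtain ⟨s, hs0, rfl⟩ : ∃ s : ℝ, 0 ≤ s ∧ α₂ = s ^ 2 :=
      ⟨√α₂, Real.sqrt_nonneg _, (Real.sq_sqrt hα₂.1).symm⟩
    rw [Set.mem_union, not_or] at h
    exact not_isForcingTriple_of_not_mem hs0 (by nlinarith [hα₂.2]) hα₁ hle h.1 h.2
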